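/- All vector spaces are over $\mathbb C$. For a vector space $W$ put $\mathcal E(W)=\mathrm{Hom}(W,W((x)))$. A subset $U\subseteq\mathcal E(W)$ is called *quasi $\mathcal S_{trig}$-local* if for all $a(x),b(x)\in U$ there are finitely many $a^{(i)}(x),b^{(i)}(x)\in U$, $f_i\in\mathbb C(x)$ $(1\le i\le r)$ and a nonzero polynomial $p$ with $$p(x/z)\,a(x)b(z)=p(x/z)\sum_{i=1}^r\iota_{z,x}\big(f_i(z/x)\big)\,b^{(i)}(z)a^{(i)}(x),$$ where $\iota_{z,x}$ is the expansion in $\mathbb C((z))((x))$. A pair $(a(x),b(x))$ in $\mathcal E(W)$ is *quasi compatible* if $p(x_1/x)a(x_1)b(x)\in\mathrm{Hom}(W,W((x_1,x)))$ for some nonzero polynomial $p$; then the fields $a(x)^e_nb(x)\in\mathcal E(W)$, $n\in\mathbb Z$, are defined by $$Y^e_{\mathcal E}(a(x),z)b(x)=\sum_{n\in\mathbb Z}a(x)^e_nb(x)\,z^{-n-1}=p(e^z)^{-1}\big(p(x_1/x)a(x_1)b(x)\big)\big|_{x_1=xe^z}$$ with $p(e^z)^{-1}$ taken in $\mathbb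 C((z))$; they do not depend on $p$. For pairs that are not quasi compatible put $a(x)^e_nb(x)=0$. Let $\langle U\rangle_e$ be the smallest subspace of $\mathcal E(W)$ that contains $U$ and $1_W$ and is closed under all products $a(x)^e_nb(x)$. A *weak quantum vertex algebra* is a vector space $V$ with a linear map $Y(\cdot,x):V\to\mathrm{Hom}(V,V((x)))$ and a vector $\mathbf 1\in V$ such that $Y(\mathbf 1,x)v=v$, $Y(v,x)\mathbf 1\in V[[x]]$ and $\lim_{x\to0}Y(v,x)\mathbf 1=v$ for $v\in V$, and such that for all $u,v\in V$ there are finitely many $u^{(i)},v^{(i)}\in V$, $f_i\in\mathbb C((x))$ with $$x_0^{-1}\delta\Big(\frac{x_1-x_2}{x_0}\Big)Y(u,x_1)Y(v,x_2)-x_0^{-1}\delta\Big(\frac{x_2-x_1}{-x_0}\Big)\sum_i f_i(x_2-x_1)Y(v^{(i)},x_2)Y(u^{(i)},x_1)=x_2^{-1}\delta\Big(\frac{x_1-x_0}{x_2}\Big)Y(Y(u,x_0)v,x_2).$$ An *automorphism* of $V$ is a bijective linear map $\sigma:V\to V$ with $\sigma(\mathbf 1)=\mathbf 1$ and $\sigma(Y(u,x)v)=Y(\sigma(u),x)\sigma(v)$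 for $u,v\in V$. **Proposition.** Let $W$ be a vector space, let $\Gamma$ be a subgroup of $\mathbb C^\times$, and let $U$ be a quasi $\mathcal S_{trig}$-local subset of $\mathcal E(W)$ that is $\Gamma$-stable, i.e. $a(\lambda x)\in U$ for all $\lambda\in\Gamma$, $a(x)\in U$. Then every pair in $\langle U\rangle_e$ is quasi compatible, $(\langle U\rangle_e,Y^e_{\mathcal E},1_W)$ is a weak quantum vertex algebra, $\langle U\rangle_e$ is $\Gamma$-stable, and $\Gamma$ acts on the weak quantum vertex algebra $\langle U\rangle_e$ by automorphisms through $\lambda\mapsto\big(a(x)\mapsto a(\lambda x)\big)$. -/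

import Mathlib

noncomputable section

namespace TrigQVA

open HVertexOperator (coeff)

/-! ### Formal series

`VertexOperator ℂ W` is `Hom (W, W((x)))`, that is, the space `E(W)` of fields `a(x)` on `W`;
`coeff a n : W →ₗ[ℂ] W` is the coefficient of `x ^ n` in `a(x)`.
A formal series in two variables with coefficients in `W` is a function `ℤ → ℤ → W`,
whose value at `m n` is the coefficient of `x₁ ^ m * x₂ ^ n`. -/

/-- The product `a(x₁) b(x₂) w`. -/
def prod₂ {W : Type*} [AddCommGroup W] [Module ℂ W] (a b : VertexOperator ℂ W) (w : W) :
    ℤ → ℤ → W :=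
  fun m n => coeff a m (coeff b n w)

/-- `f(x - y)` for `f ∈ ℂ((x))`, expanded in nonnegative powers of `y` by
`(x - y) ^ k = ∑ j ≥ 0, (-1) ^ j * (k choose j) * x ^ (k - j) * y ^ j`;
the value at `i j` is the coefficient of `x ^ i * y ^ j`. -/
def subExpand (f : LaurentSeries ℂ) (i j : ℤ) : ℂ :=
  if 0 ≤ j then f.coeff (i + j) * ((-1) ^ j.toNat * (Ring.choose (i + j) j.toNat : ℤ)) else 0

/-- The power `(x - y) ^ l`, for `l ∈ ℤ`, expanded in nonnegative powers of `y`. -/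
def subPow (l : ℤ) : ℤ → ℤ → ℂ := subExpand (HahnSeries.single l 1)

/-- The product of a scalar series `g(x₁, x₂)` and a series `A(x₁, x₂)`; it is only used where
every coefficient is a finite sum. -/
def mul₂ {W : Type*} [AddCommGroup W] [Module ℂ W] (g : ℤ → ℤ → ℂ) (A : ℤ → ℤ → W) :
    ℤ → ℤ → W :=
  fun m n => ∑ᶠ ij : ℤ × ℤ, g ij.1 ij.2 • A (m - ij.1) (n - ij.2)

/-! ### Weak quantum vertex algebras -/

/-- A weak quantum vertex algebra structure on the vector space `V`. -/
structure WeakQVA (V : Type*) [AddCommGroup V] [Module ℂ V] where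
  /-- the vacuum vector -/
  vac : V
  /-- the vertex operator map `v ↦ Y(v, x)` -/
  Y : V →ₗ[ℂ] VertexOperator ℂ V
  /-- `Y(1, x) v = v` -/
  vacuum : ∀ (v : V) (n : ℤ), coeff (Y vac) n v = if n = 0 then v else 0
  /-- `Y(v, x) 1 ∈ V[[x]]` -/
  creation : ∀ (v : V) (n : ℤ), n < 0 → coeff (Y v) n vac = 0
  /-- `Y(v, x) 1` tends to `v` as `x → 0` -/
  creation_zero : ∀ v : V, coeff (Y v) 0 vac = v
  /-- The `S`-Jacobi identity
  `x₀⁻¹ δ((x₁ - x₂)/x₀) Y(u, x₁) Y(v, x₂)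
    - x₀⁻¹ δ((x₂ - x₁)/(-x₀)) ∑ i, fᵢ(x₂ - x₁) Y(v⁽ⁱ⁾, x₂) Y(u⁽ⁱ⁾, x₁)
    = x₂⁻¹ δ((x₁ - x₀)/x₂) Y(Y(u, x₀) v, x₂)`,
  applied to `w`, as an equality of the coefficients of `x₀ ^ (-l - 1) * x₁ ^ m * x₂ ^ n`. -/
  jacobi : ∀ u v : V, ∃ (r : ℕ) (u' v' : Fin r → V) (f : Fin r → LaurentSeries ℂ),
    ∀ (w : V) (l m n : ℤ),
      mul₂ (subPow l) (prod₂ (Y u) (Y v) w) m n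
        - (-1 : ℂ) ^ l • mul₂ (subPow l)
            (∑ i, mul₂ (subExpand (f i)) (prod₂ (Y (v' i)) (Y (u' i)) w)) n m
      = ∑ᶠ i : ℕ, ((-1 : ℂ) ^ i * (Ring.choose (m + i) i : ℤ)) •
          coeff (Y (coeff (Y u) (-l - 1 - i) v)) (n + m + i + 1) w

/-- The group of automorphisms of a weak quantum vertex algebra: the bijective linear maps `σ` with
`σ(1) = 1` and `σ(Y(u, x) v) = Y(σ(u), x) σ(v)`. -/
def WeakQVA.aut {V : Type*} [AddCommGroup V] [Module ℂ V] (𝒱 : WeakQVA V) :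
    Subgroup (V ≃ₗ[ℂ] V) where
  carrier := {σ | σ 𝒱.vac = 𝒱.vac ∧
    ∀ (u v : V) (n : ℤ), σ (coeff (𝒱.Y u) n v) = coeff (𝒱.Y (σ u)) n (σ v)}
  one_mem' := ⟨rfl, fun _ _ _ => rfl⟩
  mul_mem' {σ τ} hσ hτ := by
    refine ⟨?_, fun u v n => ?_⟩
    · rw [LinearEquiv.mul_apply, hτ.1, hσ.1]
    · rw [LinearEquiv.mul_apply, hτ.2, hσ.2]; rfl
  inv_mem' {σ} hσ := by
    refine ⟨?_, fun u v n => ?_⟩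
    · apply σ.injective
      rw [hσ.1]
      exact σ.apply_symm_apply _
    · apply σ.injective
      rw [hσ.2]
      exact (σ.apply_symm_apply _).trans
        (congrArg₂ (fun a b => coeff (𝒱.Y a) n b)
          (σ.apply_symm_apply u).symm (σ.apply_symm_apply v).symm)

section Fields

variable {W : Type*} [AddCommGroup W] [Module ℂ W]

/-! ### Quasi locality and quasi compatibility of fields -/

/-- The product `p(x₁/x₂) A(x₁, x₂)` for a polynomial `p`. -/
def polyMul (p : Polynomial ℂ) (A : ℤ → ℤ → W) : ℤ → ℤ → W :=
  fun m n => p.sum fun j c => c • A (m - j) (n + j)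

/-- The rational function `f(t)`, expanded at `t = ∞`: the Laurent series in `s` that is the image
of `f` under the embedding `ℂ(t) → ℂ((s))` with `t ↦ s⁻¹`. -/
def expandAtInfty (f : RatFunc ℂ) : LaurentSeries ℂ :=
  RatFunc.eval (HahnSeries.C : ℂ →+* LaurentSeries ℂ) (HahnSeries.single (-1) 1) f

/-- The product `ι(f(x₂/x₁)) A(x₁, x₂)` for a rational function `f`, where `ι(f(x₂/x₁))` is the
expansion of `f(x₂/x₁)` in `ℂ((x₂))((x₁))`, a Laurent series in `x₁/x₂`. -/
def ratMul (f : RatFunc ℂ) (A : ℤ → ℤ → W) : ℤ → ℤ → W :=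
  fun m n => ∑ᶠ k : ℤ, (expandAtInfty f).coeff k • A (m - k) (n + k)

/-- `U ⊆ E(W)` is quasi `S_trig`-local: for `a, b ∈ U` there are `a⁽ⁱ⁾, b⁽ⁱ⁾ ∈ U`, rational
functions `fᵢ` and a nonzero polynomial `p` with
`p(x₁/x₂) a(x₁) b(x₂) = p(x₁/x₂) ∑ i, ι(fᵢ(x₂/x₁)) b⁽ⁱ⁾(x₂) a⁽ⁱ⁾(x₁)`. -/
def IsQuasiTrigLocal (U : Set (VertexOperator ℂ W)) : Prop :=
  ∀ a ∈ U, ∀ b ∈ U, ∃ (r : ℕ) (a' b' : Fin r → VertexOperator ℂ W) (f : Fin r → RatFunc ℂ),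
    (∀ i, a' i ∈ U ∧ b' i ∈ U) ∧
    ∃ p : Polynomial ℂ, p ≠ 0 ∧ ∀ (w : W) (m n : ℤ),
      polyMul p (prod₂ a b w) m n
        = polyMul p (∑ i, ratMul (f i) (fun m n => prod₂ (b' i) (a' i) w n m)) m n

/-- `A(x₁, x₂)` lies in `W((x₁, x₂))`. -/
def IsLowerTruncated (A : ℤ → ℤ → W) : Prop :=
  ∃ N : ℤ, ∀ m n : ℤ, m < N ∨ n < N → A m n = 0

/-- `p(x₁/x₂) a(x₁) b(x₂) ∈ Hom (W, W((x₁, x₂)))`. -/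
def CompatibleWith (p : Polynomial ℂ) (a b : VertexOperator ℂ W) : Prop :=
  ∀ w, IsLowerTruncated (polyMul p (prod₂ a b w))

/-- The pair `(a(x), b(x))` is quasi compatible. -/
def QuasiCompatible (a b : VertexOperator ℂ W) : Prop :=
  ∃ p : Polynomial ℂ, p ≠ 0 ∧ CompatibleWith p a b

/-- `U ⊆ E(W)` is quasi `S_trig`-compatible. -/
def IsQuasiTrigCompatible (U : Set (VertexOperator ℂ W)) : Prop :=
  ∀ a ∈ U, ∀ b ∈ U, QuasiCompatible a b

/-! ### The vertex operator map on fields -/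

/-- For `A(x₁, x) ∈ W((x₁, x))`, the coefficient of `z ^ k * x ^ N` in `A(x e^z, x)`; here
`(x e^z) ^ m = x ^ m * ∑ k ≥ 0, m ^ k / k! * z ^ k`. -/
def expSubst (A : ℤ → ℤ → W) (k : ℕ) (N : ℤ) : W :=
  ∑ᶠ m : ℤ, ((m : ℂ) ^ k / (k.factorial : ℂ)) • A m (N - m)

/-- The inverse `p(e^z)⁻¹` in `ℂ((z))`. -/
def expInv (p : Polynomial ℂ) : LaurentSeries ℂ :=
  ((Polynomial.aeval (PowerSeries.exp ℂ) p : PowerSeries ℂ) : LaurentSeries ℂ)⁻¹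

/-- The coefficient of `z ^ (-n - 1) * x ^ N` in
`p(e^z)⁻¹ (p(x₁/x) a(x₁) b(x) w)` at `x₁ = x e^z`. -/
def modeCoeff (p : Polynomial ℂ) (a b : VertexOperator ℂ W) (n N : ℤ) (w : W) : W :=
  ∑ᶠ k : ℕ, (expInv p).coeff (-n - 1 - k) • expSubst (polyMul p (prod₂ a b w)) k N


theorem finite_support_expSubst {A : ℤ → ℤ → W} (hA : IsLowerTruncated A) (k : ℕ) (N : ℤ) :
    (Function.support fun m : ℤ => ((m : ℂ) ^ k / (k.factorial : ℂ)) • A m (N - m)).Finite := by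
  obtain ⟨M, hM⟩ := hA
  refine (Set.finite_Icc M (N - M)).subset fun m hm => ?_
  by_contra h
  refine hm ?_
  have h0 : A m (N - m) = 0 := hM _ _ (by rw [Set.mem_Icc] at h; omega)
  simp [h0]

theorem finite_support_modeCoeff (g : LaurentSeries ℂ) (n : ℤ) (B : ℕ → W) :
    (Function.support fun k : ℕ => g.coeff (-n - 1 - k) • B k).Finite := by
  refine (Set.finite_Iic (-n - 1 - g.order).toNat).subset fun k hk => ?_
  by_contra h
  refine hk ?_
  have h0 : g.coeff (-n - 1 - k) = 0 :=
    HahnSeries.coeff_eq_zero_of_lt_order (by rw [Set.mem_Iic] at h; omega)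
  simp [h0]

theorem polyMul_prod₂_add (p : Polynomial ℂ) (a b : VertexOperator ℂ W) (v w : W) (m n : ℤ) :
    polyMul p (prod₂ a b (v + w)) m n
      = polyMul p (prod₂ a b v) m n + polyMul p (prod₂ a b w) m n := by
  simp only [polyMul, Polynomial.sum_def, prod₂, map_add, smul_add, Finset.sum_add_distrib]

theorem polyMul_prod₂_smul (p : Polynomial ℂ) (a b : VertexOperator ℂ W) (c : ℂ) (w : W)
    (m n : ℤ) :
    polyMul p (prod₂ a b (c • w)) m n = c • polyMul p (prod₂ a b w) m n := by
  simp only [polyMul, Polynomial.sum_def, prod₂, map_smul, Finset.smul_sum, smul_comm c]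

theorem modeCoeff_add {p : Polynomial ℂ} {a b : VertexOperator ℂ W} (h : CompatibleWith p a b)
    (n N : ℤ) (v w : W) :
    modeCoeff p a b n N (v + w) = modeCoeff p a b n N v + modeCoeff p a b n N w := by
  unfold modeCoeff
  have hf : ∀ u, (Function.support fun k : ℕ =>
      (expInv p).coeff (-n - 1 - k) • expSubst (polyMul p (prod₂ a b u)) k N).Finite :=
    fun u => finite_support_modeCoeff _ _ _
  rw [← finsum_add_distrib (hf v) (hf w)]
  refine finsum_congr fun k => ?_
  rw [← smul_add]
  congr 1
  unfold expSubst
  rw [← finsum_add_distrib (finite_support_expSubst (h v) k N) (finite_support_expSubst (h w) k N)]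
  refine finsum_congr fun m => ?_
  rw [polyMul_prod₂_add, smul_add]

theorem modeCoeff_smul (p : Polynomial ℂ) (a b : VertexOperator ℂ W) (n N : ℤ) (c : ℂ) (w : W) :
    modeCoeff p a b n N (c • w) = c • modeCoeff p a b n N w := by
  unfold modeCoeff
  rw [smul_finsum]
  refine finsum_congr fun k => ?_
  rw [smul_comm c]
  congr 1
  unfold expSubst
  rw [smul_finsum]
  refine finsum_congr fun m => ?_
  rw [polyMul_prod₂_smul, smul_comm c]

theorem bddBelow_modeCoeff {p : Polynomial ℂ} {a b : VertexOperator ℂ W}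
    (h : CompatibleWith p a b) (n : ℤ) (w : W) :
    BddBelow (Function.support fun N => modeCoeff p a b n N w) := by
  obtain ⟨M, hM⟩ := h w
  refine ⟨2 * M, fun N hN => ?_⟩
  by_contra hlt
  refine hN ?_
  have h0 : ∀ k, expSubst (polyMul p (prod₂ a b w)) k N = 0 := fun k =>
    finsum_eq_zero_of_forall_eq_zero fun m => by rw [hM m (N - m) (by omega), smul_zero]
  simp [modeCoeff, h0]

/-- The field `a(x)_n^e b(x)`, the coefficient of `z ^ (-n - 1)` in
`p(e^z)⁻¹ (p(x₁/x) a(x₁) b(x))` at `x₁ = x e^z`, computed with the polynomial `p`. -/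
def modeWith (p : Polynomial ℂ) (a b : VertexOperator ℂ W) (h : CompatibleWith p a b) (n : ℤ) :
    VertexOperator ℂ W :=
  VertexOperator.of_coeff
    (fun N =>
      { toFun := modeCoeff p a b n N
        map_add' := modeCoeff_add h n N
        map_smul' := modeCoeff_smul p a b n N })
    (bddBelow_modeCoeff h n)

open Classical in
/-- The field `a(x)_n^e b(x)`, defined by
`∑ n, a(x)_n^e b(x) * z ^ (-n - 1) = p(e^z)⁻¹ (p(x₁/x) a(x₁) b(x))` at `x₁ = x e^z`, for any `p ≠ 0`
with `p(x₁/x) a(x₁) b(x) ∈ Hom (W, W((x₁, x)))`; it does not depend on `p` (see `mode_eq`).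
It is meaningful for quasi compatible pairs only, and set to `0` for the others. -/
def mode (a b : VertexOperator ℂ W) (n : ℤ) : VertexOperator ℂ W :=
  if h : QuasiCompatible a b then modeWith h.choose a b h.choose_spec.2 n else 0

/-- The identity operator `1_W`, as a constant field. -/
def oneField : VertexOperator ℂ W :=
  VertexOperator.of_coeff (fun n => if n = 0 then LinearMap.id else 0) fun w =>
    ⟨0, fun n hn => by
      by_contra h
      exact hn (by simp [show n ≠ 0 by omega])⟩

/-- The subspace `⟨U⟩_e` of `E(W)` generated by `U`: the smallest subspace that contains `U` and
`1_W` and is closed under the products `(a(x), b(x)) ↦ a(x)_n^e b(x)` for `n ∈ ℤ`. -/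
def generated (U : Set (VertexOperator ℂ W)) : Submodule ℂ (VertexOperator ℂ W) :=
  sInf {S | U ⊆ S ∧ oneField ∈ S ∧ ∀ a ∈ S, ∀ b ∈ S, ∀ n : ℤ, mode a b n ∈ S}

/-- The field `a(c x)`, for a nonzero complex number `c`. -/
def rescale (c : ℂˣ) (a : VertexOperator ℂ W) : VertexOperator ℂ W :=
  HVertexOperator.of_coeff (fun n => (c : ℂ) ^ n • coeff a n) fun w =>
    (HVertexOperator.coeff_isPWOsupport a w).mono fun n hn h => hn (by
      change (c : ℂ) ^ n • ((HahnModule.of ℂ).symm (a w)).coeff n = 0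
      rw [h, smul_zero])

/-! ### Independence of the polynomial -/

theorem polyMul_add (p q : Polynomial ℂ) (A : ℤ → ℤ → W) (m n : ℤ) :
    polyMul (p + q) A m n = polyMul p A m n + polyMul q A m n :=
  Polynomial.sum_add_index p q _ (fun _ => zero_smul _ _) fun _ _ _ => add_smul _ _ _

theorem polyMul_monomial_mul (j : ℕ) (c : ℂ) (p : Polynomial ℂ) (A : ℤ → ℤ → W) (m n : ℤ) :
    polyMul (Polynomial.monomial j c * p) A m n = c • polyMul p A (m - j) (n + j) := by
  induction p using Polynomial.induction_on' with
  | add p q hp hq => rw [mul_add, polyMul_add, hp, hq, polyMul_add, smul_add]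
  | monomial i d =>
    rw [Polynomial.monomial_mul_monomial, polyMul, polyMul,
      Polynomial.sum_monomial_index _ _ (by rw [zero_smul]),
      Polynomial.sum_monomial_index _ _ (by rw [zero_smul]), mul_smul]
    congr 3 <;> push_cast <;> ring

theorem polyMul_monomial (j : ℕ) (c : ℂ) (A : ℤ → ℤ → W) (m n : ℤ) :
    polyMul (Polynomial.monomial j c) A m n = c • A (m - j) (n + j) := by
  rw [polyMul, Polynomial.sum_monomial_index _ _ (by rw [zero_smul])]

theorem polyMul_mul (q p : Polynomial ℂ) (A : ℤ → ℤ → W) (m n : ℤ) :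
    polyMul (q * p) A m n = polyMul q (polyMul p A) m n := by
  induction q using Polynomial.induction_on' with
  | add q r hq hr => rw [add_mul, polyMul_add, hq, hr, polyMul_add]
  | monomial i d => rw [polyMul_monomial_mul, polyMul_monomial]

theorem aeval_exp_ne_zero {q : Polynomial ℂ} (hq : q ≠ 0) :
    Polynomial.aeval (PowerSeries.exp ℂ) q ≠ 0 := by
  intro h
  have hpow : ∀ n : ℕ, ∑ j ∈ q.support, q.coeff j * (j : ℂ) ^ n = 0 := by
    intro n
    have h1 := congrArg (PowerSeries.coeff n) h
    rw [Polynomial.aeval_eq_sum_range' (lt_add_one _), map_sum, map_zero] at h1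
    rw [Finset.sum_subset (s₂ := Finset.range (q.natDegree + 1)) Polynomial.supp_subset_range_natDegree_succ
      (by intro j _ hj; rw [Polynomial.notMem_support_iff.1 hj, zero_mul])]
    have h2 : ∀ j : ℕ, PowerSeries.coeff n (q.coeff j • PowerSeries.exp ℂ ^ j)
        = q.coeff j * (j : ℂ) ^ n * (algebraMap ℚ ℂ (1 / n.factorial)) := by
      intro j
      rw [PowerSeries.exp_pow_eq_rescale_exp, PowerSeries.coeff_smul, PowerSeries.coeff_rescale,
        PowerSeries.coeff_exp, mul_assoc, smul_eq_mul]
    simp only [h2, ← Finset.sum_mul] at h1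
    refine (mul_eq_zero.1 h1).resolve_right ?_
    rw [map_eq_zero]
    exact one_div_ne_zero (Nat.cast_ne_zero.2 n.factorial_ne_zero)
  have hpoly : ∀ P : Polynomial ℂ, ∑ j ∈ q.support, q.coeff j * P.eval (j : ℂ) = 0 := by
    intro P
    induction P using Polynomial.induction_on' with
    | add P Q hP hQ => simp only [Polynomial.eval_add, mul_add, Finset.sum_add_distrib, hP, hQ, add_zero]
    | monomial n c =>
      simp only [Polynomial.eval_monomial, mul_left_comm _ c, ← Finset.mul_sum, hpow, mul_zero]
  obtain ⟨i, hi⟩ := Polynomial.support_nonempty.2 hq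
  have h3 := hpoly (∏ k ∈ q.support.erase i, (Polynomial.X - Polynomial.C (k : ℂ)))
  rw [Finset.sum_eq_single i] at h3
  · refine (mul_ne_zero (Polynomial.mem_support_iff.1 hi) ?_) h3
    rw [Polynomial.eval_prod, Finset.prod_ne_zero_iff]
    intro k hk
    rw [Polynomial.eval_sub, Polynomial.eval_X, Polynomial.eval_C, sub_ne_zero, Ne, Nat.cast_inj]
    exact (Finset.ne_of_mem_erase hk).symm
  · intro k hk hki
    rw [Polynomial.eval_prod, Finset.prod_eq_zero (Finset.mem_erase.2 ⟨hki, hk⟩) (by simp), mul_zero]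
  · exact fun h => absurd hi h

theorem expSubst_polyMul {A : ℤ → ℤ → W} (hA : IsLowerTruncated A) (q : Polynomial ℂ) (k : ℕ)
    (N : ℤ) :
    expSubst (polyMul q A) k N = ∑ ij ∈ Finset.HasAntidiagonal.antidiagonal k,
      PowerSeries.coeff ij.1 (Polynomial.aeval (PowerSeries.exp ℂ) q) • expSubst A ij.2 N := by
  have hshift : ∀ j : ℕ, (Function.support fun m : ℤ =>
      ((m : ℂ) ^ k / (k.factorial : ℂ)) • A (m - j) (N - m + j)).Finite := by
    intro j
    obtain ⟨M, hM⟩ := hA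
    refine (Set.finite_Icc (M + j) (N - M + j)).subset fun m hm => ?_
    by_contra h
    refine hm ?_
    have h0 : A (m - j) (N - m + j) = 0 := hM _ _ (by rw [Set.mem_Icc] at h; omega)
    simp [h0]
  have hmono : ∀ j : ℕ, ∑ᶠ m : ℤ, ((m : ℂ) ^ k / (k.factorial : ℂ)) • A (m - j) (N - m + j)
      = ∑ ij ∈ Finset.HasAntidiagonal.antidiagonal k,
          ((j : ℂ) ^ ij.1 / (ij.1.factorial : ℂ)) • expSubst A ij.2 N := by
    intro j
    rw [← finsum_comp_equiv (Equiv.addRight (j : ℤ))]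
    unfold expSubst
    simp only [smul_finsum]
    rw [← finsum_sum_comm]
    · refine finsum_congr fun m => ?_
      simp only [smul_smul, ← Finset.sum_smul, Equiv.coe_addRight, add_sub_cancel_right]
      rw [show N - (m + j) + j = N - m by ring]
      congr 1
      rw [Int.cast_add, add_comm, Int.cast_natCast, (Commute.all _ _).add_pow', Finset.sum_div]
      refine Finset.sum_congr rfl fun ij hij => ?_
      rw [Finset.HasAntidiagonal.mem_antidiagonal] at hij
      subst hij
      have e := Nat.choose_mul_factorial_mul_factorial (Nat.le_add_right ij.1 ij.2)
      rw [Nat.add_sub_cancel_left] at e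
      have e' : (((ij.1 + ij.2).choose ij.1 : ℕ) : ℂ) * ij.1.factorial * ij.2.factorial
        = (ij.1 + ij.2).factorial := by exact_mod_cast e
      have h1 : (ij.1.factorial : ℂ) ≠ 0 := Nat.cast_ne_zero.2 (Nat.factorial_ne_zero _)
      have h2 : (ij.2.factorial : ℂ) ≠ 0 := Nat.cast_ne_zero.2 (Nat.factorial_ne_zero _)
      have h3 : ((ij.1 + ij.2).factorial : ℂ) ≠ 0 := Nat.cast_ne_zero.2 (Nat.factorial_ne_zero _)
      rw [nsmul_eq_mul]
      field_simp
      rw [← e']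
      ring
    · intro ij _
      refine (finite_support_expSubst hA ij.2 N).subset fun m hm h => hm ?_
      simp only [] at h ⊢
      rw [h, smul_zero]
  have hsum : expSubst (polyMul q A) k N = ∑ j ∈ q.support, q.coeff j •
      ∑ᶠ m : ℤ, ((m : ℂ) ^ k / (k.factorial : ℂ)) • A (m - j) (N - m + j) := by
    simp only [smul_finsum]
    rw [← finsum_sum_comm]
    · refine finsum_congr fun m => ?_
      simp only [polyMul, Polynomial.sum_def, Finset.smul_sum, smul_comm (q.coeff _)]
    · intro j _
      refine (hshift j).subset fun m hm h => hm ?_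
      simp only [] at h ⊢
      rw [h, smul_zero]
  rw [hsum]
  simp only [hmono, Finset.smul_sum, smul_smul]
  rw [Finset.sum_comm]
  refine Finset.sum_congr rfl fun ij _ => ?_
  rw [← Finset.sum_smul]
  congr 1
  rw [Polynomial.aeval_eq_sum_range, map_sum,
    Finset.sum_subset (s₂ := Finset.range (q.natDegree + 1))
      Polynomial.supp_subset_range_natDegree_succ
      (by intro j _ hj; rw [Polynomial.notMem_support_iff.1 hj, zero_mul])]
  refine Finset.sum_congr rfl fun j _ => ?_
  rw [PowerSeries.exp_pow_eq_rescale_exp, PowerSeries.coeff_smul, PowerSeries.coeff_rescale,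
    PowerSeries.coeff_exp]
  simp [div_eq_mul_inv]

theorem expInv_mul {q : Polynomial ℂ} (hq : q ≠ 0) (p : Polynomial ℂ) :
    expInv (q * p) * ((Polynomial.aeval (PowerSeries.exp ℂ) q : PowerSeries ℂ) : LaurentSeries ℂ)
      = expInv p := by
  have h : ((Polynomial.aeval (PowerSeries.exp ℂ) q : PowerSeries ℂ) : LaurentSeries ℂ) ≠ 0 := by
    rw [Ne, map_eq_zero_iff _ HahnSeries.ofPowerSeries_injective]
    exact aeval_exp_ne_zero hq
  rw [expInv, expInv, map_mul, PowerSeries.coe_mul, mul_inv, mul_comm, ← mul_assoc,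
    mul_inv_cancel₀ h, one_mul]

theorem modeCoeff_mul_left {p q : Polynomial ℂ} {a b : VertexOperator ℂ W}
    (h : CompatibleWith p a b) (hq : q ≠ 0) (n N : ℤ) (w : W) :
    modeCoeff (q * p) a b n N w = modeCoeff p a b n N w := by
  have hqp : polyMul (q * p) (prod₂ a b w) = polyMul q (polyMul p (prod₂ a b w)) := by
    funext i j
    exact polyMul_mul q p _ i j
  set G := expInv (q * p) with hG
  set c := Polynomial.aeval (PowerSeries.exp ℂ) q with hc
  set B : ℕ → W := fun k => expSubst (polyMul p (prod₂ a b w)) k N with hB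
  obtain ⟨K, hK⟩ : ∃ K : ℕ, ∀ k : ℕ, K ≤ k → G.coeff (-n - 1 - k) = 0 :=
    ⟨(-n - G.order).toNat, fun k hk => HahnSeries.coeff_eq_zero_of_lt_order (by omega)⟩
  have hprod : ∀ j : ℕ, (expInv p).coeff (-n - 1 - j)
      = ∑ i ∈ Finset.range K, G.coeff (-n - 1 - (i + j : ℕ)) * PowerSeries.coeff i c := by
    intro j
    rw [← expInv_mul hq p, ← hG, ← hc, HahnSeries.coeff_mul]
    symm
    refine Finset.sum_bij_ne_zero (fun i _ _ => (-n - 1 - (i + j : ℕ), (i : ℤ))) ?_ ?_ ?_ ?_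
    · intro i _ hne
      rw [Finset.mem_antidiagonal]
      refine ⟨left_ne_zero_of_mul hne, ?_, by push_cast; ring⟩
      rw [HahnSeries.mem_support, LaurentSeries.coeff_coe_powerSeries]
      exact right_ne_zero_of_mul hne
    · intro i _ _ i' _ _ h
      exact Nat.cast_injective (R := ℤ) (Prod.ext_iff.1 h).2
    · rintro ⟨x, y⟩ hxy hne
      rw [Finset.mem_antidiagonal] at hxy
      obtain ⟨hx, hy, hxy⟩ := hxy
      simp only at hx hy hxy hne
      have hy0 : 0 ≤ y := by
        by_contra hlt
        exact hy (by rw [PowerSeries.coeff_coe, if_pos (by omega)])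
      lift y to ℕ using hy0
      have hx' : x = -n - 1 - (y + j : ℕ) := by push_cast; omega
      subst hx'
      rw [LaurentSeries.coeff_coe_powerSeries] at hne
      refine ⟨y, ?_, hne, rfl⟩
      rw [Finset.mem_range]
      by_contra hle
      exact hx (hK _ (by omega))
    · intro i _ _
      rw [LaurentSeries.coeff_coe_powerSeries]
  have hl : modeCoeff (q * p) a b n N w = ∑ k ∈ Finset.range K, G.coeff (-n - 1 - k) •
      ∑ ij ∈ Finset.HasAntidiagonal.antidiagonal k, PowerSeries.coeff ij.1 c • B ij.2 := by
    unfold modeCoeff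
    rw [hqp, finsum_eq_sum_of_support_subset (s := Finset.range K)]
    · refine Finset.sum_congr rfl fun k _ => ?_
      rw [expSubst_polyMul (h w)]
    · intro k hk
      rw [Finset.coe_range, Set.mem_Iio]
      by_contra hle
      exact hk (by simp only [← hG, hK k (by omega), zero_smul])
  have hr : modeCoeff p a b n N w = ∑ j ∈ Finset.range K, (expInv p).coeff (-n - 1 - j) • B j := by
    unfold modeCoeff
    rw [finsum_eq_sum_of_support_subset (s := Finset.range K)]
    intro k hk
    rw [Finset.coe_range, Set.mem_Iio]
    by_contra hle
    refine hk ?_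
    simp only []
    rw [hprod k, Finset.sum_eq_zero, zero_smul]
    intro i _
    rw [hK _ (by omega), zero_mul]
  rw [hl, hr]
  simp only [hprod, Finset.sum_smul, Finset.smul_sum]
  rw [← Finset.sum_product', ← Finset.sum_filter_of_ne (p := fun x : ℕ × ℕ => x.2 + x.1 < K),
    ← Finset.sum_fiberwise_of_maps_to (t := Finset.range K) (g := fun x : ℕ × ℕ => x.2 + x.1)]
  · refine Finset.sum_congr rfl fun k hk => ?_
    rw [Finset.mem_range] at hk
    refine Finset.sum_bij' (fun x _ => (x.2, x.1)) (fun x _ => (x.2, x.1)) ?_ ?_ ?_ ?_ ?_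
    · intro x hx
      rw [Finset.HasAntidiagonal.mem_antidiagonal] at hx
      simp only [Finset.mem_filter, Finset.mem_product, Finset.mem_range]
      omega
    · intro x hx
      simp only [Finset.mem_filter, Finset.mem_product, Finset.mem_range] at hx
      rw [Finset.HasAntidiagonal.mem_antidiagonal]
      omega
    · intro x _; rfl
    · intro x _; rfl
    · intro x hx
      rw [Finset.HasAntidiagonal.mem_antidiagonal] at hx
      simp only [hx, smul_smul]
  · intro x hx
    exact Finset.mem_range.2 (Finset.mem_filter.1 hx).2
  · intro x _ hne
    by_contra hle
    exact hne (by rw [hK _ (by omega), zero_mul, zero_smul])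

/-- Any admissible polynomial `p` computes `a(x)_n^e b(x)`. -/
theorem mode_eq {p : Polynomial ℂ} {a b : VertexOperator ℂ W} (hp : p ≠ 0)
    (h : CompatibleWith p a b) (n : ℤ) : mode a b n = modeWith p a b h n := by
  have hab : QuasiCompatible a b := ⟨p, hp, h⟩
  rw [mode, dif_pos hab]
  ext w N
  change modeCoeff _ a b n N w = modeCoeff p a b n N w
  rw [← modeCoeff_mul_left hab.choose_spec.2 hp, mul_comm,
    modeCoeff_mul_left h hab.choose_spec.1]

end Fields

end TrigQVA

/-!
The products `a(x)_n^e b(x)` come from the substitution `x₁ = x e^z` in `p(x₁/x) a(x₁) b(x)`. After a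
functional is applied and the total degree in `x₁, x` is fixed, this is a statement about scalars:
a formal series `f(t)` with `d(t) f(t) = P(t)`, for Laurent polynomials `d ≠ 0` and `P`, is sent to
`P(e^z) / d(e^z)`. This is the relation `HasExpSubst`. As `e^z` is not algebraic, its result is unique
(`HasExpSubst.unique`), and it is linear over Laurent polynomials; the basic properties of the
products of fields follow (`QuasiCompatible.hasExpSubst`, `mode_ext`).

*Locality.* Clearing denominators, quasi locality says that, up to a factor `q(x₁/x₂)`, the product
`a(x₁) b(x₂)` is a sum of products `h(x₁/x₂) b'(x₂) a'(x₁)` with polynomials `h` (`SLocal`). Such pairs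
are quasi compatible, since the left side is truncated in `x₂` and the right side in `x₁`. A version of
Dong's lemma (`mode_prodSeries_mem`, `prodSeries_mode_mem`) shows that locality is inherited by the
products: in an identity that reorders three fields, `x₁ = x₂ e^z` is substituted, and the
coefficients of the powers of `z` are polynomial relations between the products of modes, whose
leading coefficient is nonzero. As the modes vanish for large `n`, an induction applies
(`mem_saturation_of_sum`). So the generated space, a union of stages built from products and linear
combinations, is local (`SLocal.generated`).

*The Jacobi identity.* For fields `a, b, c` of a local space there is a Laurent polynomial
`D(t₁, t₂)`, a product of factors in `t₁`, in `t₂` and in `t₁/t₂`, such that `D` multiplies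
`φ(a(x₁) b(x₂) c(x) w)` to a Laurent polynomial `P` (`SLocal.exists_finite_support`). Hence
`Y(a, z₁) Y(b, z₂) c`, the sum of the `fᵢ(z₂ - z₁) Y(bᵢ, z₂) Y(aᵢ, z₁) c`, and
`Y(Y(a, z₁ - z₂) b, z₂) c` are the expansions of one function `P(e^{z₁}, e^{z₂}) / D(e^{z₁}, e^{z₂})` in
`ℂ((z₁))((z₂))`, `ℂ((z₂))((z₁))` and `ℂ((z₂))((z₁ - z₂))`; two substitutions in succession are
controlled by `evalExp₂_mul_eq`. Because `D` factors, this function is a combination of products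
`f₁(z₁) f₂(z₂) f₃(z₁ - z₂)`, for which the Jacobi identity is the elementary residue identity
`resX_sub_resY_mul`.

The group `Γ` acts by automorphisms because `x ↦ c x` multiplies the degree `N` part of a product of
two fields by `c ^ N` (`mode_rescale`).
-/

namespace TrigQVA

open HVertexOperator (coeff)

/-! ### Laurent series in one and two variables -/

section Laurent

theorem exists_coeff_eq_zero {R : Type*} [Zero R] (f : LaurentSeries R) :
    ∃ a : ℤ, ∀ n < a, f.coeff n = 0 := by
  obtain ⟨a, ha⟩ : BddBelow f.support := by
    by_cases h : f.support.Nonempty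
    · exact ⟨f.isWF_support.min h, fun x hx => f.isWF_support.min_le h hx⟩
    · exact ⟨0, fun x hx => (h ⟨x, hx⟩).elim⟩
  refine ⟨a, fun n hn => ?_⟩
  by_contra h
  exact absurd (ha ((HahnSeries.mem_support _ _).2 h)) (by omega)

theorem coeff_mul_eq_sum {R : Type*} [CommRing R] (f g : LaurentSeries R) (n : ℤ) (s : Finset ℤ)
    (hs : ∀ p, f.coeff p ≠ 0 → g.coeff (n - p) ≠ 0 → p ∈ s) :
    (f * g).coeff n = ∑ p ∈ s, f.coeff p * g.coeff (n - p) := by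
  rw [HahnSeries.coeff_mul]
  refine Finset.sum_bij_ne_zero (fun x _ _ => x.1) ?_ ?_ ?_ ?_
  · rintro ⟨p, q⟩ h hne
    rw [Finset.mem_antidiagonal] at h
    obtain ⟨h1, h2, h3⟩ := h
    simp only at h1 h2 h3
    obtain rfl : q = n - p := by omega
    exact hs p h1 h2
  · rintro ⟨p, q⟩ h _ ⟨p', q'⟩ h' _ e
    rw [Finset.mem_antidiagonal] at h h'
    have h3 := h.2.2
    have h3' := h'.2.2
    simp only at e h3 h3'
    ext <;> simp only <;> omega
  · intro p _ hne
    refine ⟨(p, n - p), ?_, hne, rfl⟩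
    rw [Finset.mem_antidiagonal]
    exact ⟨left_ne_zero_of_mul hne, right_ne_zero_of_mul hne, by simp⟩
  · rintro ⟨p, q⟩ h _
    rw [Finset.mem_antidiagonal] at h
    have h3 := h.2.2
    simp only at h3 ⊢
    obtain rfl : q = n - p := by omega
    rfl

theorem coeff_mul_Icc {R : Type*} [CommRing R] {f g : LaurentSeries R} {a b : ℤ}
    (hf : ∀ n < a, f.coeff n = 0) (hg : ∀ n < b, g.coeff n = 0) (n : ℤ) :
    (f * g).coeff n = ∑ p ∈ Finset.Icc a (n - b), f.coeff p * g.coeff (n - p) := by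
  refine coeff_mul_eq_sum f g n _ fun p hp hq => ?_
  rw [Finset.mem_Icc]
  constructor
  · by_contra h
    exact hp (hf p (by omega))
  · by_contra h
    exact hq (hg _ (by omega))

theorem coeff_ofPowerSeries_mul {R : Type*} [CommRing R] (φ : PowerSeries R) {g : LaurentSeries R}
    {b : ℤ} (hg : ∀ n < b, g.coeff n = 0) (n : ℤ) {L : ℕ} (hL : n - b < L) :
    (HahnSeries.ofPowerSeries ℤ R φ * g).coeff n
      = ∑ l ∈ Finset.range L, PowerSeries.coeff l φ * g.coeff (n - l) := by
  rw [coeff_mul_eq_sum _ _ n ((Finset.range L).map Nat.castEmbedding), Finset.sum_map]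
  · refine Finset.sum_congr rfl fun l _ => ?_
    rw [Nat.castEmbedding_apply, HahnSeries.ofPowerSeries_apply_coeff]
  · intro p hp hq
    have hp0 : 0 ≤ p := by
      by_contra hlt
      exact hp (by rw [PowerSeries.coeff_coe, if_pos (by omega)])
    lift p to ℕ using hp0
    rw [Finset.mem_map]
    refine ⟨p, ?_, rfl⟩
    rw [Finset.mem_range]
    by_contra hle
    exact hq (hg _ (by omega))

/-- The series `e^{c z}`. -/
def expSeries (c : ℂ) : LaurentSeries ℂ :=
  HahnSeries.ofPowerSeries ℤ ℂ (PowerSeries.rescale c (PowerSeries.exp ℂ))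

theorem expSeries_add (c d : ℂ) : expSeries (c + d) = expSeries c * expSeries d := by
  rw [expSeries, expSeries, expSeries, ← map_mul, PowerSeries.exp_mul_exp_eq_exp_add]

theorem expSeries_zero : expSeries 0 = 1 := by
  rw [expSeries, PowerSeries.rescale_zero, RingHom.comp_apply]
  simp

theorem coeff_expSeries (c : ℂ) (n : ℤ) :
    (expSeries c).coeff n = if 0 ≤ n then c ^ n.toNat / (n.toNat.factorial : ℂ) else 0 := by
  split_ifs with h
  · lift n to ℕ using h
    rw [expSeries, HahnSeries.ofPowerSeries_apply_coeff, PowerSeries.coeff_rescale,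
      PowerSeries.coeff_exp]
    simp [div_eq_mul_inv]
  · rw [expSeries, PowerSeries.coeff_coe, if_pos (by omega)]

theorem coeff_expSeries_natCast (c : ℂ) (n : ℕ) :
    (expSeries c).coeff n = c ^ n / (n.factorial : ℂ) := by
  rw [coeff_expSeries, if_pos (by omega), Int.toNat_natCast]

theorem coeff_expSeries_mul (c : ℂ) {g : LaurentSeries ℂ}
    {b : ℤ} (hg : ∀ n < b, g.coeff n = 0) (n : ℤ) {L : ℕ} (hL : n - b < L) :
    (expSeries c * g).coeff n
      = ∑ l ∈ Finset.range L, c ^ l / (l.factorial : ℂ) * g.coeff (n - l) := by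
  rw [expSeries, coeff_ofPowerSeries_mul _ hg n hL]
  refine Finset.sum_congr rfl fun l _ => ?_
  rw [PowerSeries.coeff_rescale, PowerSeries.coeff_exp]
  simp [div_eq_mul_inv]

theorem bddBelow_support_of_forall_lt {R : Type*} [Zero R] {f : ℤ → R} (a : ℤ)
    (h : ∀ n < a, f n = 0) : BddBelow (Function.support f) :=
  ⟨a, fun n hn => by
    by_contra hlt
    exact hn (h n (by omega))⟩

/-- The field `ℂ((x))((y))` of iterated Laurent series, the elements being Laurent series in `y`
with coefficients in `ℂ((x))`. It is not reducible to the type of Hahn series, so that its algebraic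
structure is found through its field instance only. -/
def IterLaurent : Type := LaurentSeries (LaurentSeries ℂ)

namespace IterLaurent

instance : Field IterLaurent := inferInstanceAs (Field (LaurentSeries (LaurentSeries ℂ)))

/-- The coefficients of the powers of `y`, which are series in `x`. -/
def coeff (X : IterLaurent) : ℤ → LaurentSeries ℂ := HahnSeries.coeff X

@[ext]
theorem ext {X Y : IterLaurent} (h : ∀ n, X.coeff n = Y.coeff n) : X = Y :=
  HahnSeries.ext (funext h)

theorem coeff_zero (n : ℤ) : (0 : IterLaurent).coeff n = 0 := rfl

theorem coeff_one (n : ℤ) : (1 : IterLaurent).coeff n = if n = 0 then 1 else 0 := by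
  refine (HahnSeries.coeff_one (Γ := ℤ) (R := LaurentSeries ℂ)).trans ?_
  by_cases h : n = 0 <;> simp [h]

theorem coeff_add (X Y : IterLaurent) (n : ℤ) : (X + Y).coeff n = X.coeff n + Y.coeff n := rfl

theorem exists_coeff_eq_zero (X : IterLaurent) : ∃ a : ℤ, ∀ n < a, X.coeff n = 0 :=
  TrigQVA.exists_coeff_eq_zero (R := LaurentSeries ℂ) X

theorem coeff_mul_eq_sum (X Y : IterLaurent) (n : ℤ) (s : Finset ℤ)
    (hs : ∀ p, X.coeff p ≠ 0 → Y.coeff (n - p) ≠ 0 → p ∈ s) :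
    (X * Y).coeff n = ∑ p ∈ s, X.coeff p * Y.coeff (n - p) :=
  TrigQVA.coeff_mul_eq_sum (R := LaurentSeries ℂ) X Y n s hs

/-- The series with given coefficients. -/
def mk (f : ℤ → LaurentSeries ℂ) (h : BddBelow (Function.support f)) : IterLaurent :=
  HahnSeries.ofSuppBddBelow f h

/-- The embedding of `ℂ((x))[[y]]`. -/
def ofPowerSeries : PowerSeries (LaurentSeries ℂ) →+* IterLaurent :=
  HahnSeries.ofPowerSeries ℤ (LaurentSeries ℂ)

theorem coeff_ofPowerSeries_natCast (φ : PowerSeries (LaurentSeries ℂ)) (n : ℕ) :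
    (ofPowerSeries φ).coeff n = PowerSeries.coeff n φ :=
  HahnSeries.ofPowerSeries_apply_coeff _ _

theorem coeff_ofPowerSeries_of_neg (φ : PowerSeries (LaurentSeries ℂ)) {n : ℤ} (hn : n < 0) :
    (ofPowerSeries φ).coeff n = 0 :=
  (PowerSeries.coeff_coe φ n).trans (if_pos hn)

end IterLaurent

/-- The embedding `f(x) ↦ f(x)` of `ℂ((x))` in `ℂ((x))((y))`. -/
def inX : LaurentSeries ℂ →+* IterLaurent :=
  (HahnSeries.C : LaurentSeries ℂ →+* LaurentSeries (LaurentSeries ℂ))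

/-- The embedding `f(x) ↦ f(y)` of `ℂ((x))` in `ℂ((x))((y))`. -/
def inY : LaurentSeries ℂ →+* IterLaurent where
  toFun f := f.map (HahnSeries.C : ℂ →+* LaurentSeries ℂ)
  map_one' := HahnSeries.map_one (HahnSeries.C : ℂ →+* LaurentSeries ℂ).toMonoidWithZeroHom
  map_mul' _ _ := HahnSeries.map_mul (HahnSeries.C : ℂ →+* LaurentSeries ℂ).toNonUnitalRingHom
  map_zero' := HahnSeries.map_zero (HahnSeries.C : ℂ →+* LaurentSeries ℂ).toZeroHom
  map_add' f g := by
    ext1 n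
    exact map_add HahnSeries.C (f.coeff n) (g.coeff n)

theorem coeff_inY (f : LaurentSeries ℂ) (n : ℤ) : (inY f).coeff n = HahnSeries.C (f.coeff n) := rfl

theorem coeff_inX_mul (f : LaurentSeries ℂ) (X : IterLaurent) (n : ℤ) :
    (inX f * X).coeff n = f * X.coeff n :=
  HahnSeries.coeff_single_zero_mul (R := LaurentSeries ℂ)

/-- The coefficient of `y ^ j` in `f(α x + β y)`, expanded in nonnegative powers of `y`. -/
def taylorCoeff (α : ℂˣ) (β : ℂ) (j : ℕ) (f : LaurentSeries ℂ) : LaurentSeries ℂ :=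
  HahnSeries.ofSuppBddBelow
    (fun i => f.coeff (i + j) * ((Ring.choose (i + j) j : ℤ) * ((α : ℂ) ^ i * β ^ j)))
    (by
      obtain ⟨a, ha⟩ := exists_coeff_eq_zero f
      exact bddBelow_support_of_forall_lt (a - j) fun n hn => by rw [ha _ (by omega), zero_mul])

theorem coeff_taylorCoeff (α : ℂˣ) (β : ℂ) (j : ℕ) (f : LaurentSeries ℂ) (i : ℤ) :
    (taylorCoeff α β j f).coeff i
      = f.coeff (i + j) * ((Ring.choose (i + j) j : ℤ) * ((α : ℂ) ^ i * β ^ j)) := rfl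

/-- The Leibniz rule for the Taylor coefficients; it amounts to the Vandermonde identity for the
binomial coefficients with an arbitrary integer on top. -/
theorem taylorCoeff_mul (α : ℂˣ) (β : ℂ) (j : ℕ) (f g : LaurentSeries ℂ) :
    taylorCoeff α β j (f * g) = ∑ x ∈ Finset.HasAntidiagonal.antidiagonal j,
      taylorCoeff α β x.1 f * taylorCoeff α β x.2 g := by
  obtain ⟨a, ha⟩ := exists_coeff_eq_zero f
  obtain ⟨b, hb⟩ := exists_coeff_eq_zero g
  ext i
  rw [coeff_taylorCoeff, coeff_mul_Icc ha hb, HahnSeries.coeff_sum]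
  have key : ∀ x ∈ Finset.HasAntidiagonal.antidiagonal j,
      (taylorCoeff α β x.1 f * taylorCoeff α β x.2 g).coeff i
        = ∑ p ∈ Finset.Icc a (i + j - b), f.coeff p * g.coeff (i + j - p) *
          (((Ring.choose p x.1 * Ring.choose (i + j - p) x.2 : ℤ) : ℂ) * ((α : ℂ) ^ i * β ^ j)) := by
    rintro ⟨j₁, j₂⟩ hj
    rw [Finset.HasAntidiagonal.mem_antidiagonal] at hj
    simp only at hj
    rw [coeff_mul_eq_sum _ _ i
      ((Finset.Icc a (i + j - b)).map (Equiv.subRight (j₁ : ℤ)).toEmbedding), Finset.sum_map]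
    · refine Finset.sum_congr rfl fun p _ => ?_
      simp only [Equiv.coe_toEmbedding, Equiv.subRight_apply, coeff_taylorCoeff]
      rw [show p - (j₁ : ℤ) + j₁ = p by ring, show i - (p - (j₁ : ℤ)) + j₂ = i + j - p by
        rw [← hj]; push_cast; ring]
      have hα : (α : ℂ) ^ i = (α : ℂ) ^ (p - j₁) * (α : ℂ) ^ (i - (p - j₁)) := by
        rw [← zpow_add₀ α.ne_zero]; congr 1; ring
      have hβ : β ^ j = β ^ j₁ * β ^ j₂ := by rw [← pow_add, hj]
      rw [hα, hβ]
      push_cast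
      ring
    · intro p hp hq
      rw [coeff_taylorCoeff] at hp hq
      rw [Finset.mem_map]
      refine ⟨p + j₁, ?_, by simp⟩
      rw [Finset.mem_Icc]
      constructor
      · by_contra h
        exact hp (by rw [ha _ (by omega), zero_mul])
      · by_contra h
        exact hq (by rw [hb _ (by omega), zero_mul])
  rw [Finset.sum_congr rfl key, Finset.sum_comm, Finset.sum_mul]
  refine Finset.sum_congr rfl fun p _ => ?_
  rw [← Finset.mul_sum, ← Finset.sum_mul, ← Int.cast_sum, ← Ring.add_choose_eq j (Commute.all _ _)]
  rw [show p + (i + j - p) = i + j by ring]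

/-- The embedding `f(x) ↦ f(α x + β y)` of `ℂ((x))` in `ℂ((x))((y))`, where
`(α x + β y) ^ k` is expanded in nonnegative powers of `y`. -/
def substLin (α : ℂˣ) (β : ℂ) : LaurentSeries ℂ →+* IterLaurent where
  toFun f := IterLaurent.ofPowerSeries (PowerSeries.mk fun j => taylorCoeff α β j f)
  map_one' := by
    rw [← map_one IterLaurent.ofPowerSeries]
    congr 1
    ext j i
    rw [PowerSeries.coeff_mk, coeff_taylorCoeff, PowerSeries.coeff_one, HahnSeries.coeff_one]
    by_cases hj : j = 0
    · subst hj
      by_cases hi : i = 0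
      · subst hi; simp
      · simp [hi, HahnSeries.coeff_one]
    · rw [if_neg hj, HahnSeries.coeff_zero]
      by_cases hi : i + j = 0
      · rw [hi, Ring.choose_zero_pos ℤ (by omega)]
        simp
      · rw [if_neg hi, zero_mul]
  map_mul' f g := by
    rw [← map_mul]
    congr 1
    ext1 j
    rw [PowerSeries.coeff_mk, PowerSeries.coeff_mul, taylorCoeff_mul]
    simp only [PowerSeries.coeff_mk]
  map_zero' := by
    rw [← map_zero IterLaurent.ofPowerSeries]
    congr 1
    ext j i
    rw [PowerSeries.coeff_mk, coeff_taylorCoeff]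
    simp
  map_add' f g := by
    rw [← map_add]
    congr 1
    ext j i
    rw [PowerSeries.coeff_mk, map_add, PowerSeries.coeff_mk, PowerSeries.coeff_mk,
      HahnSeries.coeff_add, coeff_taylorCoeff, coeff_taylorCoeff, coeff_taylorCoeff,
      HahnSeries.coeff_add, add_mul]

theorem coeff_substLin_natCast (α : ℂˣ) (β : ℂ) (f : LaurentSeries ℂ) (j : ℕ) :
    (substLin α β f).coeff j = taylorCoeff α β j f :=
  (IterLaurent.coeff_ofPowerSeries_natCast _ _).trans (PowerSeries.coeff_mk _ _)

theorem coeff_substLin_of_neg (α : ℂˣ) (β : ℂ) (f : LaurentSeries ℂ) {j : ℤ} (hj : j < 0) :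
    (substLin α β f).coeff j = 0 :=
  IterLaurent.coeff_ofPowerSeries_of_neg _ hj

theorem coeff_coeff_substLin (α : ℂˣ) (β : ℂ) (f : LaurentSeries ℂ) (i j : ℤ) :
    ((substLin α β f).coeff j).coeff i = if 0 ≤ j then
      f.coeff (i + j) * ((Ring.choose (i + j) j.toNat : ℤ) * ((α : ℂ) ^ i * β ^ j.toNat)) else 0 := by
  split_ifs with h
  · lift j to ℕ using h
    rw [coeff_substLin_natCast, coeff_taylorCoeff, Int.toNat_natCast]
  · rw [coeff_substLin_of_neg _ _ _ (by omega), HahnSeries.coeff_zero]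

/-- The expansion of `f(x - y)` in the definition of weak quantum vertex algebras is the image of `f`
under a homomorphism of fields. -/
theorem coeff_coeff_substLin_eq_subExpand (f : LaurentSeries ℂ) (i j : ℤ) :
    ((substLin 1 (-1) f).coeff j).coeff i = subExpand f i j := by
  rw [coeff_coeff_substLin, subExpand]
  simp only [Units.val_one, one_zpow, one_mul, mul_comm]

theorem substLin_expSeries (α : ℂˣ) (β c : ℂ) :
    substLin α β (expSeries c) = inX (expSeries (c * α)) * inY (expSeries (c * β)) := by
  ext j i
  rw [coeff_inX_mul, coeff_inY, mul_comm, HahnSeries.C_mul_eq_smul, HahnSeries.coeff_smul,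
    coeff_coeff_substLin, coeff_expSeries (c * β)]
  split_ifs with hj
  swap
  · rw [zero_smul]
  lift j to ℕ using hj
  rw [Int.toNat_natCast, smul_eq_mul]
  by_cases hi : 0 ≤ i
  · lift i to ℕ using hi
    have e : ((i : ℤ) + j) = ((i + j : ℕ) : ℤ) := by push_cast; ring
    rw [e, coeff_expSeries_natCast, coeff_expSeries_natCast, Ring.choose_natCast]
    have e' : (((i + j).choose j : ℕ) : ℂ) * i.factorial * j.factorial = (i + j).factorial := by
      have h := Nat.choose_mul_factorial_mul_factorial (Nat.le_add_left j i)
      rw [Nat.add_sub_cancel] at h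
      rw [← h]
      push_cast
      ring
    have h1 : (i.factorial : ℂ) ≠ 0 := Nat.cast_ne_zero.2 (Nat.factorial_ne_zero _)
    have h2 : (j.factorial : ℂ) ≠ 0 := Nat.cast_ne_zero.2 (Nat.factorial_ne_zero _)
    have h3 : ((i + j).factorial : ℂ) ≠ 0 := Nat.cast_ne_zero.2 (Nat.factorial_ne_zero _)
    push_cast
    rw [zpow_natCast]
    field_simp
    rw [← e']
    ring
  · rw [coeff_expSeries (c * α), if_neg hi, mul_zero]
    by_cases hij : 0 ≤ i + j
    · obtain ⟨k, hk⟩ : ∃ k : ℕ, i + j = k := ⟨(i + j).toNat, by omega⟩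
      rw [hk, Ring.choose_natCast, Nat.choose_eq_zero_of_lt (by omega)]
      simp
    · rw [coeff_expSeries, if_neg hij, zero_mul]

/-- The residue in `x`, that is, the coefficient of `x ^ (-1)`, as a Laurent series in `y`. -/
def resX : IterLaurent →+ LaurentSeries ℂ where
  toFun X := HahnSeries.ofSuppBddBelow (fun n => (X.coeff n).coeff (-1)) (by
    obtain ⟨a, ha⟩ := X.exists_coeff_eq_zero
    exact bddBelow_support_of_forall_lt a fun n hn => by rw [ha n hn, HahnSeries.coeff_zero])
  map_zero' := rfl
  map_add' _ _ := rfl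

theorem coeff_resX (X : IterLaurent) (n : ℤ) : (resX X).coeff n = (X.coeff n).coeff (-1) := rfl

theorem resX_inY_mul (f : LaurentSeries ℂ) (X : IterLaurent) : resX (inY f * X) = f * resX X := by
  obtain ⟨a, ha⟩ := exists_coeff_eq_zero f
  obtain ⟨b, hb⟩ := X.exists_coeff_eq_zero
  ext n
  rw [coeff_resX, IterLaurent.coeff_mul_eq_sum _ _ _ (Finset.Icc a (n - b)),
    coeff_mul_Icc (a := a) (b := b) ha
      (fun n hn => by rw [coeff_resX, hb n hn, HahnSeries.coeff_zero]), HahnSeries.coeff_sum]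
  · refine Finset.sum_congr rfl fun p _ => ?_
    rw [coeff_inY, HahnSeries.C_mul_eq_smul, HahnSeries.coeff_smul, coeff_resX, smul_eq_mul]
  · intro p hp hq
    rw [coeff_inY] at hp
    rw [Finset.mem_Icc]
    constructor
    · by_contra h
      exact hp (by rw [ha p (by omega), map_zero])
    · by_contra h
      exact hq (hb _ (by omega))

/-- The residue in `y`, that is, the coefficient of `y ^ (-1)`, as a Laurent series in `x`. -/
def resY : IterLaurent →+ LaurentSeries ℂ where
  toFun X := X.coeff (-1)
  map_zero' := rfl
  map_add' _ _ := rfl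

theorem resY_apply (X : IterLaurent) : resY X = X.coeff (-1) := rfl

theorem resY_inX_mul (f : LaurentSeries ℂ) (X : IterLaurent) : resY (inX f * X) = f * resY X :=
  coeff_inX_mul _ _ _

theorem choose_neg_one_sub (i j : ℕ) :
    Ring.choose (-1 - i : ℤ) j = (-1) ^ j * ((i + j).choose j : ℤ) := by
  rw [show (-1 - i : ℤ) = -(i + 1) by ring, Ring.choose_neg,
    show ((i : ℤ) + 1 + j - 1) = ((i + j : ℕ) : ℤ) by push_cast; ring, Ring.choose_natCast,
    Int.negOnePow_def]
  simp [Units.smul_def]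

/-- The coefficients of `(x₁ - x₂) ^ k * x₁ ^ p` in its two expansions differ by the coefficient of
`x₀ ^ k * (x₂ + x₀) ^ p`. -/
theorem choose_sub_choose (p n : ℤ) :
    (if 0 ≤ n then Ring.choose (n - 1 - p) n.toNat * (-1) ^ n.toNat else 0 : ℤ)
      - (if 0 ≤ -1 - p then Ring.choose (n - 1 - p) (-1 - p).toNat * (n.negOnePow : ℤ) else 0)
      = if 0 ≤ p - n then Ring.choose p (p - n).toNat else 0 := by
  by_cases hn : 0 ≤ n
  · lift n to ℕ using hn
    rw [if_pos (by omega), Int.toNat_natCast, Int.negOnePow_def, zpow_natCast, Units.val_pow_eq_pow_val]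
    simp only [Units.val_neg, Units.val_one]
    by_cases hp : 0 ≤ p
    · lift p to ℕ using hp
      rw [if_neg (by omega), sub_zero]
      have h : Ring.choose ((n : ℤ) - 1 - p) n * (-1) ^ n = (p.choose n : ℤ) := by
        rw [show ((n : ℤ) - 1 - p) = -(p + 1 - n) by ring, Ring.choose_neg,
          show ((p : ℤ) + 1 - n + n - 1) = p by ring, Ring.choose_natCast, Int.negOnePow_def,
          zpow_natCast, Units.smul_def, Units.val_pow_eq_pow_val, smul_eq_mul, mul_right_comm]
        simp [← mul_pow]
      rw [h]
      split_ifs with hpn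
      · obtain ⟨d, rfl⟩ : ∃ d : ℕ, p = n + d := ⟨p - n, by omega⟩
        rw [Ring.choose_natCast, show (((n + d : ℕ) : ℤ) - n).toNat = d by omega,
          Nat.choose_symm_add]
      · rw [Nat.choose_eq_zero_of_lt (by omega), Nat.cast_zero]
    · obtain ⟨j, rfl⟩ : ∃ j : ℕ, p = -1 - j := ⟨(-1 - p).toNat, by omega⟩
      rw [if_pos (by omega), if_neg (by omega), show (-1 - (-1 - (j : ℤ))).toNat = j by omega,
        show (n : ℤ) - 1 - (-1 - j) = ((n + j : ℕ) : ℤ) by push_cast; ring, Ring.choose_natCast,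
        Ring.choose_natCast, Nat.choose_symm_add, sub_self]
  · rw [if_neg hn]
    by_cases hp : 0 ≤ p
    · lift p to ℕ using hp
      rw [if_neg (by omega), if_pos (by omega), Ring.choose_natCast,
        Nat.choose_eq_zero_of_lt (by omega)]
      simp
    · obtain ⟨j, rfl⟩ : ∃ j : ℕ, p = -1 - j := ⟨(-1 - p).toNat, by omega⟩
      rw [if_pos (by omega), show (-1 - (-1 - (j : ℤ))).toNat = j by omega]
      by_cases hk : 0 ≤ n + j
      · rw [if_neg (by omega)]
        obtain ⟨k, hk⟩ : ∃ k : ℕ, n + j = k := ⟨(n + j).toNat, by omega⟩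
        rw [show n - 1 - (-1 - (j : ℤ)) = k by rw [← hk]; ring, Ring.choose_natCast,
          Nat.choose_eq_zero_of_lt (by omega)]
        simp
      · obtain ⟨i, hi⟩ : ∃ i : ℕ, n = -1 - i - j := ⟨(-1 - n - j).toNat, by omega⟩
        subst hi
        rw [if_pos (by omega), show ((-1 - (j : ℤ)) - (-1 - i - j)).toNat = i by omega,
          show (-1 - i - j : ℤ) - 1 - (-1 - j) = -1 - i by ring, choose_neg_one_sub,
          choose_neg_one_sub, show (-1 - i - j : ℤ) = -((i + j + 1 : ℕ) : ℤ) by push_cast; ring,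
          Int.negOnePow_neg, Int.negOnePow_def, zpow_natCast, Units.val_pow_eq_pow_val,
          add_comm j i, Nat.choose_symm_add]
        simp only [Units.val_neg, Units.val_one, pow_succ, pow_add]
        have : ((-1 : ℤ) ^ j) * (-1) ^ j = 1 := by rw [← mul_pow]; simp
        linear_combination ((-1 : ℤ) ^ i * ((i + j).choose j : ℤ)) * this

/-- The residue identity behind the Jacobi identity:
`Res f(x₁) g(x₁ - x₂) - Res f(x₁) g(-x₂ + x₁) = Res g(x₀) f(x₂ + x₀)`, the residues being taken in
`x₁`, `x₁` and `x₀`. -/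
theorem resX_sub_resY (f g : LaurentSeries ℂ) :
    resX (inX f * substLin 1 (-1) g) - resY (inY f * substLin (-1) 1 g)
      = resY (substLin 1 1 f * inY g) := by
  obtain ⟨a, ha⟩ := exists_coeff_eq_zero f
  obtain ⟨b, hb⟩ := exists_coeff_eq_zero g
  ext n
  set s := Finset.Icc (min a n) (max (-1) (n - 1 - b)) with hs
  have h1 : (resX (inX f * substLin 1 (-1) g)).coeff n = ∑ p ∈ s, f.coeff p * g.coeff (n - 1 - p) *
      ((if 0 ≤ n then Ring.choose (n - 1 - p) n.toNat * (-1) ^ n.toNat else 0 : ℤ) : ℂ) := by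
    rw [coeff_resX, coeff_inX_mul, coeff_mul_eq_sum _ _ _ s]
    · refine Finset.sum_congr rfl fun p _ => ?_
      rw [coeff_coeff_substLin, show -1 - p + n = n - 1 - p by ring]
      split_ifs
      · push_cast; simp only [one_zpow]; ring
      · simp
    · intro p hp hq
      rw [coeff_coeff_substLin] at hq
      rw [hs, Finset.mem_Icc]
      constructor
      · by_contra h
        exact hp (ha _ (by omega))
      · by_contra h
        exact hq (by rw [hb _ (by omega)]; simp)
  have h2 : (resY (inY f * substLin (-1) 1 g)).coeff n = ∑ p ∈ s, f.coeff p * g.coeff (n - 1 - p) *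
      ((if 0 ≤ -1 - p then Ring.choose (n - 1 - p) (-1 - p).toNat * (n.negOnePow : ℤ)
        else 0 : ℤ) : ℂ) := by
    rw [resY_apply, IterLaurent.coeff_mul_eq_sum _ _ _ s, HahnSeries.coeff_sum]
    · refine Finset.sum_congr rfl fun p _ => ?_
      rw [coeff_inY, HahnSeries.C_mul_eq_smul, HahnSeries.coeff_smul, coeff_coeff_substLin,
        show n + (-1 - p) = n - 1 - p by ring, Int.negOnePow_def, smul_eq_mul]
      split_ifs
      · have e : (((-1 : ℤˣ) ^ n : ℤˣ) : ℂ) = (((-1 : ℂˣ) : ℂ)) ^ n := by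
          obtain h | h := Int.even_or_odd n
          · simp [h.neg_one_zpow]
          · simp [h.neg_one_zpow]
        rw [Int.cast_mul, e, one_pow]
        ring
      · simp
    · intro p hp hq
      rw [coeff_inY] at hp
      rw [hs, Finset.mem_Icc]
      constructor
      · by_contra h
        exact hp (by rw [ha _ (by omega), map_zero])
      · by_contra h
        exact hq (coeff_substLin_of_neg _ _ _ (by omega))
  have h3 : (resY (substLin 1 1 f * inY g)).coeff n = ∑ p ∈ s, f.coeff p * g.coeff (n - 1 - p) *
      ((if 0 ≤ p - n then Ring.choose p (p - n).toNat else 0 : ℤ) : ℂ) := by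
    rw [resY_apply, IterLaurent.coeff_mul_eq_sum _ _ _ (s.map (Equiv.subRight n).toEmbedding), Finset.sum_map,
      HahnSeries.coeff_sum]
    · refine Finset.sum_congr rfl fun p _ => ?_
      simp only [Equiv.coe_toEmbedding, Equiv.subRight_apply]
      rw [coeff_inY, mul_comm, HahnSeries.C_mul_eq_smul, HahnSeries.coeff_smul,
        coeff_coeff_substLin, show n + (p - n) = p by ring, show -1 - (p - n) = n - 1 - p by ring,
        smul_eq_mul]
      split_ifs
      · push_cast; simp only [one_pow, one_zpow]; ring
      · simp
    · intro p hp hq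
      rw [coeff_inY] at hq
      rw [Finset.mem_map]
      refine ⟨p + n, ?_, by simp⟩
      rw [hs, Finset.mem_Icc]
      constructor
      · by_contra h
        exact hp (coeff_substLin_of_neg _ _ _ (by omega))
      · by_contra h
        exact hq (by rw [hb _ (by omega), map_zero])
  rw [HahnSeries.coeff_sub, h1, h2, h3, ← Finset.sum_sub_distrib]
  refine Finset.sum_congr rfl fun p _ => ?_
  rw [← choose_sub_choose p n, ← mul_sub, ← Int.cast_sub]

/-- The residue identity with an additional factor in `x₂`, which commutes with the residues. -/
theorem resX_sub_resY_mul (f₁ f₂ f₃ : LaurentSeries ℂ) :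
    resX (inX f₁ * inY f₂ * substLin 1 (-1) f₃) - resY (inY f₁ * inX f₂ * substLin (-1) 1 f₃)
      = resY (substLin 1 1 f₁ * inX f₂ * inY f₃) := by
  rw [show inX f₁ * inY f₂ * substLin 1 (-1) f₃ = inY f₂ * (inX f₁ * substLin 1 (-1) f₃) by ring,
    show inY f₁ * inX f₂ * substLin (-1) 1 f₃ = inX f₂ * (inY f₁ * substLin (-1) 1 f₃) by ring,
    show substLin 1 1 f₁ * inX f₂ * inY f₃ = inX f₂ * (substLin 1 1 f₁ * inY f₃) by ring,
    resX_inY_mul, resY_inX_mul, resY_inX_mul, ← mul_sub, resX_sub_resY]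

end Laurent

/-! ### Products of series in two variables -/

section Iterated

variable {V : Type*} [AddCommGroup V]

/-- `A(x, y)` lies in `V((x))((y))`. -/
def IsIterTruncated (A : ℤ → ℤ → V) : Prop :=
  (∃ b : ℤ, ∀ n < b, ∀ m, A m n = 0) ∧ ∀ n, ∃ a : ℤ, ∀ m < a, A m n = 0

theorem IsIterTruncated.sum {ι : Type*} (s : Finset ι) {A : ι → ℤ → ℤ → V}
    (hA : ∀ i, IsIterTruncated (A i)) : IsIterTruncated (∑ i ∈ s, A i) := by
  choose b hb using fun i => (hA i).1
  choose a ha using fun i => (hA i).2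
  obtain ⟨b', hb'⟩ := (s.image b).bddBelow
  refine ⟨⟨b', fun n hn m => ?_⟩, fun n => ?_⟩
  · rw [Finset.sum_apply, Finset.sum_apply]
    refine Finset.sum_eq_zero fun i hi => hb i n ?_ m
    exact hn.trans_le (hb' (Finset.mem_image_of_mem _ hi))
  · obtain ⟨a', ha'⟩ := (s.image fun i => a i n).bddBelow
    refine ⟨a', fun m hm => ?_⟩
    rw [Finset.sum_apply, Finset.sum_apply]
    refine Finset.sum_eq_zero fun i hi => ha i n m ?_
    exact hm.trans_le (ha' (Finset.mem_image_of_mem (fun i => a i n) hi))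

/-- For each `n`, the coefficients of `y ^ n` in `Z(x, y) A(x, y)` involve finitely many powers of
`y` in `Z`, and a common lower bound holds for the powers of `x` in the corresponding coefficients
of `Z` and of `A`. -/
theorem IsIterTruncated.exists_bounds {A : ℤ → ℤ → V} (hA : IsIterTruncated A) (Z : IterLaurent)
    (n : ℤ) : ∃ (t : Finset ℤ) (c a : ℤ),
      (∀ j, Z.coeff j ≠ 0 → (∃ i, A i (n - j) ≠ 0) → j ∈ t) ∧
      (∀ j ∈ t, ∀ i < c, (Z.coeff j).coeff i = 0) ∧ (∀ j ∈ t, ∀ i < a, A i (n - j) = 0) := by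
  obtain ⟨b, hb⟩ := hA.1
  choose a ha using hA.2
  obtain ⟨z, hz⟩ := Z.exists_coeff_eq_zero
  choose c hc using fun j => exists_coeff_eq_zero (Z.coeff j)
  obtain ⟨c', hc'⟩ := ((Finset.Icc z (n - b)).image c).bddBelow
  obtain ⟨a', ha'⟩ := ((Finset.Icc z (n - b)).image fun j => a (n - j)).bddBelow
  refine ⟨Finset.Icc z (n - b), c', a', fun j hj => ?_, fun j hj i hi => hc j i ?_,
    fun j hj i hi => ha _ i ?_⟩
  · rintro ⟨i, hi⟩
    rw [Finset.mem_Icc]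
    constructor
    · by_contra h
      exact hj (hz _ (by omega))
    · by_contra h
      exact hi (hb _ (by omega) _)
  · exact hi.trans_le (hc' (Finset.mem_image_of_mem _ hj))
  · exact hi.trans_le (ha' (Finset.mem_image_of_mem (fun j => a (n - j)) hj))

variable [Module ℂ V]

/-- The scalar series obtained by applying the functional `φ` to the coefficients of `A`. -/
def IsIterTruncated.toIter {A : ℤ → ℤ → V} (hA : IsIterTruncated A) (φ : V →ₗ[ℂ] ℂ) :
    IterLaurent :=
  IterLaurent.mk (fun n => HahnSeries.ofSuppBddBelow (fun m => φ (A m n)) (by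
      obtain ⟨a, ha⟩ := hA.2 n
      exact bddBelow_support_of_forall_lt a fun m hm => by rw [ha m hm, map_zero])) (by
    obtain ⟨b, hb⟩ := hA.1
    refine bddBelow_support_of_forall_lt b fun n hn => ?_
    ext m
    change φ (A m n) = 0
    rw [hb n hn, map_zero])

theorem IsIterTruncated.coeff_toIter {A : ℤ → ℤ → V} (hA : IsIterTruncated A) (φ : V →ₗ[ℂ] ℂ)
    (m n : ℤ) : ((hA.toIter φ).coeff n).coeff m = φ (A m n) := rfl

theorem IsIterTruncated.mul₂_eq_sum {A : ℤ → ℤ → V} (Z : IterLaurent) {n : ℤ} {t : Finset ℤ}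
    {c a : ℤ} (h₁ : ∀ j, Z.coeff j ≠ 0 → (∃ i, A i (n - j) ≠ 0) → j ∈ t)
    (h₂ : ∀ j ∈ t, ∀ i < c, (Z.coeff j).coeff i = 0) (h₃ : ∀ j ∈ t, ∀ i < a, A i (n - j) = 0)
    (m : ℤ) :
    mul₂ (fun i j => (Z.coeff j).coeff i) A m n
      = ∑ j ∈ t, ∑ i ∈ Finset.Icc c (m - a), (Z.coeff j).coeff i • A (m - i) (n - j) := by
  rw [mul₂, finsum_eq_sum_of_support_subset (s := Finset.Icc c (m - a) ×ˢ t),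
    Finset.sum_product_right]
  rintro ⟨i, j⟩ hij
  have hZ : (Z.coeff j).coeff i ≠ 0 := fun h => hij (by simp only [h, zero_smul])
  have hA : A (m - i) (n - j) ≠ 0 := fun h => hij (by simp only [h, smul_zero])
  have hj := h₁ j (fun h => hZ (by rw [h, HahnSeries.coeff_zero])) ⟨_, hA⟩
  rw [Finset.mem_coe, Finset.mem_product, Finset.mem_Icc]
  refine ⟨⟨?_, ?_⟩, hj⟩
  · by_contra h
    exact hZ (h₂ j hj i (by omega))
  · by_contra h
    exact hA (h₃ j hj _ (by simp only at h ⊢; omega))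

theorem IsIterTruncated.mul₂ {A : ℤ → ℤ → V} (hA : IsIterTruncated A) (Z : IterLaurent) :
    IsIterTruncated (TrigQVA.mul₂ (fun i j => (Z.coeff j).coeff i) A) := by
  refine ⟨?_, fun n => ?_⟩
  · obtain ⟨b, hb⟩ := hA.1
    obtain ⟨z, hz⟩ := Z.exists_coeff_eq_zero
    refine ⟨z + b, fun n hn m => finsum_eq_zero_of_forall_eq_zero fun ij => ?_⟩
    change (Z.coeff ij.2).coeff ij.1 • _ = _
    by_cases h : ij.2 < z
    · rw [hz _ h, HahnSeries.coeff_zero, zero_smul]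
    · rw [hb _ (by omega), smul_zero]
  · obtain ⟨t, c, a, h₁, h₂, h₃⟩ := hA.exists_bounds Z n
    refine ⟨c + a, fun m hm => ?_⟩
    rw [IsIterTruncated.mul₂_eq_sum Z h₁ h₂ h₃, Finset.Icc_eq_empty (by omega)]
    simp

/-- A product of a scalar series in `ℂ((x))((y))` and a series in `V((x))((y))`, given by finite sums,
becomes a product in the field `ℂ((x))((y))` when a functional is applied. -/
theorem IsIterTruncated.map_mul₂ {A : ℤ → ℤ → V} (hA : IsIterTruncated A) (Z : IterLaurent)
    (φ : V →ₗ[ℂ] ℂ) (m n : ℤ) :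
    φ (TrigQVA.mul₂ (fun i j => (Z.coeff j).coeff i) A m n)
      = ((Z * hA.toIter φ).coeff n).coeff m := by
  obtain ⟨t, c, a, h₁, h₂, h₃⟩ := hA.exists_bounds Z n
  rw [IsIterTruncated.mul₂_eq_sum Z h₁ h₂ h₃, IterLaurent.coeff_mul_eq_sum _ _ n t, HahnSeries.coeff_sum,
    map_sum]
  · refine Finset.sum_congr rfl fun j hj => ?_
    rw [coeff_mul_Icc (h₂ j hj) (b := a), map_sum]
    · refine Finset.sum_congr rfl fun i _ => ?_
      rw [map_smul, hA.coeff_toIter, smul_eq_mul]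
    · intro i hi
      rw [hA.coeff_toIter, h₃ j hj i hi, map_zero]
  · intro j hj hne
    refine h₁ j hj ?_
    by_contra! h
    refine hne ?_
    ext i
    rw [hA.coeff_toIter, h, map_zero, HahnSeries.coeff_zero]

end Iterated

/-! ### The action of Laurent polynomials on formal series -/

section Action

variable {Λ M : Type*} [AddCommGroup Λ] [AddCommGroup M] [Module ℂ M]

/-- The action of the Laurent polynomials `ℂ[Λ]` on the formal series with exponents in `Λ` and
coefficients in `M`: the monomial with exponent `g` shifts the exponents by `g`. -/
def act : AddMonoidAlgebra ℂ Λ →ₐ[ℂ] Module.End ℂ (Λ → M) :=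
  AddMonoidAlgebra.lift ℂ _ Λ
    { toFun := fun g => LinearMap.funLeft ℂ M fun x => x - g.toAdd
      map_one' := by ext f x; simp [LinearMap.funLeft_apply]
      map_mul' := fun g h => by
        ext f x
        simp [LinearMap.funLeft_apply, sub_sub] }

theorem act_single (g : Λ) (c : ℂ) (f : Λ → M) (x : Λ) :
    act (AddMonoidAlgebra.single g c) f x = c • f (x - g) := by
  rw [act, AddMonoidAlgebra.lift_single]
  rfl

theorem act_add (d e : AddMonoidAlgebra ℂ Λ) (f : Λ → M) : act (d + e) f = act d f + act e f := by
  rw [map_add, LinearMap.add_apply]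

theorem act_mul (d e : AddMonoidAlgebra ℂ Λ) (f : Λ → M) : act (d * e) f = act d (act e f) := by
  rw [map_mul, Module.End.mul_apply]

theorem act_map_apply {M' : Type*} [AddCommGroup M'] [Module ℂ M'] (φ : M →ₗ[ℂ] M')
    (d : AddMonoidAlgebra ℂ Λ) (f : Λ → M) (x : Λ) :
    act d (fun y => φ (f y)) x = φ (act d f x) := by
  induction d using AddMonoidAlgebra.induction_linear with
  | zero => simp
  | add d e hd he => rw [act_add, act_add, Pi.add_apply, Pi.add_apply, hd, he, map_add]
  | single g c => rw [act_single, act_single, map_smul]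

/-- On Laurent polynomials the action is the multiplication. -/
theorem act_coeff (d P : AddMonoidAlgebra ℂ Λ) : act d (P.coeff : Λ → ℂ) = ⇑(d * P).coeff := by
  induction d using AddMonoidAlgebra.induction_linear with
  | zero => ext; simp
  | add d e hd he => rw [act_add, hd, he, add_mul]; rfl
  | single g c =>
    ext x
    rw [act_single, AddMonoidAlgebra.coeff_single_mul_eq_mul_coeff (x - g), smul_eq_mul]
    intro y _
    exact eq_sub_iff_add_eq'.symm

/-- The Laurent polynomial `p(t^g)` given by a polynomial `p` and an exponent `g`. -/
def lau (g : Λ) : Polynomial ℂ →ₐ[ℂ] AddMonoidAlgebra ℂ Λ :=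
  Polynomial.aeval (AddMonoidAlgebra.single g 1)

theorem lau_monomial (g : Λ) (j : ℕ) (c : ℂ) :
    lau g (Polynomial.monomial j c) = AddMonoidAlgebra.single (j • g) c := by
  rw [lau, Polynomial.aeval_monomial, AddMonoidAlgebra.single_pow, one_pow,
    ← Algebra.smul_def, AddMonoidAlgebra.smul_single, smul_eq_mul, mul_one]

theorem act_lau (g : Λ) (p : Polynomial ℂ) (f : Λ → M) (x : Λ) :
    act (lau g p) f x = p.sum fun j c => c • f (x - j • g) := by
  induction p using Polynomial.induction_on' with
  | add p q hp hq =>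
    rw [map_add, act_add, Pi.add_apply, hp, hq, Polynomial.sum_add_index]
    · simp
    · intros; rw [add_smul]
  | monomial j c =>
    rw [lau_monomial, act_single, Polynomial.sum_monomial_index]
    rw [zero_smul]

theorem coeff_lau_smul {g : Λ} (hg : Function.Injective fun j : ℕ => j • g) (p : Polynomial ℂ)
    (i : ℕ) : (lau g p).coeff (i • g) = p.coeff i := by
  induction p using Polynomial.induction_on' with
  | add p q hp hq =>
    rw [map_add, AddMonoidAlgebra.coeff_add, Finsupp.add_apply, hp, hq, Polynomial.coeff_add]
  | monomial j c =>
    classical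
    rw [lau_monomial, AddMonoidAlgebra.coeff_single, Finsupp.single_apply,
      Polynomial.coeff_monomial]
    exact if_congr hg.eq_iff rfl rfl

theorem lau_ne_zero {g : Λ} (hg : Function.Injective fun j : ℕ => j • g) {p : Polynomial ℂ}
    (hp : p ≠ 0) : lau g p ≠ 0 := by
  intro h
  refine hp (Polynomial.ext fun i => ?_)
  rw [← coeff_lau_smul hg, h]
  rfl

omit [AddCommGroup Λ] in
theorem exists_coeff_eq {f : Λ → ℂ} (hf : (Function.support f).Finite) :
    ∃ P : AddMonoidAlgebra ℂ Λ, ⇑P.coeff = f :=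
  ⟨AddMonoidAlgebra.ofCoeff (Finsupp.ofSupportFinite f hf), rfl⟩

/-- The series `f` is supported where the degree `ℓ` is bounded below. -/
def IsBoundedAlong (ℓ : Λ →+ ℤ) (f : Λ → M) : Prop := ∃ c : ℤ, ∀ x, ℓ x < c → f x = 0

omit [Module ℂ M] in
theorem IsBoundedAlong.add {ℓ : Λ →+ ℤ} {f g : Λ → M} (hf : IsBoundedAlong ℓ f)
    (hg : IsBoundedAlong ℓ g) : IsBoundedAlong ℓ (f + g) := by
  obtain ⟨c, hc⟩ := hf
  obtain ⟨c', hc'⟩ := hg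
  refine ⟨min c c', fun x hx => ?_⟩
  rw [Pi.add_apply, hc x (by omega), hc' x (by omega), add_zero]

omit [Module ℂ M] in
theorem IsBoundedAlong.sum {ι : Type*} (s : Finset ι) {ℓ : Λ →+ ℤ} {f : ι → Λ → M}
    (hf : ∀ i, IsBoundedAlong ℓ (f i)) : IsBoundedAlong ℓ (∑ i ∈ s, f i) := by
  classical
  induction s using Finset.induction_on with
  | empty => exact ⟨0, fun x _ => rfl⟩
  | insert i s hi ih => rw [Finset.sum_insert hi]; exact (hf i).add ih

theorem IsBoundedAlong.act {ℓ : Λ →+ ℤ} {f : Λ → M} (hf : IsBoundedAlong ℓ f)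
    (d : AddMonoidAlgebra ℂ Λ) : IsBoundedAlong ℓ (TrigQVA.act d f) := by
  induction d using AddMonoidAlgebra.induction_linear with
  | zero => exact ⟨0, fun x _ => by simp⟩
  | add d e hd he => rw [act_add]; exact hd.add he
  | single g c =>
    obtain ⟨b, hb⟩ := hf
    refine ⟨b + ℓ g, fun x hx => ?_⟩
    rw [act_single, hb _ (by rw [map_sub]; omega), smul_zero]

end Action

/-! ### The substitution of exponentials -/

section Exp

/-- The evaluation `t ↦ e^z` of Laurent polynomials. -/
def evalExp : AddMonoidAlgebra ℂ ℤ →+* LaurentSeries ℂ :=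
  AddMonoidAlgebra.liftNCRingHom HahnSeries.C
    { toFun := fun n => expSeries (n.toAdd : ℂ)
      map_one' := by simp [expSeries_zero]
      map_mul' := fun m n => by simp [expSeries_add] } fun _ _ => Commute.all _ _

theorem evalExp_single (n : ℤ) (c : ℂ) :
    evalExp (AddMonoidAlgebra.single n c) = HahnSeries.C c * expSeries (n : ℂ) :=
  AddMonoidAlgebra.liftNC_single _ _ _ _

theorem evalExp_lau_one (p : Polynomial ℂ) :
    evalExp (lau 1 p) = HahnSeries.ofPowerSeries ℤ ℂ (Polynomial.aeval (PowerSeries.exp ℂ) p) := by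
  induction p using Polynomial.induction_on' with
  | add p q hp hq => rw [map_add, map_add, hp, hq, map_add, map_add]
  | monomial n c =>
    rw [lau_monomial, evalExp_single, Polynomial.aeval_monomial, PowerSeries.exp_pow_eq_rescale_exp,
      map_mul, expSeries, nsmul_one, Int.cast_natCast, ← HahnSeries.ofPowerSeries_C]
    rfl

theorem toLaurent_eq_lau (p : Polynomial ℂ) : Polynomial.toLaurent p = lau 1 p := by
  induction p using Polynomial.induction_on' with
  | add p q hp hq => rw [map_add, map_add, hp, hq]
  | monomial n c =>
    rw [lau_monomial, nsmul_one, ← Polynomial.C_mul_X_pow_eq_monomial,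
      Polynomial.toLaurent_C_mul_X_pow, ← LaurentPolynomial.single_eq_C_mul_T]

/-- The exponentials `e^{nz}` are linearly independent, so the substitution `t ↦ e^z` is injective. -/
theorem evalExp_ne_zero {d : AddMonoidAlgebra ℂ ℤ} (hd : d ≠ 0) : evalExp d ≠ 0 := by
  obtain ⟨n, f, hf⟩ := LaurentPolynomial.exists_T_pow d
  have hf0 : f ≠ 0 := by
    rintro rfl
    rw [map_zero] at hf
    exact hd ((LaurentPolynomial.isUnit_T n).mul_left_eq_zero.1 hf.symm)
  have hlau : Polynomial.toLaurent f = lau 1 f := toLaurent_eq_lau f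
  intro h
  have h1 : evalExp (lau 1 f) = 0 := by
    rw [← hlau, hf]
    exact (map_mul evalExp d (LaurentPolynomial.T n)).trans (by rw [h, zero_mul])
  rw [evalExp_lau_one, map_eq_zero_iff _ HahnSeries.ofPowerSeries_injective] at h1
  exact aeval_exp_ne_zero hf0 h1

/-- The evaluation `t₁ ↦ e^x`, `t₂ ↦ e^y` of Laurent polynomials in two variables. -/
def evalExp₂ : AddMonoidAlgebra ℂ (ℤ × ℤ) →+* IterLaurent :=
  AddMonoidAlgebra.liftNCRingHom (inX.comp HahnSeries.C)
    { toFun := fun g => inX (expSeries (g.toAdd.1 : ℂ)) * inY (expSeries (g.toAdd.2 : ℂ))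
      map_one' := by
        simp only [toAdd_one, Prod.fst_zero, Prod.snd_zero, Int.cast_zero, expSeries_zero, map_one,
          mul_one]
      map_mul' := fun g h => by
        simp only [toAdd_mul, Prod.fst_add, Prod.snd_add, Int.cast_add, expSeries_add, map_mul]
        ring } fun _ _ => Commute.all _ _

theorem evalExp₂_single (g : ℤ × ℤ) (c : ℂ) :
    evalExp₂ (AddMonoidAlgebra.single g c)
      = inX (HahnSeries.C c) * (inX (expSeries (g.1 : ℂ)) * inY (expSeries (g.2 : ℂ))) :=
  AddMonoidAlgebra.liftNC_single _ _ _ _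

/-- The formal series `f(t)`, in which `e^z` cannot be substituted for `t` directly, satisfies `d(t) f(t) = P(t)` for Laurent polynomials `d ≠ 0` and `P`,
and `g(z) = P(e^z) / d(e^z)`. -/
def HasExpSubst (f : ℤ → ℂ) (g : LaurentSeries ℂ) : Prop :=
  ∃ d P : AddMonoidAlgebra ℂ ℤ, d ≠ 0 ∧ act d f = P.coeff ∧ evalExp d * g = evalExp P

theorem mul_ne_zero_of_evalExp {d e : AddMonoidAlgebra ℂ ℤ} (hd : d ≠ 0) (he : e ≠ 0) :
    d * e ≠ 0 := by
  intro h
  have := mul_ne_zero (evalExp_ne_zero hd) (evalExp_ne_zero he)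
  rw [← map_mul, h, map_zero] at this
  exact this rfl

namespace HasExpSubst

/-- The result of the substitution depends neither on the denominator nor on the numerator. -/
theorem unique {f : ℤ → ℂ} {g g' : LaurentSeries ℂ} (h : HasExpSubst f g)
    (h' : HasExpSubst f g') : g = g' := by
  obtain ⟨d, P, hd, hf, hg⟩ := h
  obtain ⟨e, Q, he, hf', hg'⟩ := h'
  have hPQ : e * P = d * Q := by
    ext x
    have h1 : act (e * d) f x = (e * P).coeff x := by rw [act_mul, hf, act_coeff]
    have h2 : act (d * e) f x = (d * Q).coeff x := by rw [act_mul, hf', act_coeff]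
    rw [← h1, ← h2, mul_comm]
  refine mul_left_cancel₀ (mul_ne_zero (evalExp_ne_zero hd) (evalExp_ne_zero he)) ?_
  calc evalExp d * evalExp e * g = evalExp e * (evalExp d * g) := by ring
    _ = evalExp d * (evalExp e * g') := by rw [hg, hg', ← map_mul, hPQ, map_mul]
    _ = _ := by ring

theorem coeff (P : AddMonoidAlgebra ℂ ℤ) : HasExpSubst P.coeff (evalExp P) :=
  ⟨1, P, one_ne_zero, by rw [map_one]; rfl, by rw [map_one, one_mul]⟩

theorem zero : HasExpSubst 0 0 := by
  simpa using coeff 0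

theorem act {f : ℤ → ℂ} {g : LaurentSeries ℂ} (h : HasExpSubst f g) (e : AddMonoidAlgebra ℂ ℤ) :
    HasExpSubst (TrigQVA.act e f) (evalExp e * g) := by
  obtain ⟨d, P, hd, hf, hg⟩ := h
  refine ⟨d, e * P, hd, ?_, ?_⟩
  · rw [← act_mul, mul_comm, act_mul, hf, act_coeff]
  · rw [mul_left_comm, hg, map_mul]

theorem add {f f' : ℤ → ℂ} {g g' : LaurentSeries ℂ} (h : HasExpSubst f g)
    (h' : HasExpSubst f' g') : HasExpSubst (f + f') (g + g') := by
  obtain ⟨d, P, hd, hf, hg⟩ := h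
  obtain ⟨e, Q, he, hf', hg'⟩ := h'
  refine ⟨d * e, e * P + d * Q, mul_ne_zero_of_evalExp hd he, ?_, ?_⟩
  · rw [map_add, mul_comm d e, act_mul, hf, mul_comm e d, act_mul, hf', act_coeff, act_coeff]
    rfl
  · rw [map_add, map_mul, map_mul, map_mul, ← hg, ← hg']
    ring

theorem smul {f : ℤ → ℂ} {g : LaurentSeries ℂ} (h : HasExpSubst f g) (c : ℂ) :
    HasExpSubst (c • f) (HahnSeries.C c * g) := by
  obtain ⟨d, P, hd, hf, hg⟩ := h
  refine ⟨d, AddMonoidAlgebra.single 0 c * P, hd, ?_, ?_⟩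
  · rw [map_smul, hf, ← act_coeff]
    ext m
    rw [act_single, sub_zero]
    rfl
  · rw [mul_left_comm, hg, map_mul, evalExp_single, Int.cast_zero, expSeries_zero, mul_one]

theorem sum {ι : Type*} (s : Finset ι) {f : ι → ℤ → ℂ} {g : ι → LaurentSeries ℂ}
    (h : ∀ i ∈ s, HasExpSubst (f i) (g i)) : HasExpSubst (∑ i ∈ s, f i) (∑ i ∈ s, g i) := by
  classical
  induction s using Finset.induction_on with
  | empty => exact zero
  | insert i s hi ih =>
    rw [Finset.sum_insert hi, Finset.sum_insert hi]
    exact (h i (Finset.mem_insert_self _ _)).add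
      (ih fun j hj => h j (Finset.mem_insert_of_mem hj))

theorem shift {f : ℤ → ℂ} {g : LaurentSeries ℂ} (h : HasExpSubst f g) (i : ℤ) :
    HasExpSubst (fun m => f (m - i)) (expSeries (i : ℂ) * g) := by
  have := h.act (AddMonoidAlgebra.single i 1)
  rw [evalExp_single, map_one, one_mul] at this
  convert this using 1
  ext m
  rw [act_single, one_smul]

end HasExpSubst

end Exp

/-! ### Iterated substitution of exponentials -/

section Iterated

/-- The action on sequences of Laurent series in `z` of the Laurent polynomials in `t₁` and `t₂`,
where `t₁` shifts the sequence and `t₂` is the multiplication by `e^z`. -/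
def rowAct : AddMonoidAlgebra ℂ (ℤ × ℤ) →+ (ℤ → LaurentSeries ℂ) → ℤ → LaurentSeries ℂ where
  toFun d B m := d.coeff.sum fun g c => HahnSeries.C c * (expSeries (g.2 : ℂ) * B (m - g.1))
  map_zero' := rfl
  map_add' d e := by
    funext B m
    exact Finsupp.sum_add_index' (h := fun (g : ℤ × ℤ) (c : ℂ) =>
      HahnSeries.C c * (expSeries (g.2 : ℂ) * B (m - g.1)))
      (fun g => by rw [map_zero, zero_mul]) fun g c c' => by rw [map_add, add_mul]

theorem rowAct_single (g : ℤ × ℤ) (c : ℂ) (B : ℤ → LaurentSeries ℂ) (m : ℤ) :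
    rowAct (AddMonoidAlgebra.single g c) B m
      = HahnSeries.C c * (expSeries (g.2 : ℂ) * B (m - g.1)) := by
  change (AddMonoidAlgebra.single g c).coeff.sum (fun (g : ℤ × ℤ) (c : ℂ) =>
    HahnSeries.C c * (expSeries (g.2 : ℂ) * B (m - g.1))) = _
  rw [AddMonoidAlgebra.coeff_single, Finsupp.sum_single_index]
  rw [map_zero, zero_mul]

theorem HasExpSubst.rowAct {A : ℤ × ℤ → ℂ} {B : ℤ → LaurentSeries ℂ}
    (h : ∀ m, HasExpSubst (fun n => A (m, n)) (B m)) (D : AddMonoidAlgebra ℂ (ℤ × ℤ)) (m : ℤ) :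
    HasExpSubst (fun n => TrigQVA.act D A (m, n)) (TrigQVA.rowAct D B m) := by
  induction D using AddMonoidAlgebra.induction_linear with
  | zero =>
    rw [map_zero, map_zero]
    exact zero
  | add d e hd he =>
    rw [act_add, map_add]
    exact hd.add he
  | single g c =>
    rw [rowAct_single]
    convert ((h (m - g.1)).shift g.2).smul c using 1
    ext n
    rw [act_single]
    rfl

/-- The columns of `D(t₁, e^y) B`, where the coefficients of the powers of `y` in the rows of `B` are
obtained from `G` by `t₁ ↦ e^x`. The common bound `k₀` makes the coefficients of `e^{jy} B` finite
sums with a number of terms that does not depend on the row. -/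
theorem HasExpSubst.coeff_rowAct {B : ℤ → LaurentSeries ℂ} {k₀ : ℤ}
    (hB : ∀ m, ∀ k < k₀, (B m).coeff k = 0) {G : IterLaurent}
    (hG : ∀ k, HasExpSubst (fun m => (B m).coeff k) (G.coeff k))
    (D : AddMonoidAlgebra ℂ (ℤ × ℤ)) (k : ℤ) :
    HasExpSubst (fun m => (TrigQVA.rowAct D B m).coeff k) ((evalExp₂ D * G).coeff k) := by
  have hG₀ : ∀ k < k₀, G.coeff k = 0 := fun k hk => by
    refine (hG k).unique ?_
    convert zero using 1
    ext m
    exact hB m k hk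
  induction D using AddMonoidAlgebra.induction_linear with
  | zero =>
    rw [map_zero, map_zero]
    rw [zero_mul]
    exact zero
  | add d e hd he =>
    rw [map_add, map_add]
    rw [add_mul]
    exact hd.add he
  | single g c =>
    set L := (k - k₀).toNat + 1 with hL
    have h := (HasExpSubst.sum (Finset.range L) fun l _ =>
      ((hG (k - (l : ℕ))).shift g.1).smul ((g.2 : ℂ) ^ l / (l.factorial : ℂ))).smul c
    convert h using 1
    · ext m
      rw [rowAct_single, HahnSeries.C_mul_eq_smul, HahnSeries.coeff_smul,
        coeff_expSeries_mul _ (hB _) k (L := L) (by omega)]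
      simp [Finset.sum_apply]
    · rw [evalExp₂_single, mul_assoc, coeff_inX_mul, mul_assoc, coeff_inX_mul]
      congr 1
      rw [IterLaurent.coeff_mul_eq_sum _ _ k ((Finset.range L).map Nat.castEmbedding), Finset.sum_map,
        Finset.mul_sum]
      · refine Finset.sum_congr rfl fun l _ => ?_
        rw [Nat.castEmbedding_apply, coeff_inY, coeff_expSeries_natCast, mul_left_comm]
      · intro p hp hq
        rw [coeff_inY, coeff_expSeries] at hp
        have hp0 : 0 ≤ p := by
          by_contra hlt
          exact hp (by rw [if_neg hlt, map_zero])
        lift p to ℕ using hp0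
        rw [Finset.mem_map]
        refine ⟨p, ?_, rfl⟩
        rw [Finset.mem_range]
        by_contra hle
        exact hq (hG₀ _ (by omega))

/-- Let `A(t₁, t₂)` be a formal series such that `D(t₁, t₂) A(t₁, t₂) = P(t₁, t₂)` is a Laurent
polynomial. If `G(x, y)` is obtained from `A` by the substitution of `e^y` for `t₂` and then of
`e^x` for `t₁` in each coefficient, then `D(e^x, e^y) G(x, y) = P(e^x, e^y)`. -/
theorem evalExp₂_mul_eq {A : ℤ × ℤ → ℂ} {D P : AddMonoidAlgebra ℂ (ℤ × ℤ)}
    (hA : act D A = P.coeff) {B : ℤ → LaurentSeries ℂ}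
    (hAB : ∀ m, HasExpSubst (fun n => A (m, n)) (B m)) {k₀ : ℤ}
    (hB : ∀ m, ∀ k < k₀, (B m).coeff k = 0) {G : IterLaurent}
    (hG : ∀ k, HasExpSubst (fun m => (B m).coeff k) (G.coeff k)) :
    evalExp₂ D * G = evalExp₂ P := by
  -- `P` is obtained from the series `1`, whose substitution is `1`, by the action of `P`.
  set B₁ : ℤ → LaurentSeries ℂ := Pi.single 0 1 with hB₁
  have hδ : ∀ m n : ℤ, (1 : AddMonoidAlgebra ℂ (ℤ × ℤ)).coeff (m, n)
      = if m = 0 ∧ n = 0 then 1 else 0 := by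
    intro m n
    rw [AddMonoidAlgebra.one_def, AddMonoidAlgebra.coeff_single, Finsupp.single_apply]
    exact if_congr (by rw [eq_comm, Prod.mk_eq_zero]) rfl rfl
  have hδ' : ∀ n : ℤ, (1 : AddMonoidAlgebra ℂ ℤ).coeff n = if n = 0 then 1 else 0 := by
    intro n
    rw [AddMonoidAlgebra.one_def, AddMonoidAlgebra.coeff_single, Finsupp.single_apply]
    exact if_congr eq_comm rfl rfl
  have hB₁' : ∀ m k, (B₁ m).coeff k = if m = 0 ∧ k = 0 then 1 else 0 := by
    intro m k
    by_cases hm : m = 0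
    · subst hm
      rw [hB₁, Pi.single_eq_same, HahnSeries.coeff_one]
      by_cases hk : k = 0 <;> simp [hk]
    · rw [hB₁, Pi.single_eq_of_ne hm, if_neg fun h => hm h.1, HahnSeries.coeff_zero]
  have h₁ : ∀ m, HasExpSubst (fun n => (1 : AddMonoidAlgebra ℂ (ℤ × ℤ)).coeff (m, n)) (B₁ m) := by
    intro m
    by_cases hm : m = 0
    · subst hm
      rw [hB₁, Pi.single_eq_same, ← map_one evalExp]
      convert HasExpSubst.coeff 1 using 1
      ext n
      rw [hδ, hδ']
      exact if_congr (and_iff_right rfl) rfl rfl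
    · rw [hB₁, Pi.single_eq_of_ne hm]
      convert HasExpSubst.zero using 1
      ext n
      rw [hδ, if_neg fun h => hm h.1]
      rfl
  have h₂ : ∀ m, ∀ k < (0 : ℤ), (B₁ m).coeff k = 0 := by
    intro m k hk
    rw [hB₁', if_neg fun h => hk.ne h.2]
  have h₃ : ∀ k, HasExpSubst (fun m => (B₁ m).coeff k) ((1 : IterLaurent).coeff k) := by
    intro k
    by_cases hk : k = 0
    · subst hk
      rw [IterLaurent.coeff_one, if_pos rfl, ← map_one evalExp]
      convert HasExpSubst.coeff 1 using 1
      ext m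
      rw [hB₁', hδ']
      exact if_congr (and_iff_left rfl) rfl rfl
    · rw [IterLaurent.coeff_one, if_neg hk]
      convert HasExpSubst.zero using 1
      ext m
      rw [hB₁', if_neg fun h => hk h.2]
      rfl
  have hrow : rowAct D B = rowAct P B₁ := by
    ext1 m
    refine (HasExpSubst.rowAct hAB D m).unique ?_
    have := HasExpSubst.rowAct h₁ P m
    rwa [act_coeff, mul_one, ← hA] at this
  refine IterLaurent.ext fun k => ?_
  refine (HasExpSubst.coeff_rowAct hB hG D k).unique ?_
  rw [hrow, ← mul_one (evalExp₂ P)]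
  exact HasExpSubst.coeff_rowAct h₂ h₃ P k

/-- The coefficient of `z ^ l` in `p(t e^{s z})`. -/
def expTaylor (s : ℤ) (l : ℕ) (p : Polynomial ℂ) : Polynomial ℂ :=
  p.sum fun j c => Polynomial.monomial j (c * ((s * j : ℤ) ^ l / (l.factorial : ℂ)))

theorem expTaylor_add (s : ℤ) (l : ℕ) (p q : Polynomial ℂ) :
    expTaylor s l (p + q) = expTaylor s l p + expTaylor s l q := by
  refine Polynomial.sum_add_index _ _ _ (fun i => ?_) fun i c c' => ?_
  · rw [zero_mul, map_zero]
  · rw [add_mul, map_add]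

theorem expTaylor_monomial (s : ℤ) (l j : ℕ) (c : ℂ) :
    expTaylor s l (Polynomial.monomial j c)
      = Polynomial.monomial j (c * ((s * j : ℤ) ^ l / (l.factorial : ℂ))) := by
  rw [expTaylor, Polynomial.sum_monomial_index]
  rw [zero_mul, map_zero]

theorem expTaylor_zero (s : ℤ) (p : Polynomial ℂ) : expTaylor s 0 p = p := by
  induction p using Polynomial.induction_on' with
  | add p q hp hq => rw [expTaylor_add, hp, hq]
  | monomial n c => rw [expTaylor_monomial]; simp

/-- The coefficients of `p(t^s e^{sz}) q(t^s) B(t, z)`. -/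
theorem coeff_rowAct_lau {B : ℤ → LaurentSeries ℂ} {k₀ : ℤ}
    (hB : ∀ m, ∀ k < k₀, (B m).coeff k = 0) (s : ℤ) (p q : Polynomial ℂ) (n k : ℤ) {L : ℕ}
    (hL : k - k₀ < L) :
    (rowAct (lau (s, s) p * lau (s, 0) q) B n).coeff k
      = ∑ l ∈ Finset.range L, (expTaylor s l p * q).sum fun j c =>
          c * (B (n - j * s)).coeff (k - l) := by
  have hadd : ∀ (l : ℕ) (p q : Polynomial ℂ),
      ((p + q).sum fun j c => c * (B (n - j * s)).coeff (k - l))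
        = (p.sum fun j c => c * (B (n - j * s)).coeff (k - l))
          + q.sum fun j c => c * (B (n - j * s)).coeff (k - l) := fun l p q =>
    Polynomial.sum_add_index _ _ _ (fun i => zero_mul _) fun i c c' => add_mul _ _ _
  induction p using Polynomial.induction_on' with
  | add p p' hp hp' =>
    rw [map_add, add_mul, map_add, Pi.add_apply, Pi.add_apply, HahnSeries.coeff_add, hp, hp',
      ← Finset.sum_add_distrib]
    refine Finset.sum_congr rfl fun l _ => ?_
    rw [expTaylor_add, add_mul, hadd]
  | monomial i a =>
    induction q using Polynomial.induction_on' with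
    | add q q' hq hq' =>
      rw [map_add, mul_add, map_add, Pi.add_apply, Pi.add_apply, HahnSeries.coeff_add, hq, hq',
        ← Finset.sum_add_distrib]
      refine Finset.sum_congr rfl fun l _ => ?_
      rw [mul_add, hadd]
    | monomial j b =>
      rw [lau_monomial, lau_monomial, AddMonoidAlgebra.single_mul_single, rowAct_single,
        HahnSeries.C_mul_eq_smul, HahnSeries.coeff_smul, coeff_expSeries_mul _ (hB _) k hL,
        smul_eq_mul, Finset.mul_sum]
      refine Finset.sum_congr rfl fun l _ => ?_
      rw [expTaylor_monomial, Polynomial.monomial_mul_monomial, Polynomial.sum_monomial_index]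
      · simp only [Prod.smul_mk, Prod.mk_add_mk, nsmul_eq_mul, mul_zero, add_zero]
        rw [show n - ((i + j : ℕ) : ℤ) * s = n - (i * s + j * s) by push_cast; ring,
          mul_comm (i : ℤ) s]
        ring
      · rw [zero_mul]

end Iterated

/-! ### The products of fields as substitutions of exponentials -/

section Fields

variable {W : Type*} [AddCommGroup W] [Module ℂ W]

theorem exists_coeff_apply_eq_zero (a : VertexOperator ℂ W) (w : W) :
    ∃ K : ℤ, ∀ n < K, coeff a n w = 0 := by
  exact exists_coeff_eq_zero ((HahnModule.of ℂ).symm (a w))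

theorem field_ext {a b : VertexOperator ℂ W}
    (h : ∀ (φ : Module.Dual ℂ W) (n : ℤ) (w : W), φ (coeff a n w) = φ (coeff b n w)) : a = b := by
  refine HVertexOperator.coeff_inj ?_
  funext n
  ext w
  rw [← sub_eq_zero]
  refine (Module.forall_dual_apply_eq_zero_iff ℂ _).1 fun φ => ?_
  rw [map_sub, h, sub_self]

theorem coeff_oneField (n : ℤ) (w : W) :
    coeff (oneField : VertexOperator ℂ W) n w = if n = 0 then w else 0 := by
  change (if n = 0 then LinearMap.id else 0 : W →ₗ[ℂ] W) w = _
  split_ifs <;> rfl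

theorem coeff_rescale (c : ℂˣ) (a : VertexOperator ℂ W) (n : ℤ) :
    coeff (rescale c a) n = (c : ℂ) ^ n • coeff a n := rfl

theorem coeff_add (a b : VertexOperator ℂ W) (n : ℤ) :
    coeff (a + b) n = coeff a n + coeff b n := rfl

theorem coeff_smul (c : ℂ) (a : VertexOperator ℂ W) (n : ℤ) :
    coeff (c • a) n = c • coeff a n := rfl

theorem coeff_modeWith {p : Polynomial ℂ} {a b : VertexOperator ℂ W} (h : CompatibleWith p a b)
    (n N : ℤ) (w : W) : coeff (modeWith p a b h n) N w = modeCoeff p a b n N w := rfl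

theorem mode_eq_zero_of_not {a b : VertexOperator ℂ W} (h : ¬ QuasiCompatible a b) (n : ℤ) :
    mode a b n = 0 := dif_neg h

/-- The modes `a(x)_n^e b(x)` vanish for large `n`. -/
theorem exists_mode_eq_zero (a b : VertexOperator ℂ W) : ∃ K : ℤ, ∀ k < K, mode a b (-k - 1) = 0 := by
  by_cases h : QuasiCompatible a b
  · obtain ⟨p, hp, hc⟩ := h
    obtain ⟨K, hK⟩ := exists_coeff_eq_zero (expInv p)
    refine ⟨K, fun k hk => ?_⟩
    rw [mode_eq hp hc]
    refine field_ext fun φ N w => ?_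
    rw [coeff_modeWith, modeCoeff, finsum_eq_zero_of_forall_eq_zero]
    · rfl
    · intro i
      rw [hK _ (by omega), zero_smul]
  · exact ⟨0, fun k _ => mode_eq_zero_of_not h _⟩

/-- The coefficient of `x ^ N` in `φ(Y(a(x), z) b(x) w)`, as a Laurent series in `z`. -/
def modeSeries (φ : Module.Dual ℂ W) (a b : VertexOperator ℂ W) (w : W) (N : ℤ) :
    LaurentSeries ℂ :=
  HahnSeries.ofSuppBddBelow (fun k => φ (coeff (mode a b (-k - 1)) N w)) (by
    obtain ⟨K, hK⟩ := exists_mode_eq_zero a b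
    refine bddBelow_support_of_forall_lt K fun k hk => ?_
    rw [hK k hk]
    exact map_zero φ)

theorem coeff_modeSeries (φ : Module.Dual ℂ W) (a b : VertexOperator ℂ W) (w : W) (N k : ℤ) :
    (modeSeries φ a b w N).coeff k = φ (coeff (mode a b (-k - 1)) N w) := rfl

theorem act_lau_one_eq_polyMul (φ : Module.Dual ℂ W) (p : Polynomial ℂ) (A : ℤ → ℤ → W)
    (N m : ℤ) : act (lau 1 p) (fun m => φ (A m (N - m))) m = φ (polyMul p A m (N - m)) := by
  rw [act_lau, polyMul, Polynomial.sum_def, Polynomial.sum_def, map_sum]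
  refine Finset.sum_congr rfl fun j _ => ?_
  rw [map_smul, nsmul_one, show N - (m - (j : ℕ)) = N - m + j by ring]

theorem injective_nsmul_one : Function.Injective fun j : ℕ => j • (1 : ℤ) := fun i j h => by
  simpa using h

omit [Module ℂ W] in
theorem IsLowerTruncated.finite_support {A : ℤ → ℤ → W} (hA : IsLowerTruncated A) (N : ℤ) :
    (Function.support fun m => A m (N - m)).Finite := by
  obtain ⟨M, hM⟩ := hA
  refine (Set.finite_Icc M (N - M)).subset fun m hm => ?_
  by_contra h
  exact hm (hM _ _ (by rw [Set.mem_Icc] at h; omega))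

theorem expSubst_eq_sum {A : ℤ → ℤ → W} {N : ℤ} {s : Finset ℤ}
    (hs : ∀ m, A m (N - m) ≠ 0 → m ∈ s) (k : ℕ) :
    expSubst A k N = ∑ m ∈ s, ((m : ℂ) ^ k / (k.factorial : ℂ)) • A m (N - m) := by
  refine finsum_eq_sum_of_support_subset _ fun m hm => hs m fun h => hm ?_
  simp only [h, smul_zero]

/-- For a quasi compatible pair, `φ(Y(a(x), z) b(x) w)` is obtained from `φ(a(x₁) b(x) w)` by the
substitution `x₁ = x e^z`. -/
theorem QuasiCompatible.hasExpSubst {a b : VertexOperator ℂ W} (h : QuasiCompatible a b)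
    (φ : Module.Dual ℂ W) (w : W) (N : ℤ) :
    HasExpSubst (fun m => φ (coeff a m (coeff b (N - m) w))) (modeSeries φ a b w N) := by
  obtain ⟨p, hp, hc⟩ := h
  have hfin := (hc w).finite_support N
  obtain ⟨P, hP⟩ := exists_coeff_eq (f := fun m => φ (polyMul p (prod₂ a b w) m (N - m)))
    (hfin.subset fun m hm h0 => hm (by simp only [h0, map_zero]))
  have hlau : lau (1 : ℤ) p ≠ 0 := lau_ne_zero injective_nsmul_one hp
  refine ⟨lau 1 p, P, hlau, ?_, ?_⟩
  · rw [hP]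
    ext m
    exact act_lau_one_eq_polyMul φ p (prod₂ a b w) N m
  · set S : PowerSeries ℂ := PowerSeries.mk fun k => φ (expSubst (polyMul p (prod₂ a b w)) k N)
      with hS
    have hPS : evalExp P = HahnSeries.ofPowerSeries ℤ ℂ S := by
      have hsum : P = ∑ m ∈ hfin.toFinset, AddMonoidAlgebra.single m (P.coeff m) := by
        ext m
        rw [AddMonoidAlgebra.coeff_sum, Finsupp.finsetSum_apply]
        simp only [AddMonoidAlgebra.coeff_single, Finsupp.single_apply, Finset.sum_ite_eq']
        split_ifs with hm
        · rfl
        · rw [hP]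
          rw [Set.Finite.mem_toFinset, Function.mem_support, not_not] at hm
          simp only [hm, map_zero]
      rw [hsum, map_sum]
      ext k
      rw [HahnSeries.coeff_sum]
      simp only [evalExp_single, HahnSeries.C_mul_eq_smul, HahnSeries.coeff_smul, coeff_expSeries]
      by_cases hk : 0 ≤ k
      · lift k to ℕ using hk
        rw [HahnSeries.ofPowerSeries_apply_coeff, hS, PowerSeries.coeff_mk,
          expSubst_eq_sum (s := hfin.toFinset) (fun m hm => (Set.Finite.mem_toFinset _).2 hm),
          map_sum]
        refine Finset.sum_congr rfl fun m _ => ?_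
        rw [if_pos (by omega), Int.toNat_natCast, hP, map_smul, smul_eq_mul, smul_eq_mul, mul_comm]
      · rw [PowerSeries.coeff_coe, if_pos (by omega)]
        refine Finset.sum_eq_zero fun m _ => ?_
        rw [if_neg hk, smul_zero]
    have hg : modeSeries φ a b w N = HahnSeries.ofPowerSeries ℤ ℂ S * expInv p := by
      obtain ⟨K, hK⟩ := exists_coeff_eq_zero (expInv p)
      ext k
      rw [coeff_modeSeries, mode_eq hp hc, coeff_modeWith, modeCoeff,
        coeff_ofPowerSeries_mul S hK k (L := (k - K).toNat + 1) (by omega),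
        finsum_eq_sum_of_support_subset (s := Finset.range ((k - K).toNat + 1)), map_sum]
      · refine Finset.sum_congr rfl fun l _ => ?_
        rw [map_smul, hS, PowerSeries.coeff_mk, smul_eq_mul, mul_comm,
          show -(-k - 1) - 1 - (l : ℤ) = k - l by ring]
      · intro l hl
        rw [Finset.mem_coe, Finset.mem_range]
        by_contra hlt
        exact hl (by simp only [hK (-(-k - 1) - 1 - (l : ℤ)) (by omega), zero_smul])
    rw [hg, hPS, mul_left_comm, expInv, ← evalExp_lau_one, mul_inv_cancel₀ (evalExp_ne_zero hlau),
      mul_one]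

/-- The products of a quasi compatible pair are determined by the substitution of exponentials. -/
theorem mode_ext {a b : VertexOperator ℂ W} (h : QuasiCompatible a b)
    {c : ℤ → VertexOperator ℂ W}
    (hc : ∀ (φ : Module.Dual ℂ W) (w : W) (N : ℤ), ∃ g : LaurentSeries ℂ,
      (∀ k, g.coeff k = φ (coeff (c k) N w)) ∧
        HasExpSubst (fun m => φ (coeff a m (coeff b (N - m) w))) g) (k : ℤ) :
    mode a b (-k - 1) = c k := by
  refine field_ext fun φ N w => ?_
  obtain ⟨g, hg, hs⟩ := hc φ w N
  rw [← coeff_modeSeries, (h.hasExpSubst φ w N).unique hs, hg]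

/-! ### Multiplication by polynomials in `x₁/x₂` -/

/-- The shift `(x₁/x₂) A(x₁, x₂)` on the families, indexed by `W`, of series in two variables. -/
def shiftOp : Module.End ℂ (W → ℤ → ℤ → W) where
  toFun L w m n := L w (m - 1) (n + 1)
  map_add' _ _ := rfl
  map_smul' _ _ := rfl

/-- The multiplication by `p(x₁/x₂)` on the families, indexed by `W`, of series in two variables;
an operator `W → W[[x₁^{±1}, x₂^{±1}]]` is such a family. -/
def polyOp : Polynomial ℂ →ₐ[ℂ] Module.End ℂ (W → ℤ → ℤ → W) := Polynomial.aeval shiftOp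

theorem shiftOp_pow_apply (j : ℕ) (L : W → ℤ → ℤ → W) (w : W) (m n : ℤ) :
    (shiftOp ^ j) L w m n = L w (m - j) (n + j) := by
  induction j generalizing m n with
  | zero => simp
  | succ j ih =>
    rw [pow_succ', Module.End.mul_apply]
    change (shiftOp ^ j) L w (m - 1) (n + 1) = _
    rw [ih]
    push_cast
    congr 1 <;> ring

theorem polyOp_apply (p : Polynomial ℂ) (L : W → ℤ → ℤ → W) (w : W) (m n : ℤ) :
    polyOp p L w m n = polyMul p (L w) m n := by
  induction p using Polynomial.induction_on' with
  | add p q hp hq => rw [map_add, polyMul_add, ← hp, ← hq]; rfl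
  | monomial j c =>
    rw [polyMul_monomial, polyOp, Polynomial.aeval_monomial, ← Algebra.smul_def,
      ← shiftOp_pow_apply j L w]
    rfl

theorem polyOp_apply' (p : Polynomial ℂ) (L : W → ℤ → ℤ → W) (w : W) :
    polyOp p L w = polyMul p (L w) :=
  funext fun _ => funext fun _ => polyOp_apply p L w _ _

theorem polyOp_mul (p q : Polynomial ℂ) (L : W → ℤ → ℤ → W) :
    polyOp (p * q) L = polyOp p (polyOp q L) := by
  rw [map_mul, Module.End.mul_apply]

/-- The families that a nonzero polynomial in `x₁/x₂` multiplies into `N`. -/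
def saturation (N : Submodule ℂ (W → ℤ → ℤ → W)) (hN : ∀ p, ∀ L ∈ N, polyOp p L ∈ N) :
    Submodule ℂ (W → ℤ → ℤ → W) where
  carrier := {L | ∃ q : Polynomial ℂ, q ≠ 0 ∧ polyOp q L ∈ N}
  zero_mem' := ⟨1, one_ne_zero, by rw [map_zero]; exact N.zero_mem⟩
  add_mem' := by
    rintro L L' ⟨q, hq, hL⟩ ⟨q', hq', hL'⟩
    refine ⟨q * q', mul_ne_zero hq hq', ?_⟩
    rw [map_add]
    refine N.add_mem ?_ ?_
    · rw [mul_comm, polyOp_mul]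
      exact hN _ _ hL
    · rw [polyOp_mul]
      exact hN _ _ hL'
  smul_mem' := by
    rintro c L ⟨q, hq, hL⟩
    exact ⟨q, hq, by rw [map_smul]; exact N.smul_mem c hL⟩

theorem le_saturation (N : Submodule ℂ (W → ℤ → ℤ → W)) (hN : ∀ p, ∀ L ∈ N, polyOp p L ∈ N) :
    N ≤ saturation N hN := fun L hL => ⟨1, one_ne_zero, hN 1 L hL⟩

theorem mem_saturation_of_polyOp {N : Submodule ℂ (W → ℤ → ℤ → W)}
    {hN : ∀ p, ∀ L ∈ N, polyOp p L ∈ N} {L : W → ℤ → ℤ → W} {q : Polynomial ℂ} (hq : q ≠ 0)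
    (h : polyOp q L ∈ saturation N hN) : L ∈ saturation N hN := by
  obtain ⟨r, hr, h⟩ := h
  exact ⟨r * q, mul_ne_zero hr hq, by rwa [polyOp_mul]⟩

theorem polyOp_mem_saturation {N : Submodule ℂ (W → ℤ → ℤ → W)}
    {hN : ∀ p, ∀ L ∈ N, polyOp p L ∈ N} {L : W → ℤ → ℤ → W} (p : Polynomial ℂ)
    (h : L ∈ saturation N hN) : polyOp p L ∈ saturation N hN := by
  obtain ⟨r, hr, h⟩ := h
  exact ⟨r, hr, by rw [← polyOp_mul, mul_comm, polyOp_mul]; exact hN _ _ h⟩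

/-- The product `a(x₁) b(x₂)`. -/
def prodSeries : VertexOperator ℂ W →ₗ[ℂ] VertexOperator ℂ W →ₗ[ℂ] (W → ℤ → ℤ → W) :=
  LinearMap.mk₂ ℂ (fun a b w => prod₂ a b w)
    (fun a a' b => rfl) (fun c a b => rfl)
    (fun a b b' => by
      funext w m n
      exact map_add (coeff a m) _ _)
    (fun c a b => by
      funext w m n
      exact map_smul (coeff a m) _ _)

theorem prodSeries_apply (a b : VertexOperator ℂ W) (w : W) (m n : ℤ) :
    prodSeries a b w m n = coeff a m (coeff b n w) := rfl

/-- The families of series in `W[[x₁^{±1}]]((x₂))`. -/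
def truncatedRight : Submodule ℂ (W → ℤ → ℤ → W) where
  carrier := {L | ∀ w, ∃ K : ℤ, ∀ m, ∀ n < K, L w m n = 0}
  zero_mem' := fun w => ⟨0, fun _ _ _ => rfl⟩
  add_mem' := by
    intro L L' hL hL' w
    obtain ⟨K, hK⟩ := hL w
    obtain ⟨K', hK'⟩ := hL' w
    refine ⟨min K K', fun m n hn => ?_⟩
    change L w m n + L' w m n = 0
    rw [hK m n (by omega), hK' m n (by omega), add_zero]
  smul_mem' := by
    intro c L hL w
    obtain ⟨K, hK⟩ := hL w
    refine ⟨K, fun m n hn => ?_⟩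
    change c • L w m n = 0
    rw [hK m n hn, smul_zero]

/-- The families of series in `W[[x₂^{±1}]]((x₁))`. -/
def truncatedLeft : Submodule ℂ (W → ℤ → ℤ → W) where
  carrier := {L | ∀ w, ∃ K : ℤ, ∀ m < K, ∀ n, L w m n = 0}
  zero_mem' := fun w => ⟨0, fun _ _ _ => rfl⟩
  add_mem' := by
    intro L L' hL hL' w
    obtain ⟨K, hK⟩ := hL w
    obtain ⟨K', hK'⟩ := hL' w
    refine ⟨min K K', fun m hm n => ?_⟩
    change L w m n + L' w m n = 0
    rw [hK m (by omega), hK' m (by omega), add_zero]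
  smul_mem' := by
    intro c L hL w
    obtain ⟨K, hK⟩ := hL w
    refine ⟨K, fun m hm n => ?_⟩
    change c • L w m n = 0
    rw [hK m hm, smul_zero]

theorem polyOp_mem {N : Submodule ℂ (W → ℤ → ℤ → W)} (hN : ∀ L ∈ N, shiftOp L ∈ N)
    (p : Polynomial ℂ) : ∀ L ∈ N, polyOp p L ∈ N := by
  induction p using Polynomial.induction_on' with
  | add p q hp hq => exact fun L hL => by rw [map_add]; exact N.add_mem (hp L hL) (hq L hL)
  | monomial j c =>
    intro L hL
    rw [polyOp, Polynomial.aeval_monomial, ← Algebra.smul_def]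
    refine N.smul_mem c ?_
    induction j with
    | zero => exact hL
    | succ j ih =>
      rw [pow_succ', Module.End.mul_apply]
      exact hN _ ih

theorem polyOp_mem_truncatedRight (p : Polynomial ℂ) :
    ∀ L ∈ truncatedRight (W := W), polyOp p L ∈ truncatedRight (W := W) :=
  polyOp_mem (fun L hL w => by
    obtain ⟨K, hK⟩ := hL w
    exact ⟨K - 1, fun m n hn => hK _ _ (by omega)⟩) p

theorem polyOp_mem_truncatedLeft (p : Polynomial ℂ) :
    ∀ L ∈ truncatedLeft (W := W), polyOp p L ∈ truncatedLeft (W := W) :=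
  polyOp_mem (fun L hL w => by
    obtain ⟨K, hK⟩ := hL w
    exact ⟨K, fun m hm n => hK _ (by omega) _⟩) p

theorem prodSeries_mem_truncatedRight (a b : VertexOperator ℂ W) :
    prodSeries a b ∈ truncatedRight (W := W) := fun w => by
  obtain ⟨K, hK⟩ := exists_coeff_apply_eq_zero b w
  exact ⟨K, fun m n hn => by rw [prodSeries_apply, hK n hn, map_zero]⟩

theorem isLowerTruncated_of_mem {L : W → ℤ → ℤ → W} (h : L ∈ truncatedLeft (W := W))
    (h' : L ∈ truncatedRight (W := W)) (w : W) : IsLowerTruncated (L w) := by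
  obtain ⟨K, hK⟩ := h w
  obtain ⟨K', hK'⟩ := h' w
  refine ⟨min K K', fun m n hmn => ?_⟩
  rcases hmn with h | h
  · exact hK _ (by omega) _
  · exact hK' _ _ (by omega)

/-- As `a(x₁) b(x₂) w` is truncated in `x₂`, quasi compatibility is a condition on the powers of `x₁`
alone. -/
theorem quasiCompatible_iff (a b : VertexOperator ℂ W) :
    QuasiCompatible a b ↔ prodSeries a b ∈ saturation truncatedLeft polyOp_mem_truncatedLeft := by
  constructor
  · rintro ⟨p, hp, h⟩
    refine ⟨p, hp, fun w => ?_⟩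
    obtain ⟨K, hK⟩ := h w
    refine ⟨K, fun m hm n => ?_⟩
    rw [polyOp_apply]
    exact hK m n (Or.inl hm)
  · rintro ⟨p, hp, h⟩
    refine ⟨p, hp, fun w => ?_⟩
    have := isLowerTruncated_of_mem h
      (polyOp_mem_truncatedRight p _ (prodSeries_mem_truncatedRight a b)) w
    rwa [polyOp_apply'] at this

theorem QuasiCompatible.add_left {a a' b : VertexOperator ℂ W} (h : QuasiCompatible a b)
    (h' : QuasiCompatible a' b) : QuasiCompatible (a + a') b := by
  rw [quasiCompatible_iff] at *
  rw [map_add]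
  exact Submodule.add_mem _ h h'

theorem QuasiCompatible.smul_left {a b : VertexOperator ℂ W} (h : QuasiCompatible a b) (c : ℂ) :
    QuasiCompatible (c • a) b := by
  rw [quasiCompatible_iff] at *
  rw [map_smul]
  exact Submodule.smul_mem _ c h

theorem QuasiCompatible.add_right {a b b' : VertexOperator ℂ W} (h : QuasiCompatible a b)
    (h' : QuasiCompatible a b') : QuasiCompatible a (b + b') := by
  rw [quasiCompatible_iff] at *
  rw [map_add]
  exact Submodule.add_mem _ h h'

theorem QuasiCompatible.smul_right {a b : VertexOperator ℂ W} (h : QuasiCompatible a b) (c : ℂ) :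
    QuasiCompatible a (c • b) := by
  rw [quasiCompatible_iff] at *
  rw [map_smul]
  exact Submodule.smul_mem _ c h

theorem mode_add_left {a a' b : VertexOperator ℂ W} (h : QuasiCompatible a b)
    (h' : QuasiCompatible a' b) (n : ℤ) : mode (a + a') b n = mode a b n + mode a' b n := by
  have := mode_ext (h.add_left h') (c := fun k => mode a b (-k - 1) + mode a' b (-k - 1))
    (fun φ w N => ⟨modeSeries φ a b w N + modeSeries φ a' b w N, fun k => ?_, ?_⟩) (-n - 1)
  · simpa using this
  · exact (map_add φ _ _).symm
  · convert (h.hasExpSubst φ w N).add (h'.hasExpSubst φ w N) using 1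
    funext m
    exact map_add φ _ _

theorem mode_smul_left {a b : VertexOperator ℂ W} (h : QuasiCompatible a b) (c : ℂ) (n : ℤ) :
    mode (c • a) b n = c • mode a b n := by
  have := mode_ext (h.smul_left c) (c := fun k => c • mode a b (-k - 1))
    (fun φ w N => ⟨HahnSeries.C c * modeSeries φ a b w N, fun k => ?_, ?_⟩) (-n - 1)
  · simpa using this
  · rw [HahnSeries.C_mul_eq_smul, HahnSeries.coeff_smul]
    exact (map_smul φ _ _).symm
  · convert (h.hasExpSubst φ w N).smul c using 1
    funext m
    exact map_smul φ _ _

theorem mode_add_right {a b b' : VertexOperator ℂ W} (h : QuasiCompatible a b)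
    (h' : QuasiCompatible a b') (n : ℤ) : mode a (b + b') n = mode a b n + mode a b' n := by
  have := mode_ext (h.add_right h') (c := fun k => mode a b (-k - 1) + mode a b' (-k - 1))
    (fun φ w N => ⟨modeSeries φ a b w N + modeSeries φ a b' w N, fun k => ?_, ?_⟩) (-n - 1)
  · simpa using this
  · exact (map_add φ _ _).symm
  · convert (h.hasExpSubst φ w N).add (h'.hasExpSubst φ w N) using 1
    funext m
    rw [coeff_add, LinearMap.add_apply, map_add, map_add]
    rfl

theorem mode_smul_right {a b : VertexOperator ℂ W} (h : QuasiCompatible a b) (c : ℂ) (n : ℤ) :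
    mode a (c • b) n = c • mode a b n := by
  have := mode_ext (h.smul_right c) (c := fun k => c • mode a b (-k - 1))
    (fun φ w N => ⟨HahnSeries.C c * modeSeries φ a b w N, fun k => ?_, ?_⟩) (-n - 1)
  · simpa using this
  · rw [HahnSeries.C_mul_eq_smul, HahnSeries.coeff_smul]
    exact (map_smul φ _ _).symm
  · convert (h.hasExpSubst φ w N).smul c using 1
    funext m
    rw [coeff_smul, LinearMap.smul_apply, map_smul, map_smul]
    rfl

theorem hasExpSubst_single (N : ℤ) (c : ℂ) :
    HasExpSubst (fun m => if m = N then c else 0) (HahnSeries.C c * expSeries (N : ℂ)) := by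
  rw [← evalExp_single]
  convert HasExpSubst.coeff (AddMonoidAlgebra.single N c) using 1
  funext m
  rw [AddMonoidAlgebra.coeff_single, Finsupp.single_apply]
  exact if_congr eq_comm rfl rfl

theorem quasiCompatible_oneField_left (b : VertexOperator ℂ W) : QuasiCompatible oneField b := by
  rw [quasiCompatible_iff]
  refine le_saturation _ _ fun w => ⟨0, fun m hm n => ?_⟩
  rw [prodSeries_apply, coeff_oneField, if_neg hm.ne]

theorem quasiCompatible_oneField_right (a : VertexOperator ℂ W) : QuasiCompatible a oneField := by
  rw [quasiCompatible_iff]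
  refine le_saturation _ _ fun w => ?_
  obtain ⟨K, hK⟩ := exists_coeff_apply_eq_zero a w
  refine ⟨K, fun m hm n => ?_⟩
  rw [prodSeries_apply, coeff_oneField]
  split_ifs
  · exact hK m hm
  · rw [map_zero]

theorem mode_oneField_left (b : VertexOperator ℂ W) (k : ℤ) :
    mode oneField b (-k - 1) = if k = 0 then b else 0 := by
  refine mode_ext (quasiCompatible_oneField_left b) (c := fun k => if k = 0 then b else 0)
    (fun φ w N => ⟨HahnSeries.C (φ (coeff b N w)) * expSeries ((0 : ℤ) : ℂ), fun k => ?_, ?_⟩) k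
  rotate_left
  · convert hasExpSubst_single 0 (φ (coeff b N w)) using 1
    funext m
    rw [coeff_oneField]
    split_ifs with hm
    · rw [hm, sub_zero]
    · rw [map_zero]
  · rw [Int.cast_zero, expSeries_zero, mul_one, HahnSeries.C_apply, HahnSeries.coeff_single]
    split_ifs
    · rfl
    · exact (map_zero φ).symm

theorem mode_oneField_right (a : VertexOperator ℂ W) (k : ℤ) (hk : k ≤ 0) :
    mode a oneField (-k - 1) = if k = 0 then a else 0 := by
  refine field_ext fun φ N w => ?_
  have h := (quasiCompatible_oneField_right a).hasExpSubst φ w N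
  have h' : HasExpSubst (fun m => φ (coeff a m (coeff oneField (N - m) w)))
      (HahnSeries.C (φ (coeff a N w)) * expSeries (N : ℂ)) := by
    convert hasExpSubst_single N (φ (coeff a N w)) using 1
    funext m
    rw [coeff_oneField]
    by_cases hm : m = N
    · subst hm
      rw [if_pos (sub_self _), if_pos rfl]
    · rw [if_neg (by omega), if_neg hm, map_zero, map_zero]
  rw [← coeff_modeSeries, h.unique h', HahnSeries.C_mul_eq_smul, HahnSeries.coeff_smul]
  split_ifs with h0
  · subst h0
    rw [coeff_expSeries, if_pos le_rfl]
    simp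
  · rw [coeff_expSeries, if_neg (by omega), smul_zero]
    exact (map_zero φ).symm

theorem rescale_inv_rescale (c : ℂˣ) (a : VertexOperator ℂ W) : rescale c⁻¹ (rescale c a) = a := by
  refine field_ext fun φ n w => ?_
  rw [coeff_rescale, coeff_rescale, smul_smul, ← mul_zpow, Units.inv_mul, one_zpow, one_smul]

theorem QuasiCompatible.rescale {a b : VertexOperator ℂ W} (h : QuasiCompatible a b) (c : ℂˣ) :
    QuasiCompatible (rescale c a) (rescale c b) := by
  rw [quasiCompatible_iff] at *
  obtain ⟨p, hp, h⟩ := h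
  refine ⟨p, hp, fun w => ?_⟩
  obtain ⟨K, hK⟩ := h w
  refine ⟨K, fun m hm n => ?_⟩
  have h0 := hK m hm n
  rw [polyOp_apply] at h0 ⊢
  have : polyMul p (prodSeries (TrigQVA.rescale c a) (TrigQVA.rescale c b) w) m n
      = (c : ℂ) ^ (m + n) • polyMul p (prodSeries a b w) m n := by
    rw [polyMul, polyMul, Polynomial.sum_def, Polynomial.sum_def, Finset.smul_sum]
    refine Finset.sum_congr rfl fun j _ => ?_
    rw [prodSeries_apply, prodSeries_apply, coeff_rescale, coeff_rescale, LinearMap.smul_apply,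
      LinearMap.smul_apply, map_smul, smul_comm (p.coeff j), smul_comm (p.coeff j), smul_smul,
      ← zpow_add₀ c.ne_zero, show m - (j : ℤ) + (n + j) = m + n by ring, smul_comm]
  rw [this, h0, smul_zero]

/-- The rescaling of the variable is compatible with the products of fields. -/
theorem mode_rescale (c : ℂˣ) (a b : VertexOperator ℂ W) (n : ℤ) :
    mode (rescale c a) (rescale c b) n = rescale c (mode a b n) := by
  by_cases h : QuasiCompatible a b
  · have := mode_ext (h.rescale c) (c := fun k => rescale c (mode a b (-k - 1)))
      (fun φ w N => ⟨HahnSeries.C ((c : ℂ) ^ N) * modeSeries φ a b w N, fun k => ?_, ?_⟩) (-n - 1)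
    · simpa using this
    · rw [HahnSeries.C_mul_eq_smul, HahnSeries.coeff_smul]
      exact (map_smul φ _ _).symm
    · convert (h.hasExpSubst φ w N).smul ((c : ℂ) ^ N) using 1
      funext m
      rw [coeff_rescale, coeff_rescale, LinearMap.smul_apply, LinearMap.smul_apply,
        map_smul (coeff a m), smul_smul, ← zpow_add₀ c.ne_zero, map_smul, add_sub_cancel]
      rfl
  · have h' : ¬ QuasiCompatible (rescale c a) (rescale c b) := fun h' => h (by
      have := h'.rescale c⁻¹
      rwa [rescale_inv_rescale, rescale_inv_rescale] at this)
    rw [mode_eq_zero_of_not h, mode_eq_zero_of_not h']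
    refine field_ext fun φ n w => ?_
    rw [coeff_rescale]
    change φ 0 = φ ((c : ℂ) ^ n • (0 : W))
    rw [smul_zero]

end Fields

/-! ### Locality with polynomial structure functions -/

section Local

variable {W : Type*} [AddCommGroup W] [Module ℂ W]

/-- The product `b(x₂) a(x₁)`. -/
def swapSeries : VertexOperator ℂ W →ₗ[ℂ] VertexOperator ℂ W →ₗ[ℂ] (W → ℤ → ℤ → W) :=
  LinearMap.mk₂ ℂ (fun b a w m n => prod₂ b a w n m)
    (fun a a' b => rfl) (fun c a b => rfl)
    (fun a b b' => by
      funext w m n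
      exact map_add (coeff a n) _ _)
    (fun c a b => by
      funext w m n
      exact map_smul (coeff a n) _ _)

theorem swapSeries_apply (b a : VertexOperator ℂ W) (w : W) (m n : ℤ) :
    swapSeries b a w m n = coeff b n (coeff a m w) := rfl

/-- The span of the products `h(x₁/x₂) b(x₂) a(x₁)`, for polynomials `h`, `a ∈ X` and `b ∈ Y`. -/
def reversed (X Y : Set (VertexOperator ℂ W)) : Submodule ℂ (W → ℤ → ℤ → W) :=
  Submodule.span ℂ {L | ∃ (h : Polynomial ℂ), ∃ a ∈ X, ∃ b ∈ Y, polyOp h (swapSeries b a) = L}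

theorem polyOp_mem_reversed (X Y : Set (VertexOperator ℂ W)) (p : Polynomial ℂ) :
    ∀ L ∈ reversed X Y, polyOp p L ∈ reversed X Y := by
  intro L hL
  have hle : reversed X Y ≤ (reversed X Y).comap (polyOp p) := by
    refine Submodule.span_le.2 ?_
    rintro _ ⟨h, a, ha, b, hb, rfl⟩
    refine Submodule.subset_span ⟨p * h, a, ha, b, hb, polyOp_mul p h _⟩
  exact hle hL

theorem reversed_mono {X X' Y Y' : Set (VertexOperator ℂ W)} (hX : X ⊆ X') (hY : Y ⊆ Y') :
    reversed X Y ≤ reversed X' Y' :=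
  Submodule.span_mono fun _ ⟨h, a, ha, b, hb, e⟩ => ⟨h, a, hX ha, b, hY hb, e⟩

theorem exists_sum_of_mem_reversed {X Y : Set (VertexOperator ℂ W)} {L : W → ℤ → ℤ → W}
    (hL : L ∈ reversed X Y) :
    ∃ (ι : Type) (_ : Fintype ι) (a b : ι → VertexOperator ℂ W) (h : ι → Polynomial ℂ),
      (∀ i, a i ∈ X) ∧ (∀ i, b i ∈ Y) ∧ L = ∑ i, polyOp (h i) (swapSeries (b i) (a i)) := by
  induction hL using Submodule.span_induction with
  | mem L hL =>
    obtain ⟨h, a, ha, b, hb, rfl⟩ := hL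
    exact ⟨Unit, inferInstance, fun _ => a, fun _ => b, fun _ => h, fun _ => ha, fun _ => hb,
      by simp⟩
  | zero =>
    exact ⟨Empty, inferInstance, Empty.elim, Empty.elim, Empty.elim, fun i => i.elim,
      fun i => i.elim, by simp⟩
  | add L L' _ _ h h' =>
    obtain ⟨ι, _, a, b, h, ha, hb, rfl⟩ := h
    obtain ⟨ι', _, a', b', h', ha', hb', rfl⟩ := h'
    refine ⟨ι ⊕ ι', inferInstance, Sum.elim a a', Sum.elim b b', Sum.elim h h', ?_, ?_, ?_⟩
    · rintro (i | i)
      exacts [ha i, ha' i]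
    · rintro (i | i)
      exacts [hb i, hb' i]
    · rw [Fintype.sum_sum_type]
      rfl
  | smul c L _ h =>
    obtain ⟨ι, _, a, b, h, ha, hb, rfl⟩ := h
    refine ⟨ι, inferInstance, a, b, fun i => c • h i, ha, hb, ?_⟩
    rw [Finset.smul_sum]
    simp only [map_smul, LinearMap.smul_apply]

/-- The families `L` with `q(x₁/x₂) L(x₁, x₂) = ∑ i, hᵢ(x₁/x₂) bᵢ(x₂) aᵢ(x₁)` for a polynomial
`q ≠ 0`, polynomials `hᵢ`, and fields `aᵢ ∈ X` and `bᵢ ∈ Y`. -/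
def localSeries (X Y : Set (VertexOperator ℂ W)) : Submodule ℂ (W → ℤ → ℤ → W) :=
  saturation (reversed X Y) (polyOp_mem_reversed X Y)

theorem localSeries_mono {X X' Y Y' : Set (VertexOperator ℂ W)} (hX : X ⊆ X') (hY : Y ⊆ Y') :
    localSeries X Y ≤ localSeries X' Y' :=
  fun _ ⟨q, hq, h⟩ => ⟨q, hq, reversed_mono hX hY h⟩

/-- The products `a(x₁) b(x₂)` of `a ∈ X` and `b ∈ Y` are, up to a polynomial in `x₁/x₂`,
combinations of the products `bᵢ(x₂) aᵢ(x₁)` with `aᵢ ∈ X` and `bᵢ ∈ Y`. -/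
def SLocal (X Y : Set (VertexOperator ℂ W)) : Prop :=
  ∀ a ∈ X, ∀ b ∈ Y, prodSeries a b ∈ localSeries X Y

theorem SLocal.span {X Y : Set (VertexOperator ℂ W)} (h : SLocal X Y) :
    SLocal (Submodule.span ℂ X : Set (VertexOperator ℂ W))
      (Submodule.span ℂ Y : Set (VertexOperator ℂ W)) := by
  intro a ha b hb
  have hle : localSeries X Y ≤ localSeries (Submodule.span ℂ X : Set (VertexOperator ℂ W))
      (Submodule.span ℂ Y : Set (VertexOperator ℂ W)) :=
    localSeries_mono Submodule.subset_span Submodule.subset_span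
  refine hle ?_
  induction ha, hb using Submodule.span_induction₂ with
  | mem_mem a b ha hb => exact h a ha b hb
  | zero_left b hb => rw [map_zero]; exact Submodule.zero_mem _
  | zero_right a ha => rw [map_zero]; exact Submodule.zero_mem _
  | add_left a a' b _ _ _ h h' => rw [map_add]; exact Submodule.add_mem _ h h'
  | add_right a b b' _ _ _ h h' => rw [map_add]; exact Submodule.add_mem _ h h'
  | smul_left r a b _ _ h => rw [map_smul]; exact Submodule.smul_mem _ _ h
  | smul_right r a b _ _ h => rw [map_smul]; exact Submodule.smul_mem _ _ h

/-- The products `a(x₁) b(x₂)` are truncated in `x₂` and the products `bᵢ(x₂) aᵢ(x₁)` in `x₁`; where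
they agree, they are truncated in both. -/
theorem SLocal.isQuasiTrigCompatible {X : Set (VertexOperator ℂ W)} (h : SLocal X X) :
    IsQuasiTrigCompatible X := by
  intro a ha b hb
  rw [quasiCompatible_iff]
  obtain ⟨q, hq, hm⟩ := h a ha b hb
  refine ⟨q, hq, ?_⟩
  have hle : reversed X X ≤ truncatedLeft := by
    refine Submodule.span_le.2 ?_
    rintro _ ⟨h, a, ha, b, hb, rfl⟩
    refine polyOp_mem_truncatedLeft h _ fun w => ?_
    obtain ⟨K, hK⟩ := exists_coeff_apply_eq_zero a w
    exact ⟨K, fun m hm n => by rw [swapSeries_apply, hK m hm, map_zero]⟩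
  exact hle hm

theorem prodSeries_oneField_left (b : VertexOperator ℂ W) :
    prodSeries oneField b = swapSeries b oneField := by
  funext w m n
  rw [prodSeries_apply, swapSeries_apply, coeff_oneField, coeff_oneField]
  split_ifs
  · rfl
  · rw [map_zero]

theorem prodSeries_oneField_right (a : VertexOperator ℂ W) :
    prodSeries a oneField = swapSeries oneField a := by
  funext w m n
  rw [prodSeries_apply, swapSeries_apply, coeff_oneField, coeff_oneField]
  split_ifs
  · rfl
  · rw [map_zero]

theorem swapSeries_mem_localSeries {X Y : Set (VertexOperator ℂ W)} {a b : VertexOperator ℂ W}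
    (ha : a ∈ X) (hb : b ∈ Y) : swapSeries b a ∈ localSeries X Y :=
  le_saturation _ _ (Submodule.subset_span ⟨1, a, ha, b, hb, by rw [map_one]; rfl⟩)

theorem SLocal.insert_oneField {X : Set (VertexOperator ℂ W)} (h : SLocal X X) :
    SLocal (insert oneField X) (insert oneField X) := by
  intro a ha b hb
  rcases ha with rfl | ha
  · rw [prodSeries_oneField_left]
    exact swapSeries_mem_localSeries (Set.mem_insert _ _) hb
  rcases hb with rfl | hb
  · rw [prodSeries_oneField_right]
    exact swapSeries_mem_localSeries (Set.mem_insert_of_mem _ ha) (Set.mem_insert _ _)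
  · exact localSeries_mono (Set.subset_insert _ _) (Set.subset_insert _ _) (h a ha b hb)

/-! ### Clearing the denominators of the structure functions -/

/-- The product `g(x₁/x₂) A(x₁, x₂)`, for a Laurent series `g`. -/
def seriesMul (g : LaurentSeries ℂ) (A : ℤ → ℤ → W) (m n : ℤ) : W :=
  ∑ᶠ k : ℤ, g.coeff k • A (m - k) (n + k)

theorem finite_support_seriesMul (g : LaurentSeries ℂ) {A : ℤ → ℤ → W} {K : ℤ}
    (hA : ∀ m < K, ∀ n, A m n = 0) (m n : ℤ) :
    (Function.support fun k : ℤ => g.coeff k • A (m - k) (n + k)).Finite := by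
  obtain ⟨a, ha⟩ := exists_coeff_eq_zero g
  refine (Set.finite_Icc a (m - K)).subset fun k hk => ?_
  rw [Set.mem_Icc]
  constructor
  · by_contra h
    exact hk (by simp only [ha k (by omega), zero_smul])
  · by_contra h
    exact hk (by simp only [hA (m - k) (by omega), smul_zero])

theorem seriesMul_add (g g' : LaurentSeries ℂ) {A : ℤ → ℤ → W} {K : ℤ}
    (hA : ∀ m < K, ∀ n, A m n = 0) (m n : ℤ) :
    seriesMul (g + g') A m n = seriesMul g A m n + seriesMul g' A m n := by
  rw [seriesMul, seriesMul, seriesMul, ← finsum_add_distrib (finite_support_seriesMul g hA m n)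
    (finite_support_seriesMul g' hA m n)]
  refine finsum_congr fun k => ?_
  rw [HahnSeries.coeff_add, add_smul]

theorem seriesMul_monomial_mul (g : LaurentSeries ℂ) (A : ℤ → ℤ → W) (j : ℕ) (c : ℂ) (m n : ℤ) :
    seriesMul (HahnSeries.single (j : ℤ) c * g) A m n = c • seriesMul g A (m - j) (n + j) := by
  rw [seriesMul, seriesMul, smul_finsum, ← finsum_comp_equiv (Equiv.addRight (j : ℤ))]
  refine finsum_congr fun k => ?_
  change (HahnSeries.single (j : ℤ) c * g).coeff (k + j) • A (m - (k + j)) (n + (k + j)) = _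
  rw [HahnSeries.coeff_single_mul_add, mul_smul, show m - (k + (j : ℤ)) = m - j - k by ring,
    show n + (k + (j : ℤ)) = n + j + k by ring]

/-- The Laurent series given by a polynomial. -/
abbrev polySeries : Polynomial ℂ →+* LaurentSeries ℂ :=
  Polynomial.eval₂RingHom HahnSeries.C (HahnSeries.single 1 1)

theorem polySeries_monomial (j : ℕ) (c : ℂ) :
    polySeries (Polynomial.monomial j c) = HahnSeries.single (j : ℤ) c := by
  rw [Polynomial.coe_eval₂RingHom, Polynomial.eval₂_monomial, HahnSeries.single_pow, one_pow,
    HahnSeries.C_apply, HahnSeries.single_mul_single, zero_add, mul_one, nsmul_one]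

theorem coeff_polySeries (p : Polynomial ℂ) (j : ℕ) : (polySeries p).coeff j = p.coeff j := by
  induction p using Polynomial.induction_on' with
  | add p q hp hq => rw [map_add, HahnSeries.coeff_add, hp, hq, Polynomial.coeff_add]
  | monomial i c =>
    rw [polySeries_monomial, HahnSeries.coeff_single, Polynomial.coeff_monomial]
    by_cases h : i = j
    · simp [h]
    · rw [if_neg h, if_neg (by omega)]

theorem polySeries_injective : Function.Injective polySeries := fun p q h =>
  Polynomial.ext fun j => by rw [← coeff_polySeries, h, coeff_polySeries]

theorem polyMul_seriesMul (p : Polynomial ℂ) (g : LaurentSeries ℂ) {A : ℤ → ℤ → W} {K : ℤ}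
    (hA : ∀ m < K, ∀ n, A m n = 0) (m n : ℤ) :
    polyMul p (seriesMul g A) m n = seriesMul (polySeries p * g) A m n := by
  induction p using Polynomial.induction_on' with
  | add p q hp hq => rw [polyMul_add, hp, hq, map_add, add_mul, seriesMul_add _ _ hA]
  | monomial j c =>
    rw [polyMul_monomial, polySeries_monomial, seriesMul_monomial_mul]

theorem seriesMul_one (A : ℤ → ℤ → W) (m n : ℤ) : seriesMul 1 A m n = A m n := by
  rw [seriesMul, finsum_eq_single _ 0]
  · simp
  · intro k hk
    rw [HahnSeries.coeff_one, if_neg hk, zero_smul]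

theorem eval₂_reflect_mul_pow_of_mul_eq_one {R S : Type*} [CommSemiring R] [CommSemiring S]
    (i : R →+* S) {x y : S} (h : y * x = 1) {N : ℕ} {p : Polynomial R} (hp : p.natDegree ≤ N) :
    (p.reflect N).eval₂ i y * x ^ N = p.eval₂ i x := by
  let _ : Invertible x := ⟨y, h, by rw [mul_comm, h]⟩
  exact Polynomial.eval₂_reflect_mul_pow i x N p hp

/-- A rational function of `t` is a quotient of polynomials in `t⁻¹`, the reversed denominator and
numerator. -/
theorem exists_polySeries_mul_expandAtInfty (f : RatFunc ℂ) :
    ∃ d h : Polynomial ℂ, d ≠ 0 ∧ polySeries d * expandAtInfty f = polySeries h := by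
  set D := max f.num.natDegree f.denom.natDegree with hD
  have hrefl : ∀ p : Polynomial ℂ, p.natDegree ≤ D →
      polySeries (p.reflect D) * HahnSeries.single (-1 : ℤ) (1 : ℂ) ^ D
        = p.eval₂ HahnSeries.C (HahnSeries.single (-1 : ℤ) (1 : ℂ)) := fun p hp =>
    eval₂_reflect_mul_pow_of_mul_eq_one _ (by
      rw [HahnSeries.single_mul_single, mul_one]
      rfl) hp
  have hd : f.denom.reflect D ≠ 0 := by
    rw [Ne, Polynomial.reflect_eq_zero_iff]
    exact f.denom_ne_zero
  have hu : HahnSeries.single (-1 : ℤ) (1 : ℂ) ^ D ≠ 0 :=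
    pow_ne_zero _ (HahnSeries.single_ne_zero one_ne_zero)
  have hd' : polySeries (f.denom.reflect D) ≠ 0 := by
    rwa [Ne, map_eq_zero_iff _ polySeries_injective]
  refine ⟨f.denom.reflect D, f.num.reflect D, hd, ?_⟩
  rw [expandAtInfty, RatFunc.eval, ← hrefl _ (le_max_left _ _), ← hrefl _ (le_max_right _ _),
    mul_div_mul_right _ _ hu, mul_div_cancel₀ _ hd']

/-- The denominators of the rational structure functions can be cleared. -/
theorem IsQuasiTrigLocal.sLocal {U : Set (VertexOperator ℂ W)} (hU : IsQuasiTrigLocal U) :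
    SLocal U U := by
  intro a ha b hb
  obtain ⟨r, a', b', f, hab, p, hp, h⟩ := hU a ha b hb
  choose d hnum hd hf using fun i => exists_polySeries_mul_expandAtInfty (f i)
  have hterm : ∀ i, (fun w => ratMul (f i) (fun m n => prod₂ (b' i) (a' i) w n m))
      ∈ localSeries U U := by
    intro i
    refine ⟨d i, hd i, ?_⟩
    have e : polyOp (d i) (fun w => ratMul (f i) (fun m n => prod₂ (b' i) (a' i) w n m))
        = polyOp (hnum i) (swapSeries (b' i) (a' i)) := by
      funext w m n
      obtain ⟨K, hK⟩ := exists_coeff_apply_eq_zero (a' i) w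
      have hA : ∀ m < K, ∀ n, swapSeries (b' i) (a' i) w m n = 0 := fun m hm n => by
        rw [swapSeries_apply, hK m hm, map_zero]
      rw [polyOp_apply, polyOp_apply]
      refine (polyMul_seriesMul (d i) (expandAtInfty (f i)) hA m n).trans ?_
      rw [hf, ← mul_one (polySeries _), ← polyMul_seriesMul _ _ hA]
      congr 1
      funext m n
      exact seriesMul_one _ _ _
    rw [e]
    exact Submodule.subset_span ⟨_, _, (hab i).1, _, (hab i).2, rfl⟩
  refine mem_saturation_of_polyOp hp ?_
  have e : polyOp p (prodSeries a b) = polyOp p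
      (∑ i, fun w => ratMul (f i) (fun m n => prod₂ (b' i) (a' i) w n m)) := by
    funext w m n
    rw [polyOp_apply, polyOp_apply, Finset.sum_apply]
    exact h w m n
  rw [e]
  exact polyOp_mem_saturation p (Submodule.sum_mem _ fun i _ => hterm i)

end Local

/-! ### Locality of the products of fields -/

section Dong

variable {W : Type*} [AddCommGroup W] [Module ℂ W]

/-- The products `a(x)_n^e b(x)` of the fields in `X`. -/
def modes (X : Set (VertexOperator ℂ W)) : Set (VertexOperator ℂ W) :=
  {c | ∃ a ∈ X, ∃ b ∈ X, ∃ n : ℤ, mode a b n = c}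

/-- If a combination of `L k, L (k - 1), L (k - 2), …`, with a nonzero coefficient at `L k`, is in
a saturated space for each `k`, and `L k = 0` for `k` sufficiently negative, then all `L k` are in
the space. -/
theorem mem_saturation_of_sum {N : Submodule ℂ (W → ℤ → ℤ → W)}
    {hN : ∀ p, ∀ L ∈ N, polyOp p L ∈ N} {L : ℤ → W → ℤ → ℤ → W} {K : ℤ} (hK : ∀ k < K, L k = 0)
    {r : ℕ → Polynomial ℂ} (hr : r 0 ≠ 0)
    (h : ∀ k, ∃ n : ℕ, ∑ l ∈ Finset.range (n + 1), polyOp (r l) (L (k - l)) ∈ saturation N hN)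
    (k : ℤ) : L k ∈ saturation N hN := by
  have key : ∀ (i : ℕ) (k : ℤ), k < K + i → L k ∈ saturation N hN := by
    intro i
    induction i with
    | zero => intro k hk; rw [hK k (by omega)]; exact Submodule.zero_mem _
    | succ i ih =>
      intro k hk
      obtain ⟨n, hn⟩ := h k
      rw [Finset.sum_range_succ'] at hn
      have hs : ∑ l ∈ Finset.range n, polyOp (r (l + 1)) (L (k - ((l + 1 : ℕ) : ℤ)))
          ∈ saturation N hN :=
        Submodule.sum_mem _ fun l _ => polyOp_mem_saturation _ (ih _ (by push_cast at hk ⊢; omega))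
      have h0 := (Submodule.add_mem_iff_right _ hs).1 hn
      rw [Nat.cast_zero, sub_zero] at h0
      exact mem_saturation_of_polyOp hr h0
  exact key (k - K + 1).toNat k (by omega)

theorem coeff_zero_apply (n : ℤ) (w : W) : coeff (0 : VertexOperator ℂ W) n w = 0 := rfl

/-- A Laurent polynomial `p(t^g)` acts as a multiplication by `p(x₁/x₂)` on the values of `f` along the
direction `g`. -/
theorem act_lau_eq_polyMul {Λ M : Type*} [AddCommGroup Λ] [AddCommGroup M] [Module ℂ M]
    {f : Λ → M} {g x : Λ} {A : ℤ → ℤ → W} {φ : W →ₗ[ℂ] M} {m n : ℤ} (h : ∀ j : ℕ, f (x - j • g) = φ (A (m - j) (n + j)))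
    (p : Polynomial ℂ) : act (lau g p) f x = φ (polyMul p A m n) := by
  rw [act_lau, polyMul, Polynomial.sum_def, Polynomial.sum_def, map_sum]
  refine Finset.sum_congr rfl fun j _ => ?_
  rw [map_smul, h]

theorem act_sum {Λ ι M : Type*} [AddCommGroup Λ] [AddCommGroup M] [Module ℂ M]
    (d : AddMonoidAlgebra ℂ Λ) (s : Finset ι) (f : ι → Λ → M) : act d (∑ i ∈ s, f i) = ∑ i ∈ s, act d (f i) := map_sum _ _ _

/-- The coefficients of `z` in an identity between series in three variables, after the
substitution of exponentials in the rows. -/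
theorem sum_expTaylor_eq {ι : Type*} (t : Finset ι) {A : ℤ × ℤ → ℂ} {A' : ι → ℤ × ℤ → ℂ}
    {B : ℤ → LaurentSeries ℂ} {B' : ι → ℤ → LaurentSeries ℂ} {s : ℤ} {p q : Polynomial ℂ}
    {p' q' : ι → Polynomial ℂ}
    (hA : act (lau (s, s) p * lau (s, 0) q) A
      = ∑ i ∈ t, act (lau (s, s) (p' i) * lau (s, 0) (q' i)) (A' i))
    (hB : ∀ m, HasExpSubst (fun n => A (m, n)) (B m))
    (hB' : ∀ i m, HasExpSubst (fun n => A' i (m, n)) (B' i m)) {k₀ : ℤ}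
    (hk : ∀ m, ∀ k < k₀, (B m).coeff k = 0) (hk' : ∀ i ∈ t, ∀ m, ∀ k < k₀, (B' i m).coeff k = 0)
    (n k : ℤ) {L : ℕ} (hL : k - k₀ < L) :
    ∑ l ∈ Finset.range L,
      ((expTaylor s l p * q).sum fun j c => c * (B (n - j * s)).coeff (k - l))
    = ∑ i ∈ t, ∑ l ∈ Finset.range L,
      ((expTaylor s l (p' i) * q' i).sum fun j c => c * (B' i (n - j * s)).coeff (k - l)) := by
  have h : rowAct (lau (s, s) p * lau (s, 0) q) B n
      = ∑ i ∈ t, rowAct (lau (s, s) (p' i) * lau (s, 0) (q' i)) (B' i) n := by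
    refine (HasExpSubst.rowAct hB _ n).unique ?_
    rw [hA]
    convert HasExpSubst.sum t fun i _ => HasExpSubst.rowAct (hB' i)
      (lau (s, s) (p' i) * lau (s, 0) (q' i)) n using 1
    funext m
    rw [Finset.sum_apply, Finset.sum_apply]
  have h2 := congrArg (fun f : LaurentSeries ℂ => f.coeff k) h
  simp only [HahnSeries.coeff_sum] at h2
  rw [coeff_rowAct_lau hk s p q n k hL] at h2
  rw [h2]
  exact Finset.sum_congr rfl fun i hi => coeff_rowAct_lau (hk' i hi) s _ _ n k hL

theorem exists_common_mode_eq_zero {ι : Type*} [Finite ι] (a b : ι → VertexOperator ℂ W) :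
    ∃ K : ℤ, ∀ i, ∀ k < K, mode (a i) (b i) (-k - 1) = 0 := by
  choose K hK using fun i => exists_mode_eq_zero (a i) (b i)
  obtain ⟨c, hc⟩ := (Set.finite_range K).bddBelow
  exact ⟨c, fun i k hk => hK i k (hk.trans_le (hc ⟨i, rfl⟩))⟩

theorem polyOp_sum_apply {ι : Type*} (s : Finset ι) (h : ι → Polynomial ℂ)
    (L : ι → W → ℤ → ℤ → W) (w : W) (m n : ℤ) :
    (∑ i ∈ s, polyOp (h i) (L i)) w m n = ∑ i ∈ s, polyMul (h i) (L i w) m n := by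
  rw [Finset.sum_apply, Finset.sum_apply, Finset.sum_apply]
  exact Finset.sum_congr rfl fun i _ => polyOp_apply _ _ _ _ _

/-- Finitely many local series have a common denominator. -/
theorem SLocal.exists_common {X Y : Set (VertexOperator ℂ W)} {κ : Type} [Fintype κ]
    {a b : κ → VertexOperator ℂ W} (h : ∀ j, prodSeries (a j) (b j) ∈ localSeries X Y) :
    ∃ q : Polynomial ℂ, q ≠ 0 ∧ ∀ j, polyOp q (prodSeries (a j) (b j)) ∈ reversed X Y := by
  classical
  choose q hq hm using h
  refine ⟨∏ j, q j, Finset.prod_ne_zero_iff.2 fun j _ => hq j, fun j => ?_⟩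
  rw [← Finset.prod_erase_mul _ _ (Finset.mem_univ j), polyOp_mul]
  exact polyOp_mem_reversed _ _ _ _ (hm j)

/-- Two fields that are local with a third one have products that are local with it. -/
theorem mode_prodSeries_mem {X Y : Set (VertexOperator ℂ W)} (hXY : SLocal X Y)
    (hX : IsQuasiTrigCompatible X) {a b c : VertexOperator ℂ W} (ha : a ∈ X) (hb : b ∈ X)
    (hc : c ∈ Y) (n : ℤ) : prodSeries (mode a b n) c ∈ localSeries (X ∪ modes X) Y := by
  obtain ⟨q, hq, hbc⟩ := hXY b hb c hc
  obtain ⟨κ, _, b', c', h, hb', hc', hbc⟩ := exists_sum_of_mem_reversed hbc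
  obtain ⟨p, hp, hac⟩ := SLocal.exists_common (a := fun _ => a) (b := c')
    fun j => hXY a ha (c' j) (hc' j)
  choose ι fι a'' c'' h'' ha'' hc'' hac using fun j => exists_sum_of_mem_reversed (hac j)
  let I := Σ j, ι j
  obtain ⟨K, hK⟩ := exists_common_mode_eq_zero (ι := Option I)
    (fun i => i.elim a fun i => a'' i.1 i.2) (fun i => i.elim b fun i => b' i.1)
  have hK₁ : ∀ k < K, mode a b (-k - 1) = 0 := hK none
  have hK₂ : ∀ i : I, ∀ k < K, mode (a'' i.1 i.2) (b' i.1) (-k - 1) = 0 := fun i => hK (some i)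
  -- The equality of `q(x₂/x₃) p(x₁/x₃) a(x₁) b(x₂) c(x₃)` and
  -- `∑ h(x₂/x₃) h''(x₁/x₃) c''(x₃) a''(x₁) b'(x₂)`, indexed by the degree in `x₁, x₂` and by the
  -- exponent of `x₁`, so that the rows are the series in which `x₁ = x₂ e^z` is substituted.
  have hthree : ∀ (φ : Module.Dual ℂ W) (w : W) (N : ℤ),
      act (lau ((1, 1) : ℤ × ℤ) p * lau (1, 0) q)
        (fun x => φ (coeff a x.2 (coeff b (x.1 - x.2) (coeff c (N - x.1) w))))
      = ∑ i : I, act (lau ((1, 1) : ℤ × ℤ) (h'' i.1 i.2) * lau (1, 0) (h i.1))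
        (fun x => φ (coeff (c'' i.1 i.2) (N - x.1) (coeff (a'' i.1 i.2) x.2
          (coeff (b' i.1) (x.1 - x.2) w)))) := by
    intro φ w N
    rw [Fintype.sum_sigma, act_mul]
    have e₁ : act (lau ((1, 0) : ℤ × ℤ) q)
        (fun x => φ (coeff a x.2 (coeff b (x.1 - x.2) (coeff c (N - x.1) w))))
        = ∑ j, act (lau (1, 0) (h j)) (fun x => φ (coeff a x.2
          (coeff (c' j) (N - x.1) (coeff (b' j) (x.1 - x.2) w)))) := by
      ext ⟨n, m⟩
      rw [Finset.sum_apply, act_lau_eq_polyMul (φ := φ ∘ₗ coeff a m) (A := prodSeries b c w)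
        (m := n - m) (n := N - n), ← polyOp_apply, hbc, polyOp_sum_apply, map_sum]
      · refine Finset.sum_congr rfl fun j _ => ?_
        rw [act_lau_eq_polyMul (φ := φ ∘ₗ coeff a m) (A := swapSeries (c' j) (b' j) w)
          (m := n - m) (n := N - n)]
        intro i
        simp [swapSeries_apply, sub_right_comm, sub_add]
      · intro i
        simp [prodSeries_apply, sub_right_comm, sub_add]
    rw [e₁, act_sum]
    refine Finset.sum_congr rfl fun j _ => ?_
    rw [← act_mul, mul_comm, act_mul]
    have e₂ : act (lau ((1, 1) : ℤ × ℤ) p) (fun x => φ (coeff a x.2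
          (coeff (c' j) (N - x.1) (coeff (b' j) (x.1 - x.2) w))))
        = ∑ i, act (lau (1, 1) (h'' j i)) (fun x => φ (coeff (c'' j i) (N - x.1)
          (coeff (a'' j i) x.2 (coeff (b' j) (x.1 - x.2) w)))) := by
      ext ⟨n, m⟩
      rw [Finset.sum_apply, act_lau_eq_polyMul (φ := φ)
        (A := prodSeries a (c' j) (coeff (b' j) (n - m) w))
        (m := m) (n := N - n), ← polyOp_apply, hac, polyOp_sum_apply, map_sum]
      · refine Finset.sum_congr rfl fun i _ => ?_
        rw [act_lau_eq_polyMul (φ := φ)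
          (A := swapSeries (c'' j i) (a'' j i) (coeff (b' j) (n - m) w)) (m := m) (n := N - n)]
        intro i
        simp [swapSeries_apply, sub_add]
      · intro i
        simp [prodSeries_apply, sub_add]
    rw [e₂, act_sum]
    refine Finset.sum_congr rfl fun i _ => ?_
    rw [← act_mul, mul_comm]
  have hmain : ∀ (k : ℤ) (L : ℕ), k - K < L →
      ∑ l ∈ Finset.range L, polyOp (expTaylor 1 l p * q) (prodSeries (mode a b (-(k - l) - 1)) c)
      = ∑ i : I, ∑ l ∈ Finset.range L, polyOp (expTaylor 1 l (h'' i.1 i.2) * h i.1)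
          (swapSeries (c'' i.1 i.2) (mode (a'' i.1 i.2) (b' i.1) (-(k - l) - 1))) := by
    intro k L hL
    funext w m n
    rw [← sub_eq_zero]
    refine (Module.forall_dual_apply_eq_zero_iff ℂ _).1 fun φ => ?_
    rw [map_sub, sub_eq_zero, polyOp_sum_apply, Finset.sum_apply, Finset.sum_apply, Finset.sum_apply,
      map_sum, map_sum]
    simp only [polyOp_sum_apply, map_sum]
    have := sum_expTaylor_eq Finset.univ (hthree φ w (m + n))
      (B := fun n' => modeSeries φ a b (coeff c (m + n - n') w) n')
      (B' := fun i n' => modeSeries (φ ∘ₗ coeff (c'' i.1 i.2) (m + n - n')) (a'' i.1 i.2) (b' i.1) w n')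
      (fun n' => (hX a ha b hb).hasExpSubst φ (coeff c (m + n - n') w) n')
      (fun i n' => (hX _ (ha'' _ _) _ (hb' _)).hasExpSubst
        (φ ∘ₗ coeff (c'' i.1 i.2) (m + n - n')) w n') (k₀ := K)
      (fun n' k hk => by rw [coeff_modeSeries, hK₁ k hk, coeff_zero_apply, map_zero])
      (fun i _ n' k hk => by rw [coeff_modeSeries, hK₂ i k hk, coeff_zero_apply, map_zero]) m k hL
    convert this using 2 with l hl i hi
    · rw [polyMul, Polynomial.sum_def, Polynomial.sum_def, map_sum]
      refine Finset.sum_congr rfl fun j _ => ?_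
      rw [map_smul, coeff_modeSeries, prodSeries_apply, mul_one, smul_eq_mul,
        show m + n - (m - (j : ℤ)) = n + j by ring]
    · refine Finset.sum_congr rfl fun l _ => ?_
      rw [polyMul, Polynomial.sum_def, Polynomial.sum_def, map_sum]
      refine Finset.sum_congr rfl fun j _ => ?_
      rw [map_smul, coeff_modeSeries, swapSeries_apply, mul_one, smul_eq_mul,
        show m + n - (m - (j : ℤ)) = n + j by ring]
      rfl
  have := mem_saturation_of_sum (N := reversed (X ∪ modes X) Y)
    (hN := polyOp_mem_reversed _ _) (L := fun k => prodSeries (mode a b (-k - 1)) c) (K := K)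
    (fun k hk => by rw [hK₁ k hk, map_zero]; rfl) (r := fun l => expTaylor 1 l p * q)
    (by rw [expTaylor_zero]; exact mul_ne_zero hp hq)
    (fun k => ⟨(k - K).toNat, by
      rw [hmain k _ (by push_cast; omega)]
      refine le_saturation _ _ (Submodule.sum_mem _ fun i _ => Submodule.sum_mem _ fun l _ =>
        Submodule.subset_span ⟨_, _, Or.inr ⟨_, ha'' _ _, _, hb' _, _, rfl⟩, _, hc'' _ _, rfl⟩)⟩)
    (-n - 1)
  rw [show n = -(-n - 1) - 1 by ring]
  exact this

/-- A field that is local with two others is local with their products. -/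
theorem prodSeries_mode_mem {X Y : Set (VertexOperator ℂ W)} (hXY : SLocal X Y)
    (hY : IsQuasiTrigCompatible Y) {a b c : VertexOperator ℂ W} (ha : a ∈ X) (hb : b ∈ Y)
    (hc : c ∈ Y) (n : ℤ) : prodSeries a (mode b c n) ∈ localSeries X (Y ∪ modes Y) := by
  obtain ⟨q, hq, hab⟩ := hXY a ha b hb
  obtain ⟨κ, _, a', b', h, ha', hb', hab⟩ := exists_sum_of_mem_reversed hab
  obtain ⟨p, hp, hac⟩ := SLocal.exists_common (a := a') (b := fun _ => c)
    fun j => hXY (a' j) (ha' j) c hc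
  choose ι fι a'' c'' h'' ha'' hc'' hac using fun j => exists_sum_of_mem_reversed (hac j)
  let I := Σ j, ι j
  obtain ⟨K, hK⟩ := exists_common_mode_eq_zero (ι := Option I)
    (fun i => i.elim b fun i => b' i.1) (fun i => i.elim c fun i => c'' i.1 i.2)
  have hK₁ : ∀ k < K, mode b c (-k - 1) = 0 := hK none
  have hK₂ : ∀ i : I, ∀ k < K, mode (b' i.1) (c'' i.1 i.2) (-k - 1) = 0 := fun i => hK (some i)
  -- The equality of `q(x₁/x₂) p(x₁/x₃) a(x₁) b(x₂) c(x₃)` and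
  -- `∑ h(x₁/x₂) h''(x₁/x₃) b'(x₂) c''(x₃) a''(x₁)`, indexed by the degree in `x₂, x₃` and by the
  -- exponent of `x₂`, so that the rows are the series in which `x₂ = x₃ e^z` is substituted.
  have hthree : ∀ (φ : Module.Dual ℂ W) (w : W) (N : ℤ),
      act (lau ((-1, -1) : ℤ × ℤ) q * lau (-1, 0) p)
        (fun x => φ (coeff a (N - x.1) (coeff b x.2 (coeff c (x.1 - x.2) w))))
      = ∑ i : I, act (lau ((-1, -1) : ℤ × ℤ) (h i.1) * lau (-1, 0) (h'' i.1 i.2))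
        (fun x => φ (coeff (b' i.1) x.2 (coeff (c'' i.1 i.2) (x.1 - x.2)
          (coeff (a'' i.1 i.2) (N - x.1) w)))) := by
    intro φ w N
    rw [Fintype.sum_sigma, mul_comm, act_mul]
    have e₁ : act (lau ((-1, -1) : ℤ × ℤ) q)
        (fun x => φ (coeff a (N - x.1) (coeff b x.2 (coeff c (x.1 - x.2) w))))
        = ∑ j, act (lau (-1, -1) (h j)) (fun x => φ (coeff (b' j) x.2
          (coeff (a' j) (N - x.1) (coeff c (x.1 - x.2) w)))) := by
      ext ⟨e, u⟩
      rw [Finset.sum_apply, act_lau_eq_polyMul (φ := φ) (A := prodSeries a b (coeff c (e - u) w))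
        (m := N - e) (n := u), ← polyOp_apply, hab, polyOp_sum_apply, map_sum]
      · refine Finset.sum_congr rfl fun j _ => ?_
        rw [act_lau_eq_polyMul (φ := φ) (A := swapSeries (b' j) (a' j) (coeff c (e - u) w))
          (m := N - e) (n := u)]
        intro i
        simp [swapSeries_apply, sub_sub]
      · intro i
        simp [prodSeries_apply, sub_sub]
    rw [e₁, act_sum]
    refine Finset.sum_congr rfl fun j _ => ?_
    rw [← act_mul, mul_comm, act_mul]
    have e₂ : act (lau ((-1, 0) : ℤ × ℤ) p) (fun x => φ (coeff (b' j) x.2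
          (coeff (a' j) (N - x.1) (coeff c (x.1 - x.2) w))))
        = ∑ i, act (lau (-1, 0) (h'' j i)) (fun x => φ (coeff (b' j) x.2
          (coeff (c'' j i) (x.1 - x.2) (coeff (a'' j i) (N - x.1) w)))) := by
      ext ⟨e, u⟩
      rw [Finset.sum_apply, act_lau_eq_polyMul (φ := φ ∘ₗ coeff (b' j) u)
        (A := prodSeries (a' j) c w)
        (m := N - e) (n := e - u), ← polyOp_apply, hac, polyOp_sum_apply, map_sum]
      · refine Finset.sum_congr rfl fun i _ => ?_
        rw [act_lau_eq_polyMul (φ := φ ∘ₗ coeff (b' j) u)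
          (A := swapSeries (c'' j i) (a'' j i) w) (m := N - e) (n := e - u)]
        intro i
        simp [swapSeries_apply, sub_sub, add_sub_right_comm]
      · intro i
        simp [prodSeries_apply, sub_sub, add_sub_right_comm]
    rw [e₂, act_sum]
    refine Finset.sum_congr rfl fun i _ => ?_
    rw [← act_mul]
  have hmain : ∀ (k : ℤ) (L : ℕ), k - K < L →
      ∑ l ∈ Finset.range L, polyOp (expTaylor (-1) l q * p)
        (prodSeries a (mode b c (-(k - l) - 1)))
      = ∑ i : I, ∑ l ∈ Finset.range L, polyOp (expTaylor (-1) l (h i.1) * h'' i.1 i.2)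
          (swapSeries (mode (b' i.1) (c'' i.1 i.2) (-(k - l) - 1)) (a'' i.1 i.2)) := by
    intro k L hL
    funext w m n
    rw [← sub_eq_zero]
    refine (Module.forall_dual_apply_eq_zero_iff ℂ _).1 fun φ => ?_
    rw [map_sub, sub_eq_zero, polyOp_sum_apply, Finset.sum_apply, Finset.sum_apply, Finset.sum_apply,
      map_sum, map_sum]
    simp only [polyOp_sum_apply, map_sum]
    have := sum_expTaylor_eq Finset.univ (hthree φ w (m + n))
      (B := fun n' => modeSeries (φ ∘ₗ coeff a (m + n - n')) b c w n')
      (B' := fun i n' => modeSeries φ (b' i.1) (c'' i.1 i.2)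
        (coeff (a'' i.1 i.2) (m + n - n') w) n')
      (fun n' => (hY b hb c hc).hasExpSubst (φ ∘ₗ coeff a (m + n - n')) w n')
      (fun i n' => (hY _ (hb' _) _ (hc'' _ _)).hasExpSubst φ
        (coeff (a'' i.1 i.2) (m + n - n') w) n') (k₀ := K)
      (fun n' k hk => by rw [coeff_modeSeries, hK₁ k hk, coeff_zero_apply, map_zero])
      (fun i _ n' k hk => by rw [coeff_modeSeries, hK₂ i k hk, coeff_zero_apply, map_zero]) n k hL
    convert this using 2 with l hl i hi
    · rw [polyMul, Polynomial.sum_def, Polynomial.sum_def, map_sum]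
      refine Finset.sum_congr rfl fun j _ => ?_
      rw [map_smul, coeff_modeSeries, prodSeries_apply, smul_eq_mul,
        show m + n - (n - (j : ℤ) * -1) = m - j by ring, show n - (j : ℤ) * -1 = n + j by ring]
      rfl
    · refine Finset.sum_congr rfl fun l _ => ?_
      rw [polyMul, Polynomial.sum_def, Polynomial.sum_def, map_sum]
      refine Finset.sum_congr rfl fun j _ => ?_
      rw [map_smul, coeff_modeSeries, swapSeries_apply, smul_eq_mul,
        show m + n - (n - (j : ℤ) * -1) = m - j by ring, show n - (j : ℤ) * -1 = n + j by ring]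
  have := mem_saturation_of_sum (N := reversed X (Y ∪ modes Y))
    (hN := polyOp_mem_reversed _ _) (L := fun k => prodSeries a (mode b c (-k - 1))) (K := K)
    (fun k hk => by rw [hK₁ k hk, map_zero]) (r := fun l => expTaylor (-1) l q * p)
    (by rw [expTaylor_zero]; exact mul_ne_zero hq hp)
    (fun k => ⟨(k - K).toNat, by
      rw [hmain k _ (by push_cast; omega)]
      refine le_saturation _ _ (Submodule.sum_mem _ fun i _ => Submodule.sum_mem _ fun l _ =>
        Submodule.subset_span ⟨_, _, ha'' _ _, _, Or.inr ⟨_, hb' _, _, hc'' _ _, _, rfl⟩, rfl⟩)⟩)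
    (-n - 1)
  rw [show n = -(-n - 1) - 1 by ring]
  exact this

theorem SLocal.union_modes {X : Set (VertexOperator ℂ W)} (h : SLocal X X) :
    SLocal (X ∪ modes X) (X ∪ modes X) := by
  have hX := h.isQuasiTrigCompatible
  have h₁ : SLocal X (X ∪ modes X) := by
    rintro a ha b (hb | ⟨b, hb, c, hc, n, rfl⟩)
    · exact localSeries_mono subset_rfl Set.subset_union_left (h a ha b hb)
    · exact prodSeries_mode_mem h hX ha hb hc n
  rintro a (ha | ⟨a, ha, b, hb, n, rfl⟩) c hc
  · exact localSeries_mono Set.subset_union_left subset_rfl (h₁ a ha c hc)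
  · exact mode_prodSeries_mem h₁ hX ha hb hc n

/-- The spaces obtained from `U` and `1_W` by forming products and linear combinations `n` times. -/
def stage (U : Set (VertexOperator ℂ W)) : ℕ → Submodule ℂ (VertexOperator ℂ W)
  | 0 => Submodule.span ℂ (insert oneField U)
  | n + 1 => Submodule.span ℂ ((stage U n : Set (VertexOperator ℂ W)) ∪ modes (stage U n))

theorem stage_le_succ (U : Set (VertexOperator ℂ W)) (n : ℕ) : stage U n ≤ stage U (n + 1) :=
  fun _ ha => Submodule.subset_span (Or.inl ha)

theorem stage_mono (U : Set (VertexOperator ℂ W)) : Monotone (stage U) :=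
  monotone_nat_of_le_succ (stage_le_succ U)

theorem SLocal.stage {U : Set (VertexOperator ℂ W)} (h : SLocal U U) (n : ℕ) :
    SLocal (stage U n : Set (VertexOperator ℂ W)) (TrigQVA.stage U n) := by
  induction n with
  | zero => exact h.insert_oneField.span
  | succ n ih => exact ih.union_modes.span

theorem subset_generated (U : Set (VertexOperator ℂ W)) : U ⊆ generated U := fun a ha => by
  rw [SetLike.mem_coe, generated, Submodule.mem_sInf]
  exact fun S hS => hS.1 ha

theorem oneField_mem_generated (U : Set (VertexOperator ℂ W)) : oneField ∈ generated U := by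
  rw [generated, Submodule.mem_sInf]
  exact fun S hS => hS.2.1

theorem mode_mem_generated {U : Set (VertexOperator ℂ W)} {a b : VertexOperator ℂ W}
    (ha : a ∈ generated U) (hb : b ∈ generated U) (n : ℤ) : mode a b n ∈ generated U := by
  rw [generated, Submodule.mem_sInf] at *
  exact fun S hS => hS.2.2 a (ha S hS) b (hb S hS) n

theorem stage_le_generated (U : Set (VertexOperator ℂ W)) (n : ℕ) : stage U n ≤ generated U := by
  induction n with
  | zero =>
    refine Submodule.span_le.2 ?_
    rintro a (rfl | ha)
    · exact oneField_mem_generated U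
    · exact subset_generated U ha
  | succ n ih =>
    refine Submodule.span_le.2 ?_
    rintro _ (ha | ⟨a, ha, b, hb, k, rfl⟩)
    · exact ih ha
    · exact mode_mem_generated (ih ha) (ih hb) k

theorem exists_mem_stage {U : Set (VertexOperator ℂ W)} {a : VertexOperator ℂ W}
    (ha : a ∈ generated U) : ∃ n, a ∈ stage U n := by
  rw [← Submodule.mem_iSup_of_directed _ (stage_mono U).directed_le]
  rw [generated, Submodule.mem_sInf] at ha
  refine ha _ ⟨?_, ?_, ?_⟩
  · exact fun u hu => Submodule.mem_iSup_of_mem 0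
      (Submodule.subset_span (Set.mem_insert_of_mem _ hu))
  · exact Submodule.mem_iSup_of_mem 0 (Submodule.subset_span (Set.mem_insert _ _))
  · intro a ha b hb n
    rw [Submodule.mem_iSup_of_directed _ (stage_mono U).directed_le] at ha hb
    obtain ⟨i, hi⟩ := ha
    obtain ⟨j, hj⟩ := hb
    exact Submodule.mem_iSup_of_mem (max i j + 1) (Submodule.subset_span (Or.inr
      ⟨a, stage_mono U (le_max_left i j) hi, b, stage_mono U (le_max_right i j) hj, n, rfl⟩))

/-- The space generated by a local set is local: it is the union of the stages, each of which is
local. -/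
theorem SLocal.generated {U : Set (VertexOperator ℂ W)} (h : SLocal U U) :
    SLocal (generated U : Set (VertexOperator ℂ W)) (TrigQVA.generated U) := by
  intro a ha b hb
  obtain ⟨i, hi⟩ := exists_mem_stage ha
  obtain ⟨j, hj⟩ := exists_mem_stage hb
  exact localSeries_mono (stage_le_generated U (max i j)) (stage_le_generated U (max i j))
    (h.stage (max i j) a (stage_mono U (le_max_left i j) hi) b (stage_mono U (le_max_right i j) hj))

end Dong

/-! ### The three expansions of a series in two variables -/

section Expansions

/-- Three embeddings of `ℂ((z))` in `ℂ((x))((y))`, to be thought of as `f ↦ f(z₁)`, `f ↦ f(z₂)` and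
`f ↦ f(z₁ - z₂)`, for a choice of `x` and `y` among `z₁`, `z₂` and `z₁ - z₂`. -/
structure Expansion where
  /-- the embedding `f ↦ f(z₁)` -/
  e₁ : LaurentSeries ℂ →+* IterLaurent
  /-- the embedding `f ↦ f(z₂)` -/
  e₂ : LaurentSeries ℂ →+* IterLaurent
  /-- the embedding `f ↦ f(z₁ - z₂)` -/
  e₃ : LaurentSeries ℂ →+* IterLaurent
  const₂ : ∀ c : ℂ, e₂ (HahnSeries.C c) = e₁ (HahnSeries.C c)
  const₃ : ∀ c : ℂ, e₃ (HahnSeries.C c) = e₁ (HahnSeries.C c)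
  exp : ∀ c : ℂ, e₃ (expSeries c) = e₁ (expSeries c) * e₂ (expSeries (-c))

theorem inY_C (c : ℂ) : inY (HahnSeries.C c) = inX (HahnSeries.C c) := by
  ext n i
  rw [coeff_inY, ← mul_one (inX _), coeff_inX_mul, IterLaurent.coeff_one, HahnSeries.C_apply,
    HahnSeries.coeff_single]
  by_cases hn : n = 0
  · subst hn
    by_cases hi : i = 0 <;> simp [hi]
  · simp [hn]

theorem substLin_C (α : ℂˣ) (β c : ℂ) : substLin α β (HahnSeries.C c) = inX (HahnSeries.C c) := by
  ext n i
  rw [coeff_coeff_substLin, ← mul_one (inX _), coeff_inX_mul, IterLaurent.coeff_one,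
    HahnSeries.C_apply, HahnSeries.coeff_single]
  by_cases hn : n = 0
  · subst hn
    by_cases hi : i = 0
    · subst hi; simp
    · simp [hi]
  · rw [if_neg hn, mul_zero, HahnSeries.coeff_zero]
    split_ifs with h1 h2
    · rw [h2, Ring.choose_zero_pos ℤ (by omega)]
      simp
    · rw [zero_mul]
    · rfl

namespace Expansion

/-- The expansion in `ℂ((z₁))((z₂))`. -/
def left : Expansion where
  e₁ := inX
  e₂ := inY
  e₃ := substLin 1 (-1)
  const₂ := inY_C
  const₃ := substLin_C _ _
  exp c := by rw [substLin_expSeries]; simp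

/-- The expansion in `ℂ((z₂))((z₁))`. -/
def right : Expansion where
  e₁ := inY
  e₂ := inX
  e₃ := substLin (-1) 1
  const₂ c := (inY_C c).symm
  const₃ c := (substLin_C _ _ c).trans (inY_C c).symm
  exp c := by rw [substLin_expSeries, mul_comm]; simp

/-- The expansion in `ℂ((z₂))((z₀))`, where `z₀ = z₁ - z₂`. -/
def diag : Expansion where
  e₁ := substLin 1 1
  e₂ := inX
  e₃ := inY
  const₂ c := (substLin_C _ _ c).symm
  const₃ c := (inY_C c).trans (substLin_C _ _ c).symm
  exp c := by
    rw [substLin_expSeries, mul_right_comm, ← map_mul, ← expSeries_add]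
    simp [expSeries_zero]

/-- The evaluation `t₁ ↦ e^{z₁}`, `t₂ ↦ e^{z₂}` of Laurent polynomials. -/
def ev (e : Expansion) : AddMonoidAlgebra ℂ (ℤ × ℤ) →+* IterLaurent :=
  AddMonoidAlgebra.liftNCRingHom (e.e₁.comp HahnSeries.C)
    { toFun := fun g => e.e₁ (expSeries (g.toAdd.1 : ℂ)) * e.e₂ (expSeries (g.toAdd.2 : ℂ))
      map_one' := by
        simp only [toAdd_one, Prod.fst_zero, Prod.snd_zero, Int.cast_zero, expSeries_zero, map_one,
          mul_one]
      map_mul' := fun g h => by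
        simp only [toAdd_mul, Prod.fst_add, Prod.snd_add, Int.cast_add, expSeries_add, map_mul]
        ring } fun _ _ => Commute.all _ _

theorem ev_single (e : Expansion) (g : ℤ × ℤ) (c : ℂ) :
    e.ev (AddMonoidAlgebra.single g c)
      = e.e₁ (HahnSeries.C c) * (e.e₁ (expSeries (g.1 : ℂ)) * e.e₂ (expSeries (g.2 : ℂ))) :=
  AddMonoidAlgebra.liftNC_single _ _ _ _

theorem ev_lau_one_zero (e : Expansion) (p : Polynomial ℂ) :
    e.ev (lau (1, 0) p) = e.e₁ (evalExp (lau 1 p)) := by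
  induction p using Polynomial.induction_on' with
  | add p q hp hq => simp only [map_add, hp, hq]
  | monomial j c =>
    rw [lau_monomial, lau_monomial, ev_single, evalExp_single, map_mul]
    simp [expSeries_zero]

theorem ev_lau_zero_one (e : Expansion) (p : Polynomial ℂ) :
    e.ev (lau (0, 1) p) = e.e₂ (evalExp (lau 1 p)) := by
  induction p using Polynomial.induction_on' with
  | add p q hp hq => simp only [map_add, hp, hq]
  | monomial j c =>
    rw [lau_monomial, lau_monomial, ev_single, evalExp_single, map_mul, e.const₂]
    simp [expSeries_zero]

theorem ev_lau_neg (e : Expansion) (s : ℤ) (p : Polynomial ℂ) :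
    e.ev (lau (s, -s) p) = e.e₃ (evalExp (lau s p)) := by
  induction p using Polynomial.induction_on' with
  | add p q hp hq => simp only [map_add, hp, hq]
  | monomial j c =>
    rw [lau_monomial, lau_monomial, ev_single, evalExp_single, map_mul, e.const₃, e.exp]
    simp

end Expansion

/-- A Laurent polynomial `D(t₁, t₂)` that becomes a product `g₁(z₁) g₂(z₂) g₃(z₁ - z₂)` of nonzero
series for `t₁ = e^{z₁}` and `t₂ = e^{z₂}`. -/
def IsSplit (D : AddMonoidAlgebra ℂ (ℤ × ℤ)) : Prop :=
  ∃ g₁ g₂ g₃ : LaurentSeries ℂ, g₁ ≠ 0 ∧ g₂ ≠ 0 ∧ g₃ ≠ 0 ∧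
    ∀ e : Expansion, e.ev D = e.e₁ g₁ * e.e₂ g₂ * e.e₃ g₃

theorem IsSplit.mul {D D' : AddMonoidAlgebra ℂ (ℤ × ℤ)} (h : IsSplit D) (h' : IsSplit D') :
    IsSplit (D * D') := by
  obtain ⟨g₁, g₂, g₃, h₁, h₂, h₃, h⟩ := h
  obtain ⟨g₁', g₂', g₃', h₁', h₂', h₃', h'⟩ := h'
  refine ⟨g₁ * g₁', g₂ * g₂', g₃ * g₃', mul_ne_zero h₁ h₁', mul_ne_zero h₂ h₂', mul_ne_zero h₃ h₃',
    fun e => ?_⟩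
  simp only [map_mul, h, h']
  ring

theorem IsSplit.prod {ι : Type*} (s : Finset ι) {D : ι → AddMonoidAlgebra ℂ (ℤ × ℤ)}
    (h : ∀ i, IsSplit (D i)) : IsSplit (∏ i ∈ s, D i) := by
  classical
  induction s using Finset.induction_on with
  | empty => exact ⟨1, 1, 1, one_ne_zero, one_ne_zero, one_ne_zero, fun e => by simp⟩
  | insert i s hi ih => rw [Finset.prod_insert hi]; exact (h i).mul ih

theorem injective_nsmul_of_ne_zero {s : ℤ} (hs : s ≠ 0) : Function.Injective fun j : ℕ => j • s :=
  fun i j h => by simpa [hs] using h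

theorem evalExp_lau_ne_zero {s : ℤ} (hs : s ≠ 0) {p : Polynomial ℂ} (hp : p ≠ 0) :
    evalExp (lau s p) ≠ 0 :=
  evalExp_ne_zero (lau_ne_zero (injective_nsmul_of_ne_zero hs) hp)

theorem isSplit_lau_one_zero {p : Polynomial ℂ} (hp : p ≠ 0) : IsSplit (lau (1, 0) p) :=
  ⟨_, 1, 1, evalExp_lau_ne_zero one_ne_zero hp, one_ne_zero, one_ne_zero, fun e => by
    rw [e.ev_lau_one_zero, map_one, map_one, mul_one, mul_one]⟩

theorem isSplit_lau_zero_one {p : Polynomial ℂ} (hp : p ≠ 0) : IsSplit (lau (0, 1) p) :=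
  ⟨1, _, 1, one_ne_zero, evalExp_lau_ne_zero one_ne_zero hp, one_ne_zero, fun e => by
    rw [e.ev_lau_zero_one, map_one, map_one, one_mul, mul_one]⟩

theorem isSplit_lau_neg {s : ℤ} (hs : s ≠ 0) {p : Polynomial ℂ} (hp : p ≠ 0) :
    IsSplit (lau (s, -s) p) :=
  ⟨1, 1, _, one_ne_zero, one_ne_zero, evalExp_lau_ne_zero hs hp, fun e => by
    rw [e.ev_lau_neg, map_one, map_one, one_mul, one_mul]⟩

/-- Three series that are the expansions of one quotient `P(e^{z₁}, e^{z₂}) / D(e^{z₁}, e^{z₂})`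
satisfy the residue form of the Jacobi identity. -/
theorem IsSplit.resX_sub_resY {D : AddMonoidAlgebra ℂ (ℤ × ℤ)} (hD : IsSplit D)
    (P : AddMonoidAlgebra ℂ (ℤ × ℤ)) {G H G' : IterLaurent}
    (hG : Expansion.left.ev D * G = Expansion.left.ev P)
    (hH : Expansion.right.ev D * H = Expansion.right.ev P)
    (hG' : Expansion.diag.ev D * G' = Expansion.diag.ev P) (f g : LaurentSeries ℂ) :
    resX (inX f * (substLin 1 (-1) g * G)) - resY (inY f * (substLin (-1) 1 g * H))
      = resY (inY g * (substLin 1 1 f * G')) := by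
  obtain ⟨g₁, g₂, g₃, h₁, h₂, h₃, h⟩ := hD
  have hquot : ∀ (e : Expansion) (X : IterLaurent), e.ev D * X = e.ev P →
      X = e.ev P * (e.e₁ g₁⁻¹ * e.e₂ g₂⁻¹ * e.e₃ g₃⁻¹) := by
    intro e X hX
    have h₁' : e.e₁ g₁ ≠ 0 := (map_ne_zero _).2 h₁
    have h₂' : e.e₂ g₂ ≠ 0 := (map_ne_zero _).2 h₂
    have h₃' : e.e₃ g₃ ≠ 0 := (map_ne_zero _).2 h₃
    rw [← hX, h e, map_inv₀, map_inv₀, map_inv₀]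
    field_simp
  rw [hquot _ _ hG, hquot _ _ hH, hquot _ _ hG']
  clear hG hH hG' hquot h
  induction P using AddMonoidAlgebra.induction_linear with
  | zero => simp only [map_zero, zero_mul, mul_zero, sub_zero]
  | add P Q hP hQ =>
    simp only [map_add, add_mul, mul_add]
    rw [← hP, ← hQ]
    abel
  | single x c =>
    have key := resX_sub_resY_mul (f * HahnSeries.C c * expSeries (x.1 : ℂ) * g₁⁻¹)
      (expSeries (x.2 : ℂ) * g₂⁻¹) (g * g₃⁻¹)
    simp only [Expansion.ev_single]
    convert key using 2
    · congr 1
      change inX f * (substLin 1 (-1) g * (inX _ * (inX _ * inY _) * (inX _ * inY _ *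
        substLin 1 (-1) _))) = _
      simp only [map_mul]
      ring
    · congr 1
      change inY f * (substLin (-1) 1 g * (inY _ * (inY _ * inX _) * (inY _ * inX _ *
        substLin (-1) 1 _))) = _
      simp only [map_mul]
      ring
    · change inY g * (substLin 1 1 f * (substLin 1 1 _ * (substLin 1 1 _ * inX _) *
        (substLin 1 1 _ * inX _ * inY _))) = _
      simp only [map_mul]
      ring

end Expansions

/-! ### The iterated products of three fields -/

section Triple

theorem coeff_mapDomain_apply {Λ Λ' : Type*} [AddCommGroup Λ] [AddCommGroup Λ'] (σ : Λ ≃+ Λ')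
    (P : AddMonoidAlgebra ℂ Λ) (x : Λ) :
    (AddMonoidAlgebra.mapDomainAlgHom ℂ ℂ (σ : Λ →+ Λ') P).coeff (σ x) = P.coeff x := by
  induction P using AddMonoidAlgebra.induction_linear with
  | zero => simp
  | add d e hd he =>
    rw [map_add, AddMonoidAlgebra.coeff_add, Finsupp.add_apply, hd, he, AddMonoidAlgebra.coeff_add,
      Finsupp.add_apply]
  | single g c =>
    classical
    simp [Finsupp.single_apply]

theorem act_mapDomain_apply {Λ Λ' : Type*} [AddCommGroup Λ] [AddCommGroup Λ'] (σ : Λ ≃+ Λ')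
    (d : AddMonoidAlgebra ℂ Λ) (f : Λ → ℂ) (x : Λ) :
    act (AddMonoidAlgebra.mapDomainAlgHom ℂ ℂ (σ : Λ →+ Λ') d) (fun y => f (σ.symm y)) (σ x)
      = act d f x := by
  induction d using AddMonoidAlgebra.induction_linear with
  | zero => simp
  | add d e hd he => rw [map_add, act_add, act_add, Pi.add_apply, Pi.add_apply, hd, he]
  | single g c =>
    rw [act_single, AddMonoidAlgebra.mapDomainAlgHom_apply, AddMonoidAlgebra.mapDomain_single,
      act_single]
    simp

/-- The iterated substitution of exponentials, for series whose exponents are reindexed by `σ`. -/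
theorem Expansion.ev_mul_eq (e : Expansion) (σ : ℤ × ℤ ≃+ ℤ × ℤ)
    (hC : ∀ c, e.e₁ (HahnSeries.C c) = inX (HahnSeries.C c))
    (hσ : ∀ g : ℤ × ℤ, e.e₁ (expSeries (g.1 : ℂ)) * e.e₂ (expSeries (g.2 : ℂ))
      = inX (expSeries ((σ g).1 : ℂ)) * inY (expSeries ((σ g).2 : ℂ)))
    {A : ℤ × ℤ → ℂ} {D P : AddMonoidAlgebra ℂ (ℤ × ℤ)} (hA : act D A = P.coeff)
    {B : ℤ → LaurentSeries ℂ} (hAB : ∀ m, HasExpSubst (fun n => A (σ.symm (m, n))) (B m)) {k₀ : ℤ}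
    (hB : ∀ m, ∀ k < k₀, (B m).coeff k = 0) {G : IterLaurent}
    (hG : ∀ k, HasExpSubst (fun m => (B m).coeff k) (G.coeff k)) :
    e.ev D * G = e.ev P := by
  have hev : ∀ Q, evalExp₂ (AddMonoidAlgebra.mapDomainAlgHom ℂ ℂ (σ : ℤ × ℤ →+ ℤ × ℤ) Q)
      = e.ev Q := by
    intro Q
    induction Q using AddMonoidAlgebra.induction_linear with
    | zero => simp only [map_zero]
    | add d e hd he => simp only [map_add, hd, he]
    | single g c =>
      rw [e.ev_single, hC, hσ, AddMonoidAlgebra.mapDomainAlgHom_apply,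
        AddMonoidAlgebra.mapDomain_single, evalExp₂_single]
      rfl
  rw [← hev D, ← hev P]
  refine evalExp₂_mul_eq (A := fun y => A (σ.symm y)) ?_ hAB hB hG
  funext y
  obtain ⟨x, rfl⟩ := σ.surjective y
  rw [act_mapDomain_apply, coeff_mapDomain_apply, hA]

/-- The change of exponents from `t₁ = e^{z₁}, t₂ = e^{z₂}` to `e^{z₂}, e^{z₁ - z₂}`: the product
`t₁^i t₂^j` is `e^{(i + j) z₂} e^{i (z₁ - z₂)}`. -/
def diagEquiv : ℤ × ℤ ≃+ ℤ × ℤ where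
  toFun x := (x.1 + x.2, x.1)
  invFun y := (y.2, y.1 - y.2)
  left_inv x := by ext <;> simp
  right_inv y := by ext <;> simp
  map_add' x y := by ext <;> simp [add_add_add_comm]

variable {W : Type*} [AddCommGroup W] [Module ℂ W]

theorem modeSeries_zero_left (φ : Module.Dual ℂ W) (b : VertexOperator ℂ W) (w : W) (N : ℤ)
    (h : QuasiCompatible 0 b) : modeSeries φ 0 b w N = 0 := by
  refine (h.hasExpSubst φ w N).unique ?_
  convert HasExpSubst.zero using 1
  funext m
  rw [coeff_zero_apply, map_zero]
  rfl

/-- The series `G(z₁, z₂)` is the coefficient of `x ^ N` in `φ(Y(a, z₁) Y(b, z₂) c w)`. -/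
def IsIterate (φ : Module.Dual ℂ W) (a b c : VertexOperator ℂ W) (w : W) (N : ℤ)
    (G : IterLaurent) : Prop :=
  ∀ k, G.coeff k = modeSeries φ a (mode b c (-k - 1)) w N

/-- The series `G(z₂, z₀)` is the coefficient of `x ^ N` in `φ(Y(Y(a, z₀) b, z₂) c w)`. -/
def IsDiagIterate (φ : Module.Dual ℂ W) (a b c : VertexOperator ℂ W) (w : W) (N : ℤ)
    (G : IterLaurent) : Prop :=
  ∀ k, G.coeff k = modeSeries φ (mode a b (-k - 1)) c w N

/-- The series `φ(Y(a, z₁) Y(b, z₂) c w)` is a quotient of the Laurent polynomials `P` and `D`, at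
`t₁ = e^{z₁}` and `t₂ = e^{z₂}`, if `D` multiplies `φ(a(x₁) b(x₂) c(x) w)` to `P`. -/
theorem IsIterate.left_ev_mul {φ : Module.Dual ℂ W} {a b c : VertexOperator ℂ W} {w : W} {N : ℤ}
    {G : IterLaurent} (hG : IsIterate φ a b c w N G) (hbc : QuasiCompatible b c)
    (h : ∀ n, QuasiCompatible a (mode b c n)) {D P : AddMonoidAlgebra ℂ (ℤ × ℤ)}
    (hP : act D (fun x => φ (coeff a x.1 (coeff b x.2 (coeff c (N - x.1 - x.2) w)))) = P.coeff) :
    Expansion.left.ev D * G = Expansion.left.ev P := by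
  obtain ⟨K, hK⟩ := exists_mode_eq_zero b c
  have hB : ∀ m, ∀ k < K, (modeSeries (φ ∘ₗ coeff a m) b c w (N - m)).coeff k = 0 :=
    fun m k hk => by rw [coeff_modeSeries, hK k hk, coeff_zero_apply, map_zero]
  have hAB : ∀ m, HasExpSubst (fun n => φ (coeff a m (coeff b n (coeff c (N - m - n) w))))
      (modeSeries (φ ∘ₗ coeff a m) b c w (N - m)) :=
    fun m => hbc.hasExpSubst (φ ∘ₗ coeff a m) w (N - m)
  have hcol : ∀ k, HasExpSubst (fun m => (modeSeries (φ ∘ₗ coeff a m) b c w (N - m)).coeff k)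
      (G.coeff k) := fun k => by
    rw [hG k]
    simp only [coeff_modeSeries]
    exact (h (-k - 1)).hasExpSubst φ w N
  exact Expansion.ev_mul_eq _ (AddEquiv.refl _) (fun _ => rfl) (fun g => by rw [AddEquiv.refl_apply]; rfl) hP hAB hB hcol

/-- The series `φ(Y(b, z₂) Y(a, z₁) c w)` is the same quotient, expanded in `ℂ((z₂))((z₁))`, if `D`
multiplies `φ(b(x₂) a(x₁) c(x) w)` to `P`. -/
theorem IsIterate.right_ev_mul {φ : Module.Dual ℂ W} {a b c : VertexOperator ℂ W} {w : W} {N : ℤ}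
    {G : IterLaurent} (hG : IsIterate φ b a c w N G) (hac : QuasiCompatible a c)
    (h : ∀ n, QuasiCompatible b (mode a c n)) {D P : AddMonoidAlgebra ℂ (ℤ × ℤ)}
    (hP : act D (fun x => φ (coeff b x.2 (coeff a x.1 (coeff c (N - x.1 - x.2) w)))) = P.coeff) :
    Expansion.right.ev D * G = Expansion.right.ev P := by
  obtain ⟨K, hK⟩ := exists_mode_eq_zero a c
  have hB : ∀ n, ∀ k < K, (modeSeries (φ ∘ₗ coeff b n) a c w (N - n)).coeff k = 0 :=
    fun m k hk => by rw [coeff_modeSeries, hK k hk, coeff_zero_apply, map_zero]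
  have hAB : ∀ n, HasExpSubst (fun m => φ (coeff b n (coeff a m (coeff c (N - m - n) w))))
      (modeSeries (φ ∘ₗ coeff b n) a c w (N - n)) := fun n => by
    simp only [sub_right_comm N _ n]
    exact hac.hasExpSubst (φ ∘ₗ coeff b n) w (N - n)
  have hcol : ∀ k, HasExpSubst (fun n => (modeSeries (φ ∘ₗ coeff b n) a c w (N - n)).coeff k)
      (G.coeff k) := fun k => by
    rw [hG k]
    simp only [coeff_modeSeries]
    exact (h (-k - 1)).hasExpSubst φ w N
  refine Expansion.ev_mul_eq _ AddEquiv.prodComm (fun c => inY_C c) (fun g => ?_) hP hAB hB hcol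
  exact mul_comm (inY (expSeries (g.1 : ℂ))) (inX (expSeries (g.2 : ℂ)))

/-- The series `φ(Y(Y(a, z₁ - z₂) b, z₂) c w)` is the same quotient, expanded in `ℂ((z₂))((z₁ - z₂))`,
if `D` multiplies `φ(a(x₁) b(x₂) c(x) w)` to `P`. -/
theorem IsDiagIterate.diag_ev_mul {φ : Module.Dual ℂ W} {a b c : VertexOperator ℂ W} {w : W} {N : ℤ}
    {G : IterLaurent} (hG : IsDiagIterate φ a b c w N G) (hab : QuasiCompatible a b)
    (h : ∀ n, QuasiCompatible (mode a b n) c) {D P : AddMonoidAlgebra ℂ (ℤ × ℤ)}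
    (hP : act D (fun x => φ (coeff a x.1 (coeff b x.2 (coeff c (N - x.1 - x.2) w)))) = P.coeff) :
    Expansion.diag.ev D * G = Expansion.diag.ev P := by
  obtain ⟨K, hK⟩ := exists_mode_eq_zero a b
  have hB : ∀ n, ∀ k < K, (modeSeries φ a b (coeff c (N - n) w) n).coeff k = 0 :=
    fun m k hk => by rw [coeff_modeSeries, hK k hk, coeff_zero_apply, map_zero]
  have hAB : ∀ n, HasExpSubst
      (fun m => φ (coeff a m (coeff b (n - m) (coeff c (N - m - (n - m)) w))))
      (modeSeries φ a b (coeff c (N - n) w) n) := fun n => by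
    simp only [sub_sub_sub_cancel_right]
    exact hab.hasExpSubst φ (coeff c (N - n) w) n
  have hcol : ∀ k, HasExpSubst (fun n => (modeSeries φ a b (coeff c (N - n) w) n).coeff k)
      (G.coeff k) := fun k => by
    rw [hG k]
    simp only [coeff_modeSeries]
    exact (h (-k - 1)).hasExpSubst φ w N
  refine Expansion.ev_mul_eq _ diagEquiv (fun c => substLin_C _ _ c) (fun g => ?_) hP hAB hB hcol
  change substLin 1 1 _ * inX _ = inX (expSeries ((g.1 + g.2 : ℤ) : ℂ)) * inY (expSeries (g.1 : ℂ))
  rw [substLin_expSeries, Int.cast_add, expSeries_add, map_mul]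
  simp only [Units.val_one, mul_one]
  ring

omit [Module ℂ W] in
theorem IsBoundedAlong.finite_support {f : ℤ × ℤ → W}
    (h₁ : IsBoundedAlong (AddMonoidHom.fst ℤ ℤ) f) (h₂ : IsBoundedAlong (AddMonoidHom.snd ℤ ℤ) f)
    (h₃ : IsBoundedAlong (-(AddMonoidHom.fst ℤ ℤ + AddMonoidHom.snd ℤ ℤ)) f) :
    (Function.support f).Finite := by
  obtain ⟨b₁, h₁⟩ := h₁
  obtain ⟨b₂, h₂⟩ := h₂
  obtain ⟨b₃, h₃⟩ := h₃
  refine (Set.finite_Icc ((b₁, b₂) : ℤ × ℤ) (-b₃ - b₂, -b₃ - b₁)).subset fun x hx => ?_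
  have h₁' : b₁ ≤ x.1 := by
    by_contra h
    exact hx (h₁ x (by simpa using h))
  have h₂' : b₂ ≤ x.2 := by
    by_contra h
    exact hx (h₂ x (by simpa using h))
  have h₃' : b₃ ≤ -(x.1 + x.2) := by
    by_contra h
    refine hx (h₃ x ?_)
    change -(x.1 + x.2) < b₃
    omega
  exact ⟨⟨h₁', h₂'⟩, ⟨by change x.1 ≤ _; omega, by change x.2 ≤ _; omega⟩⟩

/-- The products `b(x₂) a(x₁) c(x) w`, in total degree `N`. -/
def tripleSeries (b a c : VertexOperator ℂ W) (w : W) (N : ℤ) (x : ℤ × ℤ) : W :=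
  coeff b x.2 (coeff a x.1 (coeff c (N - x.1 - x.2) w))

theorem act_tripleSeries (b a c : VertexOperator ℂ W) (w : W) (N : ℤ) (p : Polynomial ℂ)
    (m n : ℤ) : act (lau (1, 0) p) (tripleSeries b a c w N) (m, n)
      = coeff b n (polyMul p (prod₂ a c w) m (N - m - n)) := by
  refine act_lau_eq_polyMul (φ := coeff b n) (fun j => ?_) p
  rw [show ((m, n) : ℤ × ℤ) - j • ((1, 0) : ℤ × ℤ) = (m - j, n) by ext <;> simp]
  change coeff b n (coeff a (m - j) (coeff c (N - (m - j) - n) w))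
    = coeff b n (coeff a (m - j) (coeff c (N - m - n + j) w))
  rw [show N - (m - (j : ℤ)) - n = N - m - n + j by ring]

theorem CompatibleWith.isBoundedAlong {b a c : VertexOperator ℂ W} {p : Polynomial ℂ}
    (h : CompatibleWith p a c) (w : W) (N : ℤ) :
    IsBoundedAlong (AddMonoidHom.fst ℤ ℤ) (act (lau (1, 0) p) (tripleSeries b a c w N)) ∧
      IsBoundedAlong (-(AddMonoidHom.fst ℤ ℤ + AddMonoidHom.snd ℤ ℤ))
        (act (lau (1, 0) p) (tripleSeries b a c w N)) := by
  obtain ⟨K, hK⟩ := h w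
  constructor
  · refine ⟨K, ?_⟩
    rintro ⟨m, n⟩ hm
    have hm' : m < K := hm
    rw [act_tripleSeries, hK _ _ (Or.inl hm'), map_zero]
  · refine ⟨K - N, ?_⟩
    rintro ⟨m, n⟩ hm
    have hm' : -(m + n) < K - N := hm
    rw [act_tripleSeries, hK _ _ (Or.inr (by omega)), map_zero]

theorem CompatibleWith.isBoundedAlong_snd {b a c : VertexOperator ℂ W} {p : Polynomial ℂ}
    (h : CompatibleWith p b c) (w : W) (N : ℤ) :
    IsBoundedAlong (AddMonoidHom.snd ℤ ℤ) (act (lau (0, 1) p) fun x : ℤ × ℤ =>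
      coeff a x.1 (coeff b x.2 (coeff c (N - x.1 - x.2) w))) := by
  obtain ⟨K, hK⟩ := h w
  refine ⟨K, ?_⟩
  rintro ⟨m, n⟩ hn
  have hn' : n < K := hn
  rw [act_lau_eq_polyMul (φ := coeff a m) (A := prod₂ b c w) (m := n) (n := N - m - n),
    hK _ _ (Or.inl hn'), map_zero]
  intro j
  rw [show ((m, n) : ℤ × ℤ) - j • ((0, 1) : ℤ × ℤ) = (m, n - j) by ext <;> simp]
  change coeff a m (coeff b (n - j) (coeff c (N - m - (n - j)) w))
    = coeff a m (coeff b (n - j) (coeff c (N - m - n + j) w))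
  rw [show N - m - (n - (j : ℤ)) = N - m - n + j by ring]

theorem act_tripleSeries_eq_sum {ι : Type} [Fintype ι] {b a : VertexOperator ℂ W}
    {b' a' : ι → VertexOperator ℂ W} {q : Polynomial ℂ} {h : ι → Polynomial ℂ}
    (hba : polyOp q (prodSeries b a) = ∑ i, polyOp (h i) (swapSeries (a' i) (b' i)))
    (c : VertexOperator ℂ W) (w : W) (N : ℤ) :
    act (lau (-1, 1) q) (tripleSeries b a c w N)
      = ∑ j, act (lau (-1, 1) (h j)) (fun x : ℤ × ℤ =>
        coeff (a' j) x.1 (coeff (b' j) x.2 (coeff c (N - x.1 - x.2) w))) := by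
  ext ⟨m, n⟩
  have hx : ∀ j : ℕ, ((m, n) : ℤ × ℤ) - j • ((-1, 1) : ℤ × ℤ) = (m + j, n - j) := fun j => by
    ext <;> simp
  have hN : ∀ j : ℕ, N - (m + j) - (n - j) = N - m - n := fun j => by ring
  rw [Finset.sum_apply, act_lau_eq_polyMul (φ := LinearMap.id)
    (A := prodSeries b a (coeff c (N - m - n) w)) (m := n) (n := m), ← polyOp_apply, hba,
    polyOp_sum_apply, map_sum]
  · refine Finset.sum_congr rfl fun j _ => ?_
    rw [act_lau_eq_polyMul (φ := LinearMap.id)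
      (A := swapSeries (a' j) (b' j) (coeff c (N - m - n) w)) (m := n) (n := m)]
    intro i
    rw [hx]
    simp only [hN]
    rfl
  · intro i
    rw [hx, tripleSeries]
    simp only [hN]
    rfl

/-- The products `b(x₂) a(x₁) c(x) w` become Laurent polynomials after multiplication by a denominator
that does not depend on `w`. In each degree the exponents of `x₁`, `x₂` and `x` have to be bounded
below: those of `x₁` and `x` are by the compatibility of `a` and `c`, and those of `x₂` are by the
locality of `b` and `a`, which moves `b` next to `c`. -/
theorem SLocal.exists_finite_support {X : Set (VertexOperator ℂ W)} (hX : SLocal X X)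
    {a b c : VertexOperator ℂ W} (ha : a ∈ X) (hb : b ∈ X) (hc : c ∈ X) :
    ∃ E : AddMonoidAlgebra ℂ (ℤ × ℤ), IsSplit E ∧ ∀ (F : AddMonoidAlgebra ℂ (ℤ × ℤ)) (w : W) (N : ℤ),
      (Function.support (act (F * E) (tripleSeries b a c w N))).Finite := by
  classical
  obtain ⟨q, hq, hba⟩ := hX b hb a ha
  obtain ⟨ι, _, b', a', h, hb', ha', hba⟩ := exists_sum_of_mem_reversed hba
  have hcomp := hX.isQuasiTrigCompatible
  obtain ⟨p₁, hp₁, hac⟩ := hcomp a ha c hc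
  choose p hp hbc using fun j => hcomp (b' j) (hb' j) c hc
  set p₂ := ∏ j, p j with hp₂
  have hp₂0 : p₂ ≠ 0 := Finset.prod_ne_zero_iff.2 fun j _ => hp j
  have hsnd : ∀ w N, IsBoundedAlong (AddMonoidHom.snd ℤ ℤ)
      (act (lau (0, 1) p₂) (act (lau (-1, 1) q) (tripleSeries b a c w N))) := by
    intro w N
    rw [act_tripleSeries_eq_sum hba, act_sum]
    refine IsBoundedAlong.sum _ fun j => ?_
    rw [← act_mul, mul_comm, act_mul]
    refine IsBoundedAlong.act ?_ _
    rw [hp₂, ← Finset.mul_prod_erase _ _ (Finset.mem_univ j), mul_comm, map_mul, act_mul]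
    exact ((hbc j).isBoundedAlong_snd w N).act _
  have hsplit := isSplit_lau_neg (s := -1) (by norm_num) hq
  rw [neg_neg] at hsplit
  refine ⟨lau (1, 0) p₁ * lau (0, 1) p₂ * lau (-1, 1) q,
    ((isSplit_lau_one_zero hp₁).mul (isSplit_lau_zero_one hp₂0)).mul hsplit, fun F w N => ?_⟩
  have e₁ : F * (lau ((1, 0) : ℤ × ℤ) p₁ * lau (0, 1) p₂ * lau (-1, 1) q)
      = (F * lau (0, 1) p₂ * lau (-1, 1) q) * lau (1, 0) p₁ := by ring
  have e₂ : F * (lau ((1, 0) : ℤ × ℤ) p₁ * lau (0, 1) p₂ * lau (-1, 1) q)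
      = (F * lau (1, 0) p₁) * (lau (0, 1) p₂ * lau (-1, 1) q) := by ring
  refine IsBoundedAlong.finite_support ?_ ?_ ?_
  · rw [e₁, act_mul]
    exact (hac.isBoundedAlong w N).1.act _
  · rw [e₂, act_mul (F * _), act_mul (lau (0, 1) p₂)]
    exact (hsnd w N).act _
  · rw [e₁, act_mul]
    exact (hac.isBoundedAlong w N).2.act _

end Triple

/-! ### The Jacobi identity -/

section Jacobi

variable {W : Type*} [AddCommGroup W] [Module ℂ W]

/-- The two expansions of `p(e^{s(x - y)})`, which is a power series in `x` and `y`, agree. -/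
theorem substLin_flip (s : ℤ) (p : Polynomial ℂ) :
    substLin (-1) 1 (evalExp (lau s p)) = substLin 1 (-1) (evalExp (lau (-s) p)) := by
  induction p using Polynomial.induction_on' with
  | add p q hp hq => simp only [map_add, hp, hq]
  | monomial j c =>
    rw [lau_monomial, lau_monomial, evalExp_single, evalExp_single, map_mul, map_mul, substLin_C,
      substLin_C, substLin_expSeries, substLin_expSeries]
    simp

/-- The Jacobi identity in terms of residues. With `q(x₁/x₂) a(x₁) b(x₂) = ∑ hᵢ(x₁/x₂) bᵢ(x₂) aᵢ(x₁)`
the structure functions are `fᵢ(z) = hᵢ(e^{-z}) / q(e^{-z})`, because `x₁/x₂` becomes `e^{z₁ - z₂}` and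
the argument of `fᵢ` is `z₂ - z₁`. -/
theorem SLocal.exists_residue_identity {X : Set (VertexOperator ℂ W)} (hX : SLocal X X)
    (hmode : ∀ a ∈ X, ∀ b ∈ X, ∀ n, mode a b n ∈ X) {a b : VertexOperator ℂ W} (ha : a ∈ X)
    (hb : b ∈ X) :
    ∃ (ι : Type) (_ : Fintype ι) (a' b' : ι → VertexOperator ℂ W) (f : ι → LaurentSeries ℂ),
      (∀ i, a' i ∈ X) ∧ (∀ i, b' i ∈ X) ∧
      ∀ c ∈ X, ∀ (φ : Module.Dual ℂ W) (w : W) (N : ℤ) (G : IterLaurent) (H : ι → IterLaurent)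
        (G' : IterLaurent), IsIterate φ a b c w N G → (∀ i, IsIterate φ (b' i) (a' i) c w N (H i)) →
        IsDiagIterate φ a b c w N G' → ∀ f₁ f₃ : LaurentSeries ℂ,
        resX (inX f₁ * (substLin 1 (-1) f₃ * G))
          - resY (inY f₁ * (substLin (-1) 1 f₃ * ∑ i, substLin 1 (-1) (f i) * H i))
          = resY (inY f₃ * (substLin 1 1 f₁ * G')) := by
  classical
  obtain ⟨q, hq, hab⟩ := hX a ha b hb
  obtain ⟨ι, _, a', b', h, ha', hb', hab⟩ := exists_sum_of_mem_reversed hab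
  have hcomp := hX.isQuasiTrigCompatible
  have hq' : evalExp (lau (-1) q) ≠ 0 := evalExp_lau_ne_zero (by norm_num) hq
  refine ⟨ι, inferInstance, a', b', fun i => evalExp (lau (-1) (h i)) * (evalExp (lau (-1) q))⁻¹,
    ha', hb', fun c hc φ w N G H G' hG hH hG' f₁ f₃ => ?_⟩
  choose E hE hfin using fun i => hX.exists_finite_support (ha' i) (hb' i) hc
  set E₀ := ∏ i, E i with hE₀
  have hfin₀ : ∀ i, (Function.support
      (act E₀ (tripleSeries (b' i) (a' i) c w N))).Finite := fun i => by
    rw [hE₀, ← Finset.prod_erase_mul _ _ (Finset.mem_univ i)]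
    exact hfin i _ w N
  choose P hP using fun i => exists_coeff_eq (f := fun x =>
    φ (act E₀ (tripleSeries (b' i) (a' i) c w N) x))
    ((hfin₀ i).subset fun x hx h0 => hx (by simp only [h0, map_zero]))
  have hPi : ∀ i, act E₀ (fun x => φ (coeff (b' i) x.2 (coeff (a' i) x.1
      (coeff c (N - x.1 - x.2) w)))) = (P i).coeff := fun i => by
    rw [hP]
    funext x
    exact act_map_apply φ E₀ (tripleSeries (b' i) (a' i) c w N) x
  have hsplit₁ := isSplit_lau_neg (s := 1) one_ne_zero hq
  have hsplit : IsSplit (lau (1, -1) q * E₀) := hsplit₁.mul (IsSplit.prod _ hE)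
  have hA : act (lau (1, -1) q * E₀) (fun x => φ (coeff a x.1 (coeff b x.2
      (coeff c (N - x.1 - x.2) w)))) = (∑ i, lau (1, -1) (h i) * P i).coeff := by
    have e : act (lau (1, -1) q) (fun x : ℤ × ℤ => φ (coeff a x.1 (coeff b x.2
        (coeff c (N - x.1 - x.2) w)))) = ∑ i, act (lau (1, -1) (h i)) (fun x : ℤ × ℤ =>
        φ (coeff (b' i) x.2 (coeff (a' i) x.1 (coeff c (N - x.1 - x.2) w)))) := by
      ext ⟨m, n⟩
      have hx : ∀ j : ℕ, ((m, n) : ℤ × ℤ) - j • ((1, -1) : ℤ × ℤ) = (m - j, n + j) := fun j => by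
        ext <;> simp
      have hN : ∀ j : ℕ, N - (m - j) - (n + j) = N - m - n := fun j => by ring
      rw [Finset.sum_apply, act_lau_eq_polyMul (φ := φ)
        (A := prodSeries a b (coeff c (N - m - n) w)) (m := m) (n := n), ← polyOp_apply, hab,
        polyOp_sum_apply, map_sum]
      · refine Finset.sum_congr rfl fun j _ => ?_
        rw [act_lau_eq_polyMul (φ := φ)
          (A := swapSeries (b' j) (a' j) (coeff c (N - m - n) w)) (m := m) (n := n)]
        intro i
        rw [hx]
        simp only [hN]
        rfl
      · intro i
        rw [hx]
        simp only [hN]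
        rfl
    rw [mul_comm, act_mul, e, act_sum]
    have hs : (∑ i, lau ((1, -1) : ℤ × ℤ) (h i) * P i).coeff
        = ∑ i, (lau ((1, -1) : ℤ × ℤ) (h i) * P i).coeff := AddMonoidAlgebra.coeff_sum _ _
    rw [hs]
    funext x
    rw [Finset.sum_apply, Finsupp.finsetSum_apply]
    refine Finset.sum_congr rfl fun i _ => ?_
    rw [← act_mul, mul_comm, act_mul, hPi, act_coeff]
  refine hsplit.resX_sub_resY _ (hG.left_ev_mul (hcomp b hb c hc)
    (fun n => hcomp a ha _ (hmode b hb c hc n)) hA) ?_ (hG'.diag_ev_mul (hcomp a ha b hb)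
    (fun n => hcomp _ (hmode a ha b hb n) c hc) hA) f₁ f₃
  rw [Finset.mul_sum, map_sum]
  refine Finset.sum_congr rfl fun i _ => ?_
  rw [map_mul _ (lau (1, -1) q) E₀, map_mul _ (lau (1, -1) (h i)) (P i),
    map_mul (substLin 1 (-1)), ← (hH i).right_ev_mul (hcomp _ (ha' i) c hc)
    (fun n => hcomp _ (hb' i) _ (hmode _ (ha' i) c hc n)) (hPi i)]
  have hq₁ : Expansion.right.ev (lau (1, -1) q) = substLin 1 (-1) (evalExp (lau (-1) q)) :=
    (Expansion.right.ev_lau_neg 1 q).trans (substLin_flip 1 q)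
  have hh : Expansion.right.ev (lau (1, -1) (h i)) = substLin 1 (-1) (evalExp (lau (-1) (h i))) :=
    (Expansion.right.ev_lau_neg 1 (h i)).trans (substLin_flip 1 (h i))
  have hne : substLin 1 (-1) (evalExp (lau (-1) q)) ≠ 0 := (map_ne_zero _).2 hq'
  rw [hq₁, hh, map_inv₀]
  field_simp

theorem isIterTruncated_prod₂ {V : Type*} [AddCommGroup V] [Module ℂ V] (a b : VertexOperator ℂ V)
    (v : V) : IsIterTruncated (prod₂ a b v) := by
  refine ⟨?_, fun n => exists_coeff_apply_eq_zero a _⟩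
  obtain ⟨K, hK⟩ := exists_coeff_apply_eq_zero b v
  exact ⟨K, fun n hn m => by rw [prod₂, hK n hn, map_zero]⟩

theorem substLin_neg_one_single (l : ℤ) :
    substLin (-1) 1 (HahnSeries.single l 1)
      = inX (HahnSeries.C ((-1 : ℂ) ^ l)) * substLin 1 (-1) (HahnSeries.single l 1) := by
  ext j i
  rw [coeff_inX_mul, HahnSeries.C_mul_eq_smul, HahnSeries.coeff_smul, coeff_coeff_substLin,
    coeff_coeff_substLin, smul_eq_mul]
  split_ifs with hj
  · lift j to ℕ using hj
    by_cases h : i + j = l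
    · subst h
      have e : (-1 : ℂ) ^ (i + j) * (-1) ^ j = (-1) ^ i := by
        rw [zpow_add₀ (by norm_num), zpow_natCast, mul_assoc, ← mul_pow]
        simp
      rw [HahnSeries.coeff_single_same, Int.toNat_natCast]
      simp only [Units.val_neg, Units.val_one, one_zpow, one_pow, one_mul, mul_one]
      rw [← e]
      ring
    · rw [HahnSeries.coeff_single_of_ne h]
      simp
  · rw [mul_zero]

theorem coeff_resX_single (m n : ℤ) (X : IterLaurent) :
    (resX (inX (HahnSeries.single (-m - 1) 1) * X)).coeff n = (X.coeff n).coeff m := by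
  rw [coeff_resX, coeff_inX_mul, show (-1 : ℤ) = m + (-m - 1) by ring,
    HahnSeries.coeff_single_mul_add, one_mul]

theorem resY_inY_single_mul (l : ℤ) (X : IterLaurent) :
    resY (inY (HahnSeries.single l 1) * X) = X.coeff (-1 - l) := by
  rw [resY_apply, IterLaurent.coeff_mul_eq_sum _ _ _ {l}, Finset.sum_singleton, coeff_inY,
    HahnSeries.coeff_single_same, map_one, one_mul]
  intro p hp _
  rw [coeff_inY] at hp
  rw [Finset.mem_singleton]
  by_contra h
  exact hp (by rw [HahnSeries.coeff_single_of_ne h, map_zero])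

theorem subPow_eq (l : ℤ) : subPow l
    = fun i j => ((substLin 1 (-1) (HahnSeries.single l 1)).coeff j).coeff i := by
  funext i j
  exact (coeff_coeff_substLin_eq_subExpand _ i j).symm

theorem subExpand_eq (f : LaurentSeries ℂ) :
    subExpand f = fun i j => ((substLin 1 (-1) f).coeff j).coeff i := by
  funext i j
  exact (coeff_coeff_substLin_eq_subExpand _ i j).symm

theorem IsIterTruncated.toIter_mul₂ {V : Type*} [AddCommGroup V] [Module ℂ V] {A : ℤ → ℤ → V} (hA : IsIterTruncated A) (Z : IterLaurent)
    (φ : V →ₗ[ℂ] ℂ) : (hA.mul₂ Z).toIter φ = Z * hA.toIter φ := by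
  ext n m
  rw [IsIterTruncated.coeff_toIter, hA.map_mul₂]

theorem IsIterTruncated.toIter_sum {V ι : Type*} [AddCommGroup V] [Module ℂ V]
    (s : Finset ι) {A : ι → ℤ → ℤ → V}
    (hA : ∀ i, IsIterTruncated (A i)) (φ : V →ₗ[ℂ] ℂ) :
    (IsIterTruncated.sum s hA).toIter φ = ∑ i ∈ s, (hA i).toIter φ := by
  classical
  have hc : ∀ (t : Finset ι) (n m : ℤ), ((∑ i ∈ t, (hA i).toIter φ).coeff n).coeff m
      = ∑ i ∈ t, φ (A i m n) := by
    intro t n m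
    induction t using Finset.induction_on with
    | empty => rw [Finset.sum_empty, Finset.sum_empty, IterLaurent.coeff_zero, HahnSeries.coeff_zero]
    | insert i t hi ih =>
      rw [Finset.sum_insert hi, Finset.sum_insert hi, IterLaurent.coeff_add, HahnSeries.coeff_add, ih,
        IsIterTruncated.coeff_toIter]
  ext n m
  rw [IsIterTruncated.coeff_toIter, hc, Finset.sum_apply, Finset.sum_apply, map_sum]

/-- The coefficients of the first term of the Jacobi identity. -/
theorem map_mul₂_subPow {V : Type*} [AddCommGroup V] [Module ℂ V] {A : ℤ → ℤ → V}
    (hA : IsIterTruncated A) (φ : V →ₗ[ℂ] ℂ) (l m n : ℤ) :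
    φ (mul₂ (subPow l) A m n) = (resX (inX (HahnSeries.single (-m - 1) 1) *
      (substLin 1 (-1) (HahnSeries.single l 1) * hA.toIter φ))).coeff n := by
  rw [coeff_resX_single, subPow_eq, hA.map_mul₂]

/-- The coefficients of the second term of the Jacobi identity. -/
theorem map_mul₂_subPow_sum {V ι : Type*} [AddCommGroup V] [Module ℂ V] [Fintype ι]
    {A : ι → ℤ → ℤ → V} (hA : ∀ i, IsIterTruncated (A i)) (f : ι → LaurentSeries ℂ)
    (φ : V →ₗ[ℂ] ℂ) (l m n : ℤ) :
    φ ((-1 : ℂ) ^ l • mul₂ (subPow l) (∑ i, mul₂ (subExpand (f i)) (A i)) n m)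
      = (resY (inY (HahnSeries.single (-m - 1) 1) * (substLin (-1) 1 (HahnSeries.single l 1) *
          ∑ i, substLin 1 (-1) (f i) * (hA i).toIter φ))).coeff n := by
  have hB := IsIterTruncated.sum Finset.univ fun i => (hA i).mul₂ (substLin 1 (-1) (f i))
  have h := hB.map_mul₂ (substLin 1 (-1) (HahnSeries.single l 1)) φ n m
  have hsum : hB.toIter φ = ∑ i, substLin 1 (-1) (f i) * (hA i).toIter φ :=
    (IsIterTruncated.toIter_sum Finset.univ (fun i => (hA i).mul₂ (substLin 1 (-1) (f i))) φ).trans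
      (Finset.sum_congr rfl fun i _ => (hA i).toIter_mul₂ _ φ)
  rw [hsum] at h
  rw [resY_inY_single_mul, show -1 - (-m - 1) = m by ring, substLin_neg_one_single, mul_assoc,
    coeff_inX_mul, HahnSeries.C_mul_eq_smul, HahnSeries.coeff_smul, map_smul, ← h, subPow_eq]
  simp only [subExpand_eq]

section Structure

variable (V : Submodule ℂ (VertexOperator ℂ W))

/-- The vertex operator map `Y(a, z) b = ∑ n, a(x)_n^e b(x) * z ^ (-n - 1)` on a space of pairwise
quasi compatible fields that is closed under the products. -/
def fieldY (hV : IsQuasiTrigCompatible (V : Set (VertexOperator ℂ W)))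
    (hmode : ∀ a ∈ V, ∀ b ∈ V, ∀ n, mode a b n ∈ V) : V →ₗ[ℂ] VertexOperator ℂ V where
  toFun a := VertexOperator.of_coeff
    (fun k =>
      { toFun := fun b => ⟨mode a b (-k - 1), hmode a a.2 b b.2 _⟩
        map_add' := fun b b' => Subtype.ext
          (mode_add_right (hV a a.2 b b.2) (hV a a.2 b' b'.2) _)
        map_smul' := fun c b => Subtype.ext (mode_smul_right (hV a a.2 b b.2) c _) })
    (fun b => by
      obtain ⟨K, hK⟩ := exists_mode_eq_zero (a : VertexOperator ℂ W) b
      exact bddBelow_support_of_forall_lt K fun k hk => Subtype.ext (hK k hk))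
  map_add' a a' := by
    refine HVertexOperator.coeff_inj ?_
    funext k
    ext1 b
    exact Subtype.ext (mode_add_left (hV a a.2 b b.2) (hV a' a'.2 b b.2) _)
  map_smul' c a := by
    refine HVertexOperator.coeff_inj ?_
    funext k
    ext1 b
    exact Subtype.ext (mode_smul_left (hV a a.2 b b.2) c _)

variable {V} (hV : IsQuasiTrigCompatible (V : Set (VertexOperator ℂ W)))
  (hmode : ∀ a ∈ V, ∀ b ∈ V, ∀ n, mode a b n ∈ V)

theorem coe_coeff_fieldY (a b : V) (k : ℤ) :
    (coeff (fieldY V hV hmode a) k b : VertexOperator ℂ W) = mode a b (-k - 1) := rfl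

/-- The coefficient of `x ^ N` in `φ(a(x) w)`, as a functional of the field `a(x)`. -/
def coeffDual (V : Submodule ℂ (VertexOperator ℂ W)) (φ : Module.Dual ℂ W) (w : W) (N : ℤ) :
    V →ₗ[ℂ] ℂ where
  toFun a := φ (coeff (a : VertexOperator ℂ W) N w)
  map_add' _ _ := map_add φ _ _
  map_smul' _ _ := map_smul φ _ _

theorem coeffDual_apply (φ : Module.Dual ℂ W) (w : W) (N : ℤ) (a : V) :
    coeffDual V φ w N a = φ (coeff (a : VertexOperator ℂ W) N w) := rfl

theorem eq_of_coeffDual {a b : V} (h : ∀ (φ : Module.Dual ℂ W) (w : W) (N : ℤ),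
    coeffDual V φ w N a = coeffDual V φ w N b) : a = b :=
  Subtype.ext (field_ext fun φ N w => h φ w N)

theorem isIterate_toIter (φ : Module.Dual ℂ W) (a b c : V) (w : W) (N : ℤ) :
    IsIterate φ a b c w N ((isIterTruncated_prod₂ (fieldY V hV hmode a) (fieldY V hV hmode b) c).toIter
      (coeffDual V φ w N)) := by
  intro k
  ext m
  rw [IsIterTruncated.coeff_toIter, coeff_modeSeries, coeffDual_apply, prod₂, coe_coeff_fieldY,
    coe_coeff_fieldY]

theorem exists_isDiagIterate (hV : IsQuasiTrigCompatible (V : Set (VertexOperator ℂ W)))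
    (hmode : ∀ a ∈ V, ∀ b ∈ V, ∀ n, mode a b n ∈ V) (φ : Module.Dual ℂ W) (a b c : V) (w : W) (N : ℤ) :
    ∃ G : IterLaurent, IsDiagIterate φ (a : VertexOperator ℂ W) b c w N G := by
  obtain ⟨K, hK⟩ := exists_mode_eq_zero (a : VertexOperator ℂ W) b
  refine ⟨IterLaurent.mk (fun k => modeSeries φ (mode a b (-k - 1)) c w N)
    (bddBelow_support_of_forall_lt K fun k hk => ?_), fun k => rfl⟩
  have h := hV _ (hmode _ a.2 _ b.2 (-k - 1)) _ c.2
  rw [hK k hk] at h ⊢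
  exact modeSeries_zero_left φ c w N h

theorem taylorCoeff_single (k : ℤ) (j : ℕ) :
    taylorCoeff 1 1 j (HahnSeries.single k 1)
      = HahnSeries.single (k - j) ((Ring.choose k j : ℤ) : ℂ) := by
  ext i
  rw [coeff_taylorCoeff]
  by_cases h : i = k - j
  · subst h
    rw [sub_add_cancel, HahnSeries.coeff_single_same, HahnSeries.coeff_single_same]
    simp
  · rw [HahnSeries.coeff_single_of_ne h, HahnSeries.coeff_single_of_ne (by omega), zero_mul]

theorem coeff_coeff_substLin_single_mul {X : IterLaurent} {K : ℤ} (hX : ∀ k < K, X.coeff k = 0)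
    (k t n : ℤ) {L : ℕ} (hL : t - K < L) :
    ((substLin 1 1 (HahnSeries.single k 1) * X).coeff t).coeff n
      = ∑ i ∈ Finset.range L,
          ((Ring.choose k i : ℤ) : ℂ) * (X.coeff (t - i)).coeff (n - (k - i)) := by
  rw [IterLaurent.coeff_mul_eq_sum _ _ _ ((Finset.range L).map Nat.castEmbedding), Finset.sum_map,
    HahnSeries.coeff_sum]
  · refine Finset.sum_congr rfl fun i _ => ?_
    rw [Nat.castEmbedding_apply, coeff_substLin_natCast, taylorCoeff_single]
    obtain ⟨n', rfl⟩ : ∃ n', n = n' + (k - i) := ⟨n - (k - i), by ring⟩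
    rw [HahnSeries.coeff_single_mul_add, add_sub_cancel_right]
  · intro p hp hq
    have hp0 : 0 ≤ p := by
      by_contra hlt
      exact hp (coeff_substLin_of_neg _ _ _ (by omega))
    lift p to ℕ using hp0
    rw [Finset.mem_map]
    refine ⟨p, ?_, rfl⟩
    rw [Finset.mem_range]
    by_contra hle
    exact hq (hX _ (by omega))

theorem choose_neg_sub_one (m : ℤ) (i : ℕ) :
    ((Ring.choose (-m - 1) i : ℤ) : ℂ) = (-1) ^ i * (Ring.choose (m + i) i : ℤ) := by
  rw [show -m - 1 = -(m + 1) by ring, Ring.choose_neg, Int.negOnePow_def,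
    show m + 1 + (i : ℤ) - 1 = m + i by ring]
  simp [Units.smul_def]

set_option maxHeartbeats 1000000 in
/-- The coefficients of the third term of the Jacobi identity. -/
theorem coeff_resY_diag {φ : Module.Dual ℂ W} {a b c : V} {w : W} {N : ℤ} {G : IterLaurent}
    (hG : IsDiagIterate φ (a : VertexOperator ℂ W) b c w N G) (l m n : ℤ) :
    (resY (inY (HahnSeries.single l 1) * (substLin 1 1 (HahnSeries.single (-m - 1) 1) * G))).coeff n
      = coeffDual V φ w N (∑ᶠ i : ℕ, ((-1 : ℂ) ^ i * (Ring.choose (m + i) i : ℤ)) •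
          coeff (fieldY V hV hmode (coeff (fieldY V hV hmode a) (-l - 1 - i) b)) (n + m + i + 1) c) := by
  obtain ⟨K, hK⟩ := exists_mode_eq_zero (a : VertexOperator ℂ W) b
  set L := (-1 - l - K).toNat + 1 with hL
  have hzero : ∀ i : ℕ, L ≤ i → coeff (fieldY V hV hmode a) (-l - 1 - i) b = 0 := fun i hi =>
    Subtype.ext (hK _ (by omega))
  have hG₀ : ∀ k < K, G.coeff k = 0 := fun k hk => by
    have h := hV _ (hmode _ a.2 _ b.2 (-k - 1)) _ c.2
    rw [hG k]
    rw [hK k hk] at h ⊢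
    exact modeSeries_zero_left φ c w N h
  have hsupp : (Function.support fun i : ℕ => ((-1 : ℂ) ^ i * (Ring.choose (m + i) i : ℤ)) •
      coeff (fieldY V hV hmode (coeff (fieldY V hV hmode a) (-l - 1 - i) b)) (n + m + i + 1) c)
      ⊆ Finset.range L := by
    intro i hi
    rw [Finset.mem_coe, Finset.mem_range]
    by_contra hle
    refine hi ?_
    simp only [hzero i (by omega), map_zero]
    exact smul_zero _
  rw [finsum_eq_sum_of_support_subset _ hsupp, map_sum, resY_inY_single_mul,
    coeff_coeff_substLin_single_mul hG₀ _ _ _ (L := L) (by omega)]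
  refine Finset.sum_congr rfl fun i _ => ?_
  have e₁ : -1 - l - (i : ℤ) = -l - 1 - i := by ring
  have e₂ : n - (-m - 1 - (i : ℤ)) = n + m + i + 1 := by ring
  rw [hG, e₁, e₂, choose_neg_sub_one, map_smul, smul_eq_mul, coeff_modeSeries, coeffDual_apply,
    coe_coeff_fieldY, coe_coeff_fieldY]

set_option maxHeartbeats 1000000 in
/-- The Jacobi identity for a space of mutually local fields; it is tested on the functionals that
extract a matrix coefficient of a field. -/
theorem field_jacobi (hX : SLocal (V : Set (VertexOperator ℂ W)) V) (a b : V) :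
    ∃ (r : ℕ) (u' v' : Fin r → V) (f : Fin r → LaurentSeries ℂ), ∀ (c : V) (l m n : ℤ),
      mul₂ (subPow l) (prod₂ (fieldY V hV hmode a) (fieldY V hV hmode b) c) m n
        - (-1 : ℂ) ^ l • mul₂ (subPow l) (∑ i, mul₂ (subExpand (f i))
            (prod₂ (fieldY V hV hmode (v' i)) (fieldY V hV hmode (u' i)) c)) n m
      = ∑ᶠ i : ℕ, ((-1 : ℂ) ^ i * (Ring.choose (m + i) i : ℤ)) •
          coeff (fieldY V hV hmode (coeff (fieldY V hV hmode a) (-l - 1 - i) b)) (n + m + i + 1) c := by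
  obtain ⟨ι, _, a', b', f, ha', hb', h⟩ := hX.exists_residue_identity hmode a.2 b.2
  let σ := (Fintype.equivFin ι).symm
  refine ⟨Fintype.card ι, fun i => ⟨a' (σ i), ha' _⟩, fun i => ⟨b' (σ i), hb' _⟩, fun i => f (σ i),
    fun c l m n => ?_⟩
  have hH : ∀ i, IsIterTruncated (prod₂ (fieldY V hV hmode ⟨b' i, hb' i⟩)
      (fieldY V hV hmode ⟨a' i, ha' i⟩) c) := fun i => isIterTruncated_prod₂ _ _ _
  refine eq_of_coeffDual fun φ w N => ?_
  obtain ⟨G', hG'⟩ := exists_isDiagIterate hV hmode φ a b c w N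
  have key := h c c.2 φ w N _ (fun i => (hH i).toIter (coeffDual V φ w N)) G'
    (isIterate_toIter hV hmode φ a b c w N)
    (fun i => isIterate_toIter hV hmode φ ⟨b' i, hb' i⟩ ⟨a' i, ha' i⟩ c w N) hG'
    (HahnSeries.single (-m - 1) 1) (HahnSeries.single l 1)
  rw [← Equiv.sum_comp σ] at key
  have key' := congrArg (fun F : LaurentSeries ℂ => F.coeff n) key
  simp only [HahnSeries.coeff_sub] at key'
  rw [coeff_resY_diag hV hmode hG', ← map_mul₂_subPow,
    ← map_mul₂_subPow_sum (fun i => hH (σ i)) (fun i => f (σ i)), ← map_sub] at key'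
  exact key'

end Structure

end Jacobi

/-! ### The weak quantum vertex algebra generated by a local set of fields -/

section Main

variable {W : Type*} [AddCommGroup W] [Module ℂ W]

/-- The weak quantum vertex algebra structure on a space of mutually local fields that contains
`1_W` and is closed under the products. -/
def fieldWeakQVA (V : Submodule ℂ (VertexOperator ℂ W))
    (hX : SLocal (V : Set (VertexOperator ℂ W)) V) (hone : oneField ∈ V)
    (hmode : ∀ a ∈ V, ∀ b ∈ V, ∀ n, mode a b n ∈ V) : WeakQVA V where
  vac := ⟨oneField, hone⟩
  Y := fieldY V hX.isQuasiTrigCompatible hmode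
  vacuum v n := by
    refine Subtype.ext ?_
    rw [coe_coeff_fieldY, mode_oneField_left]
    split_ifs <;> rfl
  creation v n hn := by
    refine Subtype.ext ?_
    rw [coe_coeff_fieldY, mode_oneField_right _ _ hn.le, if_neg hn.ne]
    rfl
  creation_zero v := by
    refine Subtype.ext ?_
    rw [coe_coeff_fieldY, mode_oneField_right _ _ le_rfl, if_pos rfl]
  jacobi a b := field_jacobi hX.isQuasiTrigCompatible hmode hX a b

theorem rescale_add (c : ℂˣ) (a b : VertexOperator ℂ W) :
    rescale c (a + b) = rescale c a + rescale c b := field_ext fun φ n w => by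
  simp only [coeff_rescale, coeff_add, smul_add]

theorem rescale_smul (c : ℂˣ) (r : ℂ) (a : VertexOperator ℂ W) :
    rescale c (r • a) = r • rescale c a := field_ext fun φ n w => by
  simp only [coeff_rescale, coeff_smul, smul_comm r]

theorem rescale_rescale_inv (c : ℂˣ) (a : VertexOperator ℂ W) : rescale c (rescale c⁻¹ a) = a := by
  have := rescale_inv_rescale c⁻¹ a
  rwa [inv_inv] at this

/-- The rescaling of the variable as a linear map on the space of fields. -/
def rescaleLinear (c : ℂˣ) : VertexOperator ℂ W →ₗ[ℂ] VertexOperator ℂ W where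
  toFun := rescale c
  map_add' := rescale_add c
  map_smul' := rescale_smul c

theorem rescale_oneField (c : ℂˣ) : rescale c (oneField : VertexOperator ℂ W) = oneField := by
  refine field_ext fun φ n w => ?_
  rw [coeff_rescale, LinearMap.smul_apply, coeff_oneField]
  split_ifs with h
  · rw [h, zpow_zero, one_smul]
  · rw [smul_zero]

theorem rescale_one (a : VertexOperator ℂ W) : rescale 1 a = a := by
  refine field_ext fun φ n w => ?_
  rw [coeff_rescale, Units.val_one, one_zpow, one_smul]

theorem rescale_mul (c d : ℂˣ) (a : VertexOperator ℂ W) :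
    rescale (c * d) a = rescale c (rescale d a) := by
  refine field_ext fun φ n w => ?_
  rw [coeff_rescale, coeff_rescale, coeff_rescale, Units.val_mul, mul_zpow, mul_smul]

theorem rescale_mem_generated {U : Set (VertexOperator ℂ W)} {c : ℂˣ}
    (hU : ∀ a ∈ U, rescale c a ∈ U) {a : VertexOperator ℂ W} (ha : a ∈ generated U) :
    rescale c a ∈ generated U := by
  rw [generated, Submodule.mem_sInf] at ha
  refine ha ((generated U).comap (rescaleLinear c)) ⟨?_, ?_, ?_⟩
  · exact fun u hu => subset_generated U (hU u hu)
  · change rescale c oneField ∈ generated U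
    rw [rescale_oneField]
    exact oneField_mem_generated U
  · intro a ha b hb n
    change rescale c (mode a b n) ∈ generated U
    rw [← mode_rescale]
    exact mode_mem_generated ha hb n

/-- The rescaling of the variable as a linear automorphism of the space generated by `U`. -/
def rescaleGenerated (U : Set (VertexOperator ℂ W)) (Γ : Subgroup ℂˣ)
    (hΓ : ∀ c ∈ Γ, ∀ a ∈ U, rescale c a ∈ U) (c : Γ) : generated U ≃ₗ[ℂ] generated U :=
  LinearEquiv.ofLinearMap
    ((rescaleLinear (c : ℂˣ)).restrict fun _ ha => rescale_mem_generated (hΓ c c.2) ha)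
    ((rescaleLinear ((c⁻¹ : Γ) : ℂˣ)).restrict fun _ ha =>
      rescale_mem_generated (hΓ _ (c⁻¹).2) ha)
    (LinearMap.ext fun a => Subtype.ext (rescale_rescale_inv (c : ℂˣ) (a : VertexOperator ℂ W)))
    (LinearMap.ext fun a => Subtype.ext (rescale_inv_rescale (c : ℂˣ) (a : VertexOperator ℂ W)))

end Main

end TrigQVA

theorem proposition4p11 {W : Type*} [AddCommGroup W] [Module ℂ W] (Γ : Subgroup ℂˣ)
    (U : Set (VertexOperator ℂ W)) (hU : TrigQVA.IsQuasiTrigLocal U)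
    (hΓ : ∀ c ∈ Γ, ∀ a ∈ U, TrigQVA.rescale c a ∈ U) :
    TrigQVA.IsQuasiTrigCompatible (TrigQVA.generated U : Set (VertexOperator ℂ W)) ∧
    ∃ 𝒱 : TrigQVA.WeakQVA (TrigQVA.generated U),
      (𝒱.vac : VertexOperator ℂ W) = TrigQVA.oneField ∧
      (∀ (a b : TrigQVA.generated U) (n : ℤ),
        (VertexOperator.ncoeff (𝒱.Y a) n b : VertexOperator ℂ W) = TrigQVA.mode a b n) ∧
      ∃ ρ : Γ →* 𝒱.aut, ∀ (c : Γ) (a : TrigQVA.generated U),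
        ((ρ c : TrigQVA.generated U ≃ₗ[ℂ] TrigQVA.generated U) a : VertexOperator ℂ W)
          = TrigQVA.rescale (c : ℂˣ) a := by
  have hX := hU.sLocal.generated
  refine ⟨hX.isQuasiTrigCompatible, TrigQVA.fieldWeakQVA (TrigQVA.generated U) hX
    (TrigQVA.oneField_mem_generated U) (fun a ha b hb n => TrigQVA.mode_mem_generated ha hb n),
    rfl, fun a b n => ?_,
    { toFun := fun c => ⟨TrigQVA.rescaleGenerated U Γ hΓ c, ?_, fun u v n => ?_⟩
      map_one' := ?_
      map_mul' := fun c d => ?_ }, fun c a => rfl⟩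
  · change TrigQVA.mode (a : VertexOperator ℂ W) b (-(-n - 1) - 1) = _
    rw [show -(-n - 1) - 1 = n by ring]
  · exact Subtype.ext (TrigQVA.rescale_oneField _)
  · exact Subtype.ext (TrigQVA.mode_rescale _ _ _ _).symm
  · refine Subtype.ext (LinearEquiv.ext fun a => Subtype.ext ?_)
    exact TrigQVA.rescale_one _
  · refine Subtype.ext (LinearEquiv.ext fun a => Subtype.ext ?_)
    exact TrigQVA.rescale_mul _ _ _
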